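/- Let $R$ be a discrete valuation ring, let $G$ be a flat affine $R$-group scheme (not necessarily of finite type), let $\theta\colon X\to\operatorname{Spec}R$ be an $R$-scheme and let $j\colon T\to X$ be a $G$-torsor: $T$ is an $R$-scheme with a right action $\sigma\colon T\times_R G\to T$, the morphism $j$ is faithfully flat, quasi-compact and $G$-invariant, and $(\sigma,\mathrm{pr}_T)\colon T\times_R G\to T\times_X T$ is an isomorphism. Assume that $H^0(T,\mathcal O_T)=R$, i.e. that $R\to H^0(T,\mathcal O_T)$ is an isomorphism. Assume moreover that $X$ satisfies one of the following two conditions: (a) $X$ is quasi-compact and quasi-separated; or (b) $X$ is integral, flat and locally of finite type over $R$, and its special fibre is integral. Let $\mathrm{Rep}^0_{R,tf}(G)$ be the category of $R$-linear representations of $G$ on finitely generated free $R$-modules, let $\mathrm{Vect}_X$ be the category of vector bundles (locally free $\mathcal O_X$-modules of finite rank, with all $\mathcal O_X$-linear maps) on $X$, let $G\text{-}\mathrm{Vect}_T$ be the category of vector bundles $\mathcal F$ on $T$ with a $G$-linearization $\sigma^*\mathcal F\cong\mathrm{pr}_T^*\mathcal F$, and let $\mathcal T\subset\mathrm{Vect}_X$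 be the full subcategory of the bundles $E$ trivialized by $T$, that is, $j^*E\cong\mathcal O_T^{\oplus n}$ for some $n\ge 0$. For a representation $V$, the bundle $(\theta\circ j)^*V$ on $T$ is linearized by the action of $G$ on $V$. Then the pull-back functor $j^*\colon\mathrm{Vect}_X\to G\text{-}\mathrm{Vect}_T$ is an equivalence of categories and, for every quasi-inverse $\rho$ of $j^*$, the functor $$F_T\colon V\longmapsto \rho\bigl((\theta\circ j)^*V\bigr)$$ takes its values in $\mathcal T$ and is an equivalence of categories $F_T\colon\mathrm{Rep}^0_{R,tf}(G)\to\mathcal T$. -/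

import Mathlib

open CategoryTheory AlgebraicGeometry MonoidalCategory CartesianMonoidalCategory Limits
open scoped TensorProduct
universe u

namespace TorsorRep

/-- The structure morphism `Y ⟶ S` of an `S`-scheme `Y`. -/
def str {S : Scheme.{u}} (Y : Over S) : Y.left ⟶ S := Y.hom

lemma str_w {S : Scheme.{u}} {Y' Y : Over S} (f : Y' ⟶ Y) : f.left ≫ str Y = str Y' := Over.w f

section PullbackCoherence

variable {X Y Z W : Scheme.{u}}

/-- The canonical isomorphism `f^* ∘ g^* ≅ k^*` attached to a factorisation `k = g ∘ f`. -/
noncomputable def pcomp (f : X ⟶ Y) (g : Y ⟶ Z) (k : X ⟶ Z) (h : f ≫ g = k) :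
    Scheme.Modules.pullback g ⋙ Scheme.Modules.pullback f ≅ Scheme.Modules.pullback k :=
  Scheme.Modules.pullbackComp f g ≪≫ Scheme.Modules.pullbackCongr h

lemma pcomp_rfl (f : X ⟶ Y) (g : Y ⟶ Z) :
    pcomp f g (f ≫ g) rfl = Scheme.Modules.pullbackComp f g := by
  ext1; simp [pcomp, Scheme.Modules.pullbackCongr]

lemma pcomp_assoc (f : X ⟶ Y) (g : Y ⟶ Z) (h : Z ⟶ W) (fg : X ⟶ Z) (gh : Y ⟶ W) (k : X ⟶ W)
    (h₁ : f ≫ g = fg) (h₂ : g ≫ h = gh) (h₃ : f ≫ gh = k) (h₄ : fg ≫ h = k) (M : W.Modules) :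
    (Scheme.Modules.pullback f).map ((pcomp g h gh h₂).hom.app M) ≫ (pcomp f gh k h₃).hom.app M =
      (pcomp f g fg h₁).hom.app ((Scheme.Modules.pullback h).obj M) ≫
        (pcomp fg h k h₄).hom.app M := by
  subst h₁ h₂ h₃
  have := congr_app (Scheme.Modules.pseudofunctor_associativity f g h) M
  simp only [NatTrans.comp_app, Functor.whiskerRight_app, Functor.whiskerLeft_app,
    Functor.associator_hom_app, Category.id_comp, eqToHom_app] at this
  have e : (pcomp (f ≫ g) h (f ≫ g ≫ h) h₄).hom.app M =
      (Scheme.Modules.pullbackComp (f ≫ g) h).hom.app M ≫ eqToHom (by rw [Category.assoc]) := by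
    simp [pcomp, Scheme.Modules.pullbackCongr]
  rw [e, pcomp_rfl, pcomp_rfl, pcomp_rfl]
  have e' : (Scheme.Modules.pullbackComp f g).hom.app ((Scheme.Modules.pullback h).obj M) ≫
      (Scheme.Modules.pullbackComp (f ≫ g) h).hom.app M =
        (Scheme.Modules.pullback f).map ((Scheme.Modules.pullbackComp g h).hom.app M) ≫
          (Scheme.Modules.pullbackComp f (g ≫ h)).hom.app M ≫
            eqToHom (by rw [Category.assoc]) := by
    rw [← this, Iso.hom_inv_id_app_assoc, ← Functor.map_comp_assoc, Iso.hom_inv_id_app]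
    simp
  rw [reassoc_of% e']
  simp

/-- Base change along `g : Y' ⟶ Y` of a morphism `f₁^* M₁ ⟶ f₂^* M₂` of modules on `Y`, as a
morphism `(f₁ ∘ g)^* M₁ ⟶ (f₂ ∘ g)^* M₂`. -/
noncomputable def baseChange {Y' Y X₁ X₂ : Scheme.{u}} {M₁ : X₁.Modules} {M₂ : X₂.Modules}
    {f₁ : Y ⟶ X₁} {f₂ : Y ⟶ X₂}
    (φ : (Scheme.Modules.pullback f₁).obj M₁ ⟶ (Scheme.Modules.pullback f₂).obj M₂)
    (g : Y' ⟶ Y) (k₁ : Y' ⟶ X₁) (k₂ : Y' ⟶ X₂) (h₁ : g ≫ f₁ = k₁) (h₂ : g ≫ f₂ = k₂) :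
    (Scheme.Modules.pullback k₁).obj M₁ ⟶ (Scheme.Modules.pullback k₂).obj M₂ :=
  (pcomp g f₁ k₁ h₁).inv.app M₁ ≫ (Scheme.Modules.pullback g).map φ ≫
    (pcomp g f₂ k₂ h₂).hom.app M₂

/-- Given `q ∘ a = r = q ∘ b`, an endomorphism of `r^* N` seen as a morphism
`a^* q^* N ⟶ b^* q^* N`. -/
noncomputable def transport {P T Z : Scheme.{u}} {q : T ⟶ Z} {a b : P ⟶ T} {r : P ⟶ Z}
    (ha : a ≫ q = r) (hb : b ≫ q = r) {N : Z.Modules}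
    (α : (Scheme.Modules.pullback r).obj N ⟶ (Scheme.Modules.pullback r).obj N) :
    (Scheme.Modules.pullback a).obj ((Scheme.Modules.pullback q).obj N) ⟶
      (Scheme.Modules.pullback b).obj ((Scheme.Modules.pullback q).obj N) :=
  (pcomp a q r ha).hom.app N ≫ α ≫ (pcomp b q r hb).inv.app N

lemma transport_comp {P T Z : Scheme.{u}} {q : T ⟶ Z} {a b c : P ⟶ T} {r : P ⟶ Z}
    (ha : a ≫ q = r) (hb : b ≫ q = r) (hc : c ≫ q = r) {N : Z.Modules}
    (α β : (Scheme.Modules.pullback r).obj N ⟶ (Scheme.Modules.pullback r).obj N) :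
    transport ha hb α ≫ transport hb hc β = transport ha hc (α ≫ β) := by
  simp [transport]

lemma transport_id {P T Z : Scheme.{u}} {q : T ⟶ Z} {a : P ⟶ T} {r : P ⟶ Z}
    (ha : a ≫ q = r) {N : Z.Modules} :
    transport (N := N) ha ha (𝟙 _) = 𝟙 _ := by
  simp [transport]

lemma transport_naturality {P T Z : Scheme.{u}} {q : T ⟶ Z} {a b : P ⟶ T} {r : P ⟶ Z}
    (ha : a ≫ q = r) (hb : b ≫ q = r) {N N' : Z.Modules} (f : N ⟶ N')
    (α : (Scheme.Modules.pullback r).obj N ⟶ (Scheme.Modules.pullback r).obj N)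
    (α' : (Scheme.Modules.pullback r).obj N' ⟶ (Scheme.Modules.pullback r).obj N')
    (h : (Scheme.Modules.pullback r).map f ≫ α' = α ≫ (Scheme.Modules.pullback r).map f) :
    (Scheme.Modules.pullback a).map ((Scheme.Modules.pullback q).map f) ≫ transport ha hb α' =
      transport ha hb α ≫ (Scheme.Modules.pullback b).map ((Scheme.Modules.pullback q).map f) := by
  have e₁ := (pcomp a q r ha).hom.naturality f
  have e₂ := (pcomp b q r hb).inv.naturality f
  dsimp at e₁ e₂
  simp only [transport, Category.assoc]
  rw [reassoc_of% e₁, reassoc_of% h, e₂]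

lemma baseChange_transport {P' P T Z : Scheme.{u}} {q : T ⟶ Z} {a b : P ⟶ T} {r : P ⟶ Z}
    (ha : a ≫ q = r) (hb : b ≫ q = r) {N : Z.Modules}
    (α : (Scheme.Modules.pullback r).obj N ⟶ (Scheme.Modules.pullback r).obj N)
    (g : P' ⟶ P) (a' b' : P' ⟶ T) (r' : P' ⟶ Z) (ha' : g ≫ a = a') (hb' : g ≫ b = b')
    (hr : g ≫ r = r') (ha'' : a' ≫ q = r') (hb'' : b' ≫ q = r') :
    baseChange (transport ha hb α) g a' b' ha' hb' =
      transport ha'' hb'' (baseChange α g r' r' hr hr) := by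
  have e₁ := pcomp_assoc g a q a' r r' ha' ha hr ha'' N
  have e₂ := pcomp_assoc g b q b' r r' hb' hb hr hb'' N
  simp only [transport, baseChange, Functor.map_comp, Category.assoc]
  rw [← cancel_epi ((pcomp g a a' ha').hom.app _)]
  rw [← cancel_mono ((pcomp b' q r' hb'').hom.app _)]
  simp only [Iso.hom_inv_id_app_assoc, Category.assoc, ← e₂, Iso.inv_hom_id_app,
    ← Functor.map_comp_assoc]
  rw [← reassoc_of% e₁]
  simp

lemma baseChange_id {Y' Y X : Scheme.{u}} {M : X.Modules} {f : Y ⟶ X}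
    (g : Y' ⟶ Y) (k : Y' ⟶ X) (h : g ≫ f = k) :
    baseChange (𝟙 ((Scheme.Modules.pullback f).obj M)) g k k h h = 𝟙 _ := by
  simp [baseChange]

lemma baseChange_refl_cocycle {Q P Z : Scheme.{u}} {N : Z.Modules} {r : P ⟶ Z} (a b c : Q ⟶ P)
    (r' : Q ⟶ Z) (ha : a ≫ r = r') (hb : b ≫ r = r') (hc : c ≫ r = r') :
    baseChange (Iso.refl ((Scheme.Modules.pullback r).obj N)).hom a r' r' ha ha =
      baseChange (Iso.refl ((Scheme.Modules.pullback r).obj N)).hom b r' r' hb hb ≫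
        baseChange (Iso.refl ((Scheme.Modules.pullback r).obj N)).hom c r' r' hc hc :=
  (baseChange_id a r' ha).trans ((Category.comp_id _).symm.trans
    (congr_arg₂ (· ≫ ·) (baseChange_id b r' hb).symm (baseChange_id c r' hc).symm))

lemma baseChange_eq {Y' Y Z : Scheme.{u}} {M : Z.Modules} {f : Y ⟶ Z} {g : Y' ⟶ Y} {k : Y' ⟶ Z}
    (h : g ≫ f = k)
    (i : (Scheme.Modules.pullback g).obj ((Scheme.Modules.pullback f).obj M) ≅
      (Scheme.Modules.pullback k).obj M) (hi : i.hom = (pcomp g f k h).hom.app M)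
    (φ : (Scheme.Modules.pullback f).obj M ⟶ (Scheme.Modules.pullback f).obj M) :
    baseChange φ g k k h h = i.inv ≫ (Scheme.Modules.pullback g).map φ ≫ i.hom := by
  have : i = (pcomp g f k h).app M := Iso.ext hi
  subst this
  rfl

lemma unit_pcomp (f : X ⟶ Y) (g : Y ⟶ Z) (k : X ⟶ Z) (h : f ≫ g = k) (N : Z.Modules)
    (x : Γ(N, ⊤)) :
    ((pcomp f g k h).hom.app N).app ⊤
      (((Scheme.Modules.pullbackPushforwardAdjunction f).unit.app
          ((Scheme.Modules.pullback g).obj N)).app ⊤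
        (((Scheme.Modules.pullbackPushforwardAdjunction g).unit.app N).app ⊤ x)) =
      ((Scheme.Modules.pullbackPushforwardAdjunction k).unit.app N).app ⊤ x := by
  subst h
  rw [pcomp_rfl]
  have := unit_conjugateEquiv ((Scheme.Modules.pullbackPushforwardAdjunction g).comp
    (Scheme.Modules.pullbackPushforwardAdjunction f))
    (Scheme.Modules.pullbackPushforwardAdjunction (f ≫ g))
    (Scheme.Modules.pullbackComp f g).inv N
  rw [Scheme.Modules.conjugateEquiv_pullbackComp_inv] at this
  have h2 := congr($this ≫ (Scheme.Modules.pushforward (f ≫ g)).map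
    ((Scheme.Modules.pullbackComp f g).hom.app N))
  rw [Category.assoc, Category.assoc, ← Functor.map_comp, Iso.inv_hom_id_app,
    CategoryTheory.Functor.map_id] at h2
  replace h2 := h2.trans (Category.comp_id _)
  exact congr((Scheme.Modules.Hom.app $h2 ⊤) x)

end PullbackCoherence

section Sections

variable {R : CommRingCat.{u}}

/-- The ring `Γ(Y, 𝒪_Y)` of an `R`-scheme `Y`, as an `R`-algebra. -/
def GlobalFunctions (Y : Over (Spec R)) : Type u := Γ(Y.left, ⊤)

noncomputable instance (Y : Over (Spec R)) : CommRing (GlobalFunctions Y) :=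
  inferInstanceAs (CommRing Γ(Y.left, ⊤))

noncomputable instance (Y : Over (Spec R)) : Algebra R (GlobalFunctions Y) :=
  RingHom.toAlgebra ((Scheme.ΓSpecIso R).inv ≫ (str Y).appTop).hom

/-- Pull-back of functions along a morphism of `R`-schemes. -/
noncomputable def pullFunctions {Y' Y : Over (Spec R)} (f : Y' ⟶ Y) :
    GlobalFunctions Y →ₐ[R] GlobalFunctions Y' where
  __ := f.left.appTop.hom
  commutes' r := by
    change f.left.appTop.hom (((Scheme.ΓSpecIso R).inv ≫
      (str Y).appTop).hom r) = ((Scheme.ΓSpecIso R).inv ≫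
      (str Y').appTop).hom r
    have : (str Y).appTop ≫ f.left.appTop =
        (str Y').appTop := by
      rw [← Scheme.Hom.comp_appTop, str_w]
    rw [← this]
    rfl

/-- The functor `V ↦ Ṽ` from `R`-modules to modules on `Spec R`. -/
noncomputable def tildeFunctor (R : CommRingCat.{u}) : ModuleCat.{u} R ⥤ (Spec R).Modules :=
  tilde.functor R

/-- The functor of global sections, from modules on `Spec R` to `R`-modules. -/
noncomputable def specΓ (R : CommRingCat.{u}) : (Spec R).Modules ⥤ ModuleCat.{u} R :=
  moduleSpecΓFunctor

/-- `V ↦ Ṽ` is left adjoint to global sections. -/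
noncomputable def tildeAdj (R : CommRingCat.{u}) : tildeFunctor R ⊣ specΓ R :=
  tilde.adjunction

/-- The functor `V ↦ θ^* Ṽ` from `R`-modules to modules on an `R`-scheme `θ : Y ⟶ Spec R`. -/
noncomputable def pullTilde (Y : Over (Spec R)) : ModuleCat.{u} R ⥤ Y.left.Modules :=
  tildeFunctor R ⋙ Scheme.Modules.pullback (str Y)

/-- The functor of global sections, from modules on an `R`-scheme to `R`-modules. -/
noncomputable def sec (Y : Over (Spec R)) : Y.left.Modules ⥤ ModuleCat.{u} R :=
  Scheme.Modules.pushforward (str Y) ⋙ specΓ R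

/-- `V ↦ θ^* Ṽ` is left adjoint to global sections. -/
noncomputable def pullTildeAdj (Y : Over (Spec R)) : pullTilde Y ⊣ sec Y :=
  (tildeAdj R).comp (Scheme.Modules.pullbackPushforwardAdjunction (str Y))

noncomputable instance (Y : Over (Spec R)) (M : Y.left.Modules) :
    Module (GlobalFunctions Y) ((sec Y).obj M) :=
  inferInstanceAs (Module Γ(Y.left, ⊤) Γ(M, ⊤))

instance (Y : Over (Spec R)) (M : Y.left.Modules) :
    IsScalarTower R (GlobalFunctions Y) ((sec Y).obj M) :=
  .of_algebraMap_smul fun r x ↦ by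
    rfl

/-- The canonical `R`-linear map `V ⟶ Γ(Y, θ^* Ṽ)`. -/
noncomputable def toSec (Y : Over (Spec R)) (V : ModuleCat.{u} R) :
    V →ₗ[R] (sec Y).obj ((pullTilde Y).obj V) :=
  ((pullTildeAdj Y).unit.app V).hom

/-- The canonical map `Γ(Y, 𝒪_Y) ⊗ V ⟶ Γ(Y, θ^* Ṽ)`. -/
noncomputable def tensorToSec (Y : Over (Spec R)) (V : ModuleCat.{u} R) :
    GlobalFunctions Y ⊗[R] V →ₗ[GlobalFunctions Y] (sec Y).obj ((pullTilde Y).obj V) :=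
  (toSec Y V).liftBaseChange (GlobalFunctions Y)

/-- The morphism of `𝒪_Y`-modules `θ^* Ṽ ⟶ θ^* W̃` induced by a `Γ(Y, 𝒪_Y)`-linear map
`Γ(Y, 𝒪_Y) ⊗ V ⟶ Γ(Y, 𝒪_Y) ⊗ W`. -/
noncomputable def sheafHom {Y : Over (Spec R)} {V W : ModuleCat.{u} R}
    (a : GlobalFunctions Y ⊗[R] V →ₗ[GlobalFunctions Y] GlobalFunctions Y ⊗[R] W) :
    (pullTilde Y).obj V ⟶ (pullTilde Y).obj W :=
  letI s : V →ₗ[R] (sec Y).obj ((pullTilde Y).obj W) :=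
    (tensorToSec Y W ∘ₗ a).restrictScalars R ∘ₗ TensorProduct.mk R (GlobalFunctions Y) V 1
  letI t : V ⟶ ModuleCat.of R ((sec Y).obj ((pullTilde Y).obj W)) := ModuleCat.ofHom s
  ((pullTildeAdj Y).homEquiv V _).symm t

lemma sec_map_smul {Y : Over (Spec R)} {M N : Y.left.Modules} (φ : M ⟶ N)
    (b : GlobalFunctions Y) (x : (sec Y).obj M) :
    (sec Y).map φ (b • x) = b • (sec Y).map φ x :=
  Scheme.Modules.Hom.app_smul φ (U := ⊤) b x

lemma homEquiv_apply {Y : Over (Spec R)} {V : ModuleCat.{u} R} {M : Y.left.Modules}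
    (φ : (pullTilde Y).obj V ⟶ M) (v : V) :
    (pullTildeAdj Y).homEquiv V M φ v = (sec Y).map φ (toSec Y V v) := by
  rw [Adjunction.homEquiv_unit]
  rfl

lemma pullTilde_hom_ext {Y : Over (Spec R)} {V : ModuleCat.{u} R} {M : Y.left.Modules}
    {φ ψ : (pullTilde Y).obj V ⟶ M}
    (h : ∀ v : V, (sec Y).map φ (toSec Y V v) = (sec Y).map ψ (toSec Y V v)) : φ = ψ := by
  apply ((pullTildeAdj Y).homEquiv V M).injective
  ext v
  rw [homEquiv_apply, homEquiv_apply, h]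

lemma sec_map_sheafHom_toSec {Y : Over (Spec R)} {V W : ModuleCat.{u} R}
    (a : GlobalFunctions Y ⊗[R] V →ₗ[GlobalFunctions Y] GlobalFunctions Y ⊗[R] W) (v : V) :
    (sec Y).map (sheafHom a) (toSec Y V v) = tensorToSec Y W (a (1 ⊗ₜ v)) := by
  rw [← homEquiv_apply, sheafHom, Equiv.apply_symm_apply]
  rfl

lemma tensorToSec_tmul (Y : Over (Spec R)) (V : ModuleCat.{u} R) (b : GlobalFunctions Y) (v : V) :
    tensorToSec Y V (b ⊗ₜ v) = b • toSec Y V v := by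
  simp [tensorToSec]

lemma sec_map_sheafHom {Y : Over (Spec R)} {V W : ModuleCat.{u} R}
    (a : GlobalFunctions Y ⊗[R] V →ₗ[GlobalFunctions Y] GlobalFunctions Y ⊗[R] W)
    (x : GlobalFunctions Y ⊗[R] V) :
    (sec Y).map (sheafHom a) (tensorToSec Y V x) = tensorToSec Y W (a x) := by
  induction x with
  | zero => simp
  | add x y hx hy => simp only [map_add, hx, hy]
  | tmul b v =>
    rw [tensorToSec_tmul, sec_map_smul, sec_map_sheafHom_toSec, ← map_smul, ← map_smul,
      TensorProduct.smul_tmul', smul_eq_mul, mul_one]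

lemma sheafHom_comp {Y : Over (Spec R)} {V W U : ModuleCat.{u} R}
    (a : GlobalFunctions Y ⊗[R] V →ₗ[GlobalFunctions Y] GlobalFunctions Y ⊗[R] W)
    (b : GlobalFunctions Y ⊗[R] W →ₗ[GlobalFunctions Y] GlobalFunctions Y ⊗[R] U) :
    sheafHom (b ∘ₗ a) = sheafHom a ≫ sheafHom b := by
  apply pullTilde_hom_ext
  intro v
  rw [Functor.map_comp, ModuleCat.comp_apply, sec_map_sheafHom_toSec, sec_map_sheafHom_toSec,
    sec_map_sheafHom]
  rfl

lemma sheafHom_id (Y : Over (Spec R)) (V : ModuleCat.{u} R) :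
    sheafHom (Y := Y) (V := V) LinearMap.id = 𝟙 _ := by
  apply pullTilde_hom_ext
  intro v
  rw [CategoryTheory.Functor.map_id, ModuleCat.id_apply, sec_map_sheafHom_toSec, LinearMap.id_apply,
    tensorToSec_tmul, one_smul]

lemma sheafHom_baseChange (Y : Over (Spec R)) {V W : ModuleCat.{u} R} (f : V ⟶ W) :
    sheafHom (f.hom.baseChange (GlobalFunctions Y)) = (pullTilde Y).map f := by
  apply pullTilde_hom_ext
  intro v
  rw [sec_map_sheafHom_toSec, LinearMap.baseChange_tmul, tensorToSec_tmul, one_smul]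
  exact congr($((pullTildeAdj Y).unit.naturality f) v)

/-- Pull-back of global sections of a module along a morphism of `R`-schemes. -/
noncomputable def pullSec {Y' Y : Over (Spec R)} (f : Y' ⟶ Y) (M : Y.left.Modules) :
    (sec Y).obj M →+ (sec Y').obj ((Scheme.Modules.pullback f.left).obj M) :=
  (Scheme.Modules.Hom.app
    ((Scheme.Modules.pullbackPushforwardAdjunction f.left).unit.app M) ⊤).hom

lemma pullSec_smul {Y' Y : Over (Spec R)} (f : Y' ⟶ Y) (M : Y.left.Modules)
    (b : GlobalFunctions Y) (x : (sec Y).obj M) :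
    pullSec f M (b • x) = pullFunctions f b • pullSec f M x :=
  Scheme.Modules.Hom.app_smul ((Scheme.Modules.pullbackPushforwardAdjunction f.left).unit.app M)
    (U := ⊤) b x

lemma pullSec_naturality {Y' Y : Over (Spec R)} (f : Y' ⟶ Y) {M N : Y.left.Modules} (φ : M ⟶ N)
    (x : (sec Y).obj M) :
    (sec Y').map ((Scheme.Modules.pullback f.left).map φ) (pullSec f M x) =
      pullSec f N ((sec Y).map φ x) := by
  have := (Scheme.Modules.pullbackPushforwardAdjunction f.left).unit.naturality φ
  exact congr((Scheme.Modules.Hom.app $this.symm ⊤) x)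

/-- The canonical isomorphism `f^* θ^* Ṽ ≅ θ'^* Ṽ` for a morphism `f : Y' ⟶ Y` of
`R`-schemes. -/
noncomputable def pullTildeIso {Y' Y : Over (Spec R)} (f : Y' ⟶ Y) (V : ModuleCat.{u} R) :
    (Scheme.Modules.pullback f.left).obj ((pullTilde Y).obj V) ≅ (pullTilde Y').obj V :=
  Iso.app (F := Scheme.Modules.pullback (str Y) ⋙ Scheme.Modules.pullback f.left)
    (G := Scheme.Modules.pullback (str Y'))
    (pcomp f.left (str Y) (str Y') (str_w f)) ((tildeFunctor R).obj V)

lemma toSec_apply (Y : Over (Spec R)) (V : ModuleCat.{u} R) (v : V) :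
    toSec Y V v = ((Scheme.Modules.pullbackPushforwardAdjunction (str Y)).unit.app
      ((tildeFunctor R).obj V)).app ⊤ ((tildeAdj R).unit.app V v) := rfl

lemma sec_map_apply {Y : Over (Spec R)} {M N : Y.left.Modules} (φ : M ⟶ N)
    (x : (sec Y).obj M) : (sec Y).map φ x = φ.app ⊤ x := rfl

lemma pullSec_apply {Y' Y : Over (Spec R)} (f : Y' ⟶ Y) (M : Y.left.Modules)
    (x : (sec Y).obj M) : pullSec f M x = (Scheme.Modules.Hom.app
    ((Scheme.Modules.pullbackPushforwardAdjunction f.left).unit.app M) ⊤) x := rfl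


lemma pullTildeIso_hom {Y' Y : Over (Spec R)} (f : Y' ⟶ Y) (V : ModuleCat.{u} R) :
    (pullTildeIso f V).hom =
      (pcomp f.left (str Y) (str Y') (str_w f)).hom.app ((tildeFunctor R).obj V) :=
  Iso.app_hom (pcomp f.left (str Y) (str Y') (str_w f)) ((tildeFunctor R).obj V)

lemma sec_map_pullTildeIso {Y' Y : Over (Spec R)} (f : Y' ⟶ Y) (V : ModuleCat.{u} R)
    (x : (sec Y').obj ((Scheme.Modules.pullback f.left).obj ((pullTilde Y).obj V))) :
    (sec Y').map (pullTildeIso f V).hom x = ((pcomp f.left (str Y) (str Y')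
      (str_w f)).hom.app ((tildeFunctor R).obj V)).app ⊤ x :=
  (sec_map_apply (pullTildeIso f V).hom x).trans
    (congrArg (fun φ ↦ @Scheme.Modules.Hom.app _ ((Scheme.Modules.pullback f.left).obj
      ((pullTilde Y).obj V)) ((pullTilde Y').obj V) φ ⊤ x) (pullTildeIso_hom f V))

lemma pullSec_toSec_aux {Y' Y : Over (Spec R)} (f : Y' ⟶ Y) (V : ModuleCat.{u} R) (v : V) :
   pullSec f _ (toSec Y V v) =  ((Scheme.Modules.pullbackPushforwardAdjunction f.left).unit.app
          ((Scheme.Modules.pullback (str Y)).obj ((tildeFunctor R).obj V))).app ⊤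
        (((Scheme.Modules.pullbackPushforwardAdjunction (str Y)).unit.app ((tildeFunctor R).obj V)).app ⊤ ((tildeAdj R).unit.app V v)) := by
   exact (congrArg (pullSec f ((pullTilde Y).obj V)) (toSec_apply Y V v)).trans (pullSec_apply _ _ _)

lemma pullSec_toSec {Y' Y : Over (Spec R)} (f : Y' ⟶ Y) (V : ModuleCat.{u} R) (v : V) :
    (sec Y').map (pullTildeIso f V).hom
      (pullSec f _ (toSec Y V v)) = toSec Y' V v := by
  have := unit_pcomp f.left (str Y) (str Y') (str_w f) ((tildeFunctor R).obj V)
    ((tildeAdj R).unit.app V v)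
  rw [toSec_apply Y', ← this, pullSec_toSec_aux]
  have := sec_map_pullTildeIso f V (((Scheme.Modules.pullbackPushforwardAdjunction f.left).unit.app
          ((Scheme.Modules.pullback (str Y)).obj ((tildeFunctor R).obj V))).app ⊤
        (((Scheme.Modules.pullbackPushforwardAdjunction (str Y)).unit.app ((tildeFunctor R).obj V)).app ⊤ ((tildeAdj R).unit.app V v)))
  exact this

lemma baseChange_sheafHom {Y' Y : Over (Spec R)} (f : Y' ⟶ Y) {V W : ModuleCat.{u} R}
    (a : GlobalFunctions Y ⊗[R] V →ₗ[GlobalFunctions Y] GlobalFunctions Y ⊗[R] W)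
    (a' : GlobalFunctions Y' ⊗[R] V →ₗ[GlobalFunctions Y'] GlobalFunctions Y' ⊗[R] W)
    (h : ∀ x, a' ((pullFunctions f).toLinearMap.rTensor V x) =
      (pullFunctions f).toLinearMap.rTensor W (a x)) :
    (pullTildeIso f V).inv ≫ (Scheme.Modules.pullback f.left).map (sheafHom a) ≫
      (pullTildeIso f W).hom = sheafHom a' := by
  have key (x : GlobalFunctions Y ⊗[R] W) :
      (sec Y').map (pullTildeIso f W).hom
        (pullSec f _ (tensorToSec Y W x)) =
        tensorToSec Y' W ((pullFunctions f).toLinearMap.rTensor W x) := by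
    induction x with
    | zero => simp
    | add x y hx hy => simp only [map_add, hx, hy]
    | tmul b w =>
      rw [LinearMap.rTensor_tmul, tensorToSec_tmul, tensorToSec_tmul, pullSec_smul, sec_map_smul,
        pullSec_toSec]
      rfl
  apply pullTilde_hom_ext
  intro v
  rw [sec_map_sheafHom_toSec]
  have h1 := h (1 ⊗ₜ v)
  rw [LinearMap.rTensor_tmul, AlgHom.toLinearMap_apply, map_one] at h1
  rw [h1, ← key, ← sec_map_sheafHom_toSec, ← pullSec_naturality, ← pullSec_toSec f V v]
  simp only [← ModuleCat.comp_apply, ← Functor.map_comp, Iso.hom_inv_id_assoc]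

/-- The isomorphism `pullTildeIso` with `θ^* Ṽ` written out. -/
noncomputable def tildeIso {Y' Y : Over (Spec R)} (f : Y' ⟶ Y) (V : ModuleCat.{u} R) :
    (Scheme.Modules.pullback f.left).obj
        ((Scheme.Modules.pullback (str Y)).obj ((tildeFunctor R).obj V)) ≅
      (Scheme.Modules.pullback (str Y')).obj ((tildeFunctor R).obj V) :=
  pullTildeIso f V

lemma tildeIso_hom {Y' Y : Over (Spec R)} (f : Y' ⟶ Y) (h : f.left ≫ str Y = str Y')
    (V : ModuleCat.{u} R) :
    (tildeIso f V).hom = (pcomp f.left (str Y) (str Y') h).hom.app ((tildeFunctor R).obj V) := by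
  have e : h = str_w f := rfl
  subst e
  exact pullTildeIso_hom f V

/-- The morphism `sheafHom` with `θ^* Ṽ` and `θ^* W̃` written out. -/
noncomputable def tildeHom {Y : Over (Spec R)} {V W : ModuleCat.{u} R}
    (a : GlobalFunctions Y ⊗[R] V →ₗ[GlobalFunctions Y] GlobalFunctions Y ⊗[R] W) :
    (Scheme.Modules.pullback (str Y)).obj ((tildeFunctor R).obj V) ⟶
      (Scheme.Modules.pullback (str Y)).obj ((tildeFunctor R).obj W) :=
  sheafHom a

lemma tildeHom_comp {Y : Over (Spec R)} {V W U : ModuleCat.{u} R}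
    (a : GlobalFunctions Y ⊗[R] V →ₗ[GlobalFunctions Y] GlobalFunctions Y ⊗[R] W)
    (b : GlobalFunctions Y ⊗[R] W →ₗ[GlobalFunctions Y] GlobalFunctions Y ⊗[R] U) :
    tildeHom (b ∘ₗ a) = tildeHom a ≫ tildeHom b :=
  sheafHom_comp a b

lemma tildeHom_id (Y : Over (Spec R)) (V : ModuleCat.{u} R) :
    tildeHom (Y := Y) (V := V) LinearMap.id = 𝟙 _ :=
  sheafHom_id Y V

lemma tildeHom_baseChange (Y : Over (Spec R)) {V W : ModuleCat.{u} R} (f : V ⟶ W) :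
    tildeHom (f.hom.baseChange (GlobalFunctions Y)) =
      (Scheme.Modules.pullback (str Y)).map ((tildeFunctor R).map f) :=
  sheafHom_baseChange Y f

lemma tildeIso_tildeHom {Y' Y : Over (Spec R)} (f : Y' ⟶ Y) {V W : ModuleCat.{u} R}
    (a : GlobalFunctions Y ⊗[R] V →ₗ[GlobalFunctions Y] GlobalFunctions Y ⊗[R] W)
    (a' : GlobalFunctions Y' ⊗[R] V →ₗ[GlobalFunctions Y'] GlobalFunctions Y' ⊗[R] W)
    (h : ∀ x, a' ((pullFunctions f).toLinearMap.rTensor V x) =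
      (pullFunctions f).toLinearMap.rTensor W (a x)) :
    (tildeIso f V).inv ≫ (Scheme.Modules.pullback f.left).map (tildeHom a) ≫
      (tildeIso f W).hom = tildeHom a' :=
  baseChange_sheafHom f a a' h

end Sections


section VectorBundles

/-- A module on a scheme is a vector bundle if every point has an open neighbourhood on which it
is isomorphic to `𝒪^n` for some natural number `n`. -/
def IsVectorBundle {X : Scheme.{u}} : ObjectProperty X.Modules := fun E ↦
  ∀ x : X, ∃ (U : X.Opens) (n : ℕ), x ∈ U ∧
    Nonempty ((Scheme.Modules.pullback U.ι).obj E ≅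
      SheafOfModules.free (R := (U : Scheme.{u}).ringCatSheaf) (ULift.{u} (Fin n)))

instance opensMap_final {X Y : Scheme.{u}} (f : X ⟶ Y) :
    (TopologicalSpace.Opens.map f.base).Final where
  out U := by
    let t : StructuredArrow U (TopologicalSpace.Opens.map f.base) :=
      StructuredArrow.mk (Y := ⊤) (homOfLE (fun _ _ ↦ trivial))
    have : Nonempty (StructuredArrow U (TopologicalSpace.Opens.map f.base)) := ⟨t⟩
    exact zigzag_isConnected fun a b ↦
      (Zigzag.of_hom (StructuredArrow.homMk (homOfLE le_top) (Subsingleton.elim _ _) : a ⟶ t)).trans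
        (Zigzag.of_inv (StructuredArrow.homMk (homOfLE le_top) (Subsingleton.elim _ _) : b ⟶ t))

/-- The pull-back of `𝒪^I` is `𝒪^I`. -/
noncomputable def pullbackFree {X Y : Scheme.{u}} (f : X ⟶ Y) (I : Type u) :
    (Scheme.Modules.pullback f).obj (SheafOfModules.free (R := Y.ringCatSheaf) I) ≅
      (SheafOfModules.free (R := X.ringCatSheaf) I) :=
  haveI : (SheafOfModules.pushforward.{u} f.toRingCatSheafHom).IsRightAdjoint :=
    (Scheme.Modules.pullbackPushforwardAdjunction f).isRightAdjoint
  SheafOfModules.pullbackObjFreeIso f.toRingCatSheafHom I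

lemma IsVectorBundle.pullback {X Y : Scheme.{u}} (f : X ⟶ Y) {E : Y.Modules}
    (hE : IsVectorBundle E) : IsVectorBundle ((Scheme.Modules.pullback f).obj E) := by
  intro x
  obtain ⟨U, n, hx, ⟨e⟩⟩ := hE (f x)
  refine ⟨f ⁻¹ᵁ U, n, hx, ⟨?_⟩⟩
  exact (Scheme.Modules.pullbackComp (f ⁻¹ᵁ U).ι f).app E ≪≫
    (pcomp (f ∣_ U) U.ι _ (morphismRestrict_ι f U)).symm.app E ≪≫
    (Scheme.Modules.pullback (f ∣_ U)).mapIso e ≪≫ pullbackFree _ _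

lemma isVectorBundle_of_iso_free {X : Scheme.{u}} {E : X.Modules} (n : ℕ)
    (e : E ≅ SheafOfModules.free (R := X.ringCatSheaf) (ULift.{u} (Fin n))) : IsVectorBundle E :=
  fun _ ↦ ⟨⊤, n, trivial, ⟨(Scheme.Modules.pullback _).mapIso e ≪≫ pullbackFree _ _⟩⟩

/-- The category of vector bundles on a scheme, with all `𝒪_X`-linear maps as morphisms. -/
abbrev Vect (X : Scheme.{u}) := (IsVectorBundle (X := X)).FullSubcategory

lemma isVectorBundle_pullTilde {R : CommRingCat.{u}} (Y : Over (Spec R)) (V : ModuleCat.{u} R)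
    [Module.Free R V] [Module.Finite R V] : IsVectorBundle ((pullTilde Y).obj V) := by
  let ι := Module.Free.ChooseBasisIndex R V
  have e : V ≅ ModuleCat.of R (ι →₀ R) := (Module.Free.chooseBasis R V).repr.toModuleIso
  have e' : (ULift.{u} (Fin (Fintype.card ι))) ≃ ι := Equiv.ulift.trans (Fintype.equivFin ι).symm
  refine isVectorBundle_of_iso_free (Fintype.card ι) ?_
  exact (pullTilde Y).mapIso (e ≪≫ (Finsupp.domLCongr (R := R) e'.symm).toModuleIso) ≪≫
    (Scheme.Modules.pullback (str Y)).mapIso (tildeFinsupp _) ≪≫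
    pullbackFree (str Y) _

end VectorBundles

section Torsors

open MonObj

variable {S : Scheme.{u}}

/-- A right action `T × G ⟶ T` of a group scheme `G` on a scheme `T` over `S`. -/
structure RightAction (G T : Over S) [GrpObj G] where
  /-- the action `(t, g) ↦ t g` -/
  act : T ⊗ G ⟶ T
  act_one : ∀ (Y : Over S) (t : Y ⟶ T), lift t 1 ≫ act = t
  act_mul : ∀ (Y : Over S) (t : Y ⟶ T) (g h : Y ⟶ G),
    lift t (g * h) ≫ act = lift (lift t g ≫ act) h ≫ act

variable {G T X : Over S} [GrpObj G]

/-- `j : T ⟶ X` is a `G`-torsor for the right action `σ`: it is faithfully flat and quasi-compact,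
`G`-invariant, and `(σ, pr_T) : T × G ⟶ T ×_X T` is an isomorphism. -/
structure IsTorsor (σ : RightAction G T) (j : T ⟶ X) : Prop where
  flat : Flat j.left
  surjective : Surjective j.left
  quasiCompact : QuasiCompact j.left
  invariant : σ.act ≫ j = fst T G ≫ j
  isIso : IsIso (pullback.lift σ.act (fst T G) invariant : T ⊗ G ⟶ pullback j j)

variable (σ : RightAction G T)

namespace RightAction

/-- The map `(t, g, h) ↦ (t, g)`. -/
noncomputable def firstPair (_ : RightAction G T) : (T ⊗ G) ⊗ G ⟶ T ⊗ G := fst (T ⊗ G) G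

/-- The map `(t, g, h) ↦ (t g, h)`. -/
noncomputable def secondPair : (T ⊗ G) ⊗ G ⟶ T ⊗ G := lift (fst (T ⊗ G) G ≫ σ.act) (snd (T ⊗ G) G)

/-- The map `(t, g, h) ↦ (t, g h)`. -/
noncomputable def productPair (_ : RightAction G T) : (T ⊗ G) ⊗ G ⟶ T ⊗ G :=
  lift (fst (T ⊗ G) G ≫ fst T G) ((fst (T ⊗ G) G ≫ snd T G) * snd (T ⊗ G) G)

lemma secondPair_fst : σ.secondPair ≫ fst T G = σ.firstPair ≫ σ.act := by
  simp [secondPair, firstPair]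

lemma productPair_fst : σ.productPair ≫ fst T G = σ.firstPair ≫ fst T G := by
  simp [productPair, firstPair]

lemma productPair_act : σ.productPair ≫ σ.act = σ.secondPair ≫ σ.act := by
  rw [productPair, act_mul, secondPair]
  congr 2
  rw [← comp_lift, lift_fst_snd, Category.comp_id]

end RightAction

/-- The diagram of `S`-schemes `T × G × G ⇶ T × G ⇉ T` attached to a right action of `G` on `T`:
`act (t, g) = t g`, `pr (t, g) = t`, `first (t, g, h) = (t, g)`, `second (t, g, h) = (t g, h)` and
`prod (t, g, h) = (t, g h)`. Only the identities between these maps that are needed in order to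
formulate the notion of an equivariant sheaf are recorded. -/
structure ActionDiagram (S : Scheme.{u}) where
  /-- the scheme `T` -/
  T : Over S
  /-- the scheme `T × G` -/
  P : Over S
  /-- the scheme `T × G × G` -/
  Q : Over S
  /-- the action -/
  act : P ⟶ T
  /-- the projection -/
  pr : P ⟶ T
  /-- `(t, g, h) ↦ (t, g)` -/
  first : Q ⟶ P
  /-- `(t, g, h) ↦ (t g, h)` -/
  second : Q ⟶ P
  /-- `(t, g, h) ↦ (t, g h)` -/
  prod : Q ⟶ P
  second_pr : second ≫ pr = first ≫ act
  prod_pr : prod ≫ pr = first ≫ pr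
  prod_act : prod ≫ act = second ≫ act

namespace ActionDiagram

variable (D : ActionDiagram S)

lemma second_pr_left : D.second.left ≫ D.pr.left = D.first.left ≫ D.act.left :=
  congrArg (fun f ↦ f.left) D.second_pr

lemma prod_pr_left : D.prod.left ≫ D.pr.left = D.first.left ≫ D.pr.left :=
  congrArg (fun f ↦ f.left) D.prod_pr

lemma prod_act_left : D.prod.left ≫ D.act.left = D.second.left ≫ D.act.left :=
  congrArg (fun f ↦ f.left) D.prod_act

variable {D} in
lemma second_pr_comp {Z : Scheme.{u}} {q : D.T.left ⟶ Z} (h : D.act.left ≫ q = D.pr.left ≫ q) :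
    D.second.left ≫ D.pr.left ≫ q = D.first.left ≫ D.pr.left ≫ q := by
  rw [← Category.assoc, D.second_pr_left, Category.assoc, h]

lemma prod_pr_comp {Z : Scheme.{u}} (q : D.T.left ⟶ Z) :
    D.prod.left ≫ D.pr.left ≫ q = D.first.left ≫ D.pr.left ≫ q := by
  rw [← Category.assoc, D.prod_pr_left, Category.assoc]

end ActionDiagram

/-- The diagram `T × G × G ⇶ T × G ⇉ T` of a right action. -/
@[simps]
noncomputable def RightAction.diagram : ActionDiagram S where
  T := T
  P := T ⊗ G
  Q := (T ⊗ G) ⊗ G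
  act := σ.act
  pr := fst T G
  first := σ.firstPair
  second := σ.secondPair
  prod := σ.productPair
  second_pr := σ.secondPair_fst
  prod_pr := σ.productPair_fst
  prod_act := σ.productPair_act

/-- A `G`-sheaf on `T`: an `𝒪_T`-module `F` together with an isomorphism `φ : act^* F ≅ pr^* F` on
`T × G` (fibrewise `φ_{t, g} : F_{t g} ≅ F_t`) such that `φ_{t, g h} = φ_{t, g} ∘ φ_{t g, h}`
on `T × G × G`. -/
structure EquivariantSheaf (D : ActionDiagram S) where
  /-- the underlying module -/
  sheaf : D.T.left.Modules
  /-- the linearisation -/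
  φ : (Scheme.Modules.pullback D.act.left).obj sheaf ≅ (Scheme.Modules.pullback D.pr.left).obj sheaf
  cocycle :
    baseChange φ.hom D.prod.left (D.second.left ≫ D.act.left) (D.first.left ≫ D.pr.left) D.prod_act_left D.prod_pr_left =
      baseChange φ.hom D.second.left (D.second.left ≫ D.act.left) (D.first.left ≫ D.act.left) rfl D.second_pr_left ≫
        baseChange φ.hom D.first.left (D.first.left ≫ D.act.left) (D.first.left ≫ D.pr.left) rfl rfl

namespace EquivariantSheaf

variable {D : ActionDiagram S}

/-- Morphisms of `G`-sheaves: `𝒪_T`-linear maps compatible with the linearisations. -/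
@[ext]
structure Hom (F F' : EquivariantSheaf D) where
  /-- the underlying morphism of modules -/
  hom : F.sheaf ⟶ F'.sheaf
  comm : (Scheme.Modules.pullback D.act.left).map hom ≫ F'.φ.hom =
    F.φ.hom ≫ (Scheme.Modules.pullback D.pr.left).map hom

instance : Category (EquivariantSheaf D) where
  Hom := Hom
  id F := { hom := 𝟙 _, comm := by simp }
  comp f g :=
    { hom := f.hom ≫ g.hom
      comm := by rw [Functor.map_comp, Functor.map_comp, Category.assoc, g.comm, reassoc_of% f.comm] }

@[ext]
lemma hom_ext {F F' : EquivariantSheaf D} {f g : F ⟶ F'} (h : f.hom = g.hom) : f = g :=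
  Hom.ext h

variable (D) in
/-- The functor forgetting the linearisation. -/
@[simps]
def forget : EquivariantSheaf D ⥤ D.T.left.Modules where
  obj F := F.sheaf
  map f := f.hom

lemma map_map_id {C₂ C₃ C₄ : Type*} [Category C₂] [Category C₃] [Category C₄]
    (F₂ : C₂ ⥤ C₃) (F₃ : C₃ ⥤ C₄) {X : C₂} {i : X ⟶ X} (h : i = 𝟙 X) :
    F₃.map (F₂.map i) = 𝟙 (F₃.obj (F₂.obj X)) := by
  simp [h]

lemma map_map_comp {C₂ C₃ C₄ : Type*} [Category C₂] [Category C₃] [Category C₄]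
    (F₂ : C₂ ⥤ C₃) (F₃ : C₃ ⥤ C₄) {X Y Z : C₂} {k : X ⟶ Z} {f : X ⟶ Y} {g : Y ⟶ Z}
    (h : k = f ≫ g) :
    F₃.map (F₂.map k) = F₃.map (F₂.map f) ≫ F₃.map (F₂.map g) := by
  simp [h]

/-- The `G`-sheaf `q^* N` attached to a `G`-invariant morphism `q : T ⟶ Z` and an automorphism
`α` of the pull-back of `N` to `T × G`: its linearisation is
`act^* q^* N ≅ (q ∘ act)^* N = (q ∘ pr)^* N ≅ pr^* q^* N`, the middle identification being twisted
by `α`. -/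
noncomputable def linearise {Z : Scheme.{u}} (q : D.T.left ⟶ Z) (r : D.P.left ⟶ Z) (r' : D.Q.left ⟶ Z)
    (h₁ : D.act.left ≫ q = r) (h₂ : D.pr.left ≫ q = r) (e₁ : D.first.left ≫ r = r')
    (e₂ : D.second.left ≫ r = r') (e₃ : D.prod.left ≫ r = r') (N : Z.Modules)
    (α : (Scheme.Modules.pullback r).obj N ≅ (Scheme.Modules.pullback r).obj N)
    (hα : baseChange α.hom D.prod.left r' r' e₃ e₃ =
      baseChange α.hom D.second.left r' r' e₂ e₂ ≫ baseChange α.hom D.first.left r' r' e₁ e₁) :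
    EquivariantSheaf D where
  sheaf := (Scheme.Modules.pullback q).obj N
  φ :=
    { hom := transport h₁ h₂ α.hom
      inv := transport h₂ h₁ α.inv
      hom_inv_id := by rw [transport_comp, Iso.hom_inv_id, transport_id]
      inv_hom_id := by rw [transport_comp, Iso.inv_hom_id, transport_id] }
  cocycle := by
    have a₁ : (D.second.left ≫ D.act.left) ≫ q = r' := by rw [Category.assoc, h₁, e₂]
    have a₂ : (D.first.left ≫ D.act.left) ≫ q = r' := by rw [Category.assoc, h₁, e₁]
    have a₃ : (D.first.left ≫ D.pr.left) ≫ q = r' := by rw [Category.assoc, h₂, e₁]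
    rw [baseChange_transport h₁ h₂ α.hom _ _ _ r' _ _ e₃ a₁ a₃,
      baseChange_transport h₁ h₂ α.hom _ _ _ r' _ _ e₂ a₁ a₂,
      baseChange_transport h₁ h₂ α.hom _ _ _ r' _ _ e₁ a₂ a₃, transport_comp, hα]

/-- The functor `V ↦ q^* F(V₀)` obtained from functors `V ↦ V₀` (given by `obj` and `map`) and `F`,
and automorphisms `α V` as in `linearise` that are natural in `V`. -/
noncomputable def lineariseFunctor {Z : Scheme.{u}} {C₁ C₂ : Type*} [Category C₁] [Category C₂]
    (obj : C₁ → C₂) (map : ∀ V W : C₁, (V ⟶ W) → (obj V ⟶ obj W))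
    (map_id : ∀ V : C₁, map V V (𝟙 V) = 𝟙 (obj V))
    (map_comp : ∀ (U V W : C₁) (f : U ⟶ V) (g : V ⟶ W),
      map U W (f ≫ g) = map U V f ≫ map V W g)
    (F : C₂ ⥤ Z.Modules)
    (q : D.T.left ⟶ Z) (r : D.P.left ⟶ Z) (r' : D.Q.left ⟶ Z)
    (h₁ : D.act.left ≫ q = r) (h₂ : D.pr.left ≫ q = r) (e₁ : D.first.left ≫ r = r')
    (e₂ : D.second.left ≫ r = r') (e₃ : D.prod.left ≫ r = r')
    (α : ∀ V : C₁, (Scheme.Modules.pullback r).obj (F.obj (obj V)) ≅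
      (Scheme.Modules.pullback r).obj (F.obj (obj V)))
    (hα : ∀ V : C₁, baseChange (α V).hom D.prod.left r' r' e₃ e₃ =
      baseChange (α V).hom D.second.left r' r' e₂ e₂ ≫
        baseChange (α V).hom D.first.left r' r' e₁ e₁)
    (hf : ∀ (V W : C₁) (f : V ⟶ W),
      (Scheme.Modules.pullback r).map (F.map (map V W f)) ≫ (α W).hom =
        (α V).hom ≫ (Scheme.Modules.pullback r).map (F.map (map V W f))) :
    C₁ ⥤ EquivariantSheaf D where
  obj V := linearise q r r' h₁ h₂ e₁ e₂ e₃ (F.obj (obj V)) (α V) (hα V)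
  map {V W} f :=
    { hom := (Scheme.Modules.pullback q).map (F.map (map V W f))
      comm := transport_naturality h₁ h₂ (F.map (map V W f)) (α V).hom (α W).hom (hf V W f) }
  map_id V := hom_ext (map_map_id F (Scheme.Modules.pullback q) (map_id V))
  map_comp f g := hom_ext (map_map_comp F (Scheme.Modules.pullback q) (map_comp _ _ _ f g))

/-- The `G`-sheaf `q^* N` attached to a `G`-invariant morphism `q : T ⟶ Z`, with the linearisation
`act^* q^* N ≅ (q ∘ act)^* N = (q ∘ pr)^* N ≅ pr^* q^* N`. -/

noncomputable def lineariseRefl {Z : Scheme.{u}} (q : D.T.left ⟶ Z) (r : D.P.left ⟶ Z) (r' : D.Q.left ⟶ Z)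
    (h₁ : D.act.left ≫ q = r) (h₂ : D.pr.left ≫ q = r) (e₁ : D.first.left ≫ r = r')
    (e₂ : D.second.left ≫ r = r') (e₃ : D.prod.left ≫ r = r') (N : Z.Modules) : EquivariantSheaf D :=
  linearise q r r' h₁ h₂ e₁ e₂ e₃ N (Iso.refl _)
    (baseChange_refl_cocycle D.prod.left D.second.left D.first.left r' e₃ e₂ e₁)

/-- The `G`-sheaf `j^* E` for a `G`-invariant morphism `j : T ⟶ X`, with the linearisation
`act^* j^* E ≅ (j ∘ act)^* E = (j ∘ pr)^* E ≅ pr^* j^* E`. -/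
noncomputable def ofInvariant {X : Scheme.{u}} (j : D.T.left ⟶ X) (hj : D.act.left ≫ j = D.pr.left ≫ j)
    (E : X.Modules) : EquivariantSheaf D :=
  lineariseRefl j (D.pr.left ≫ j) (D.first.left ≫ D.pr.left ≫ j) hj rfl rfl (D.second_pr_comp hj)
    (D.prod_pr_comp j) E

/-- The functor `E ↦ j^* E` from modules on `X` to `G`-sheaves on `T`, for a `G`-invariant
morphism `j : T ⟶ X`. -/
noncomputable def pullbackFunctor {X : Scheme.{u}} (j : D.T.left ⟶ X) (hj : D.act.left ≫ j = D.pr.left ≫ j) :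
    X.Modules ⥤ EquivariantSheaf D where
  obj E := ofInvariant j hj E
  map f :=
    { hom := (Scheme.Modules.pullback j).map f
      comm := transport_naturality _ _ f (𝟙 _) (𝟙 _)
        ((Category.comp_id _).trans (Category.id_comp _).symm) }
  map_id E := hom_ext ((Scheme.Modules.pullback j).map_id E)
  map_comp f g := hom_ext ((Scheme.Modules.pullback j).map_comp f g)

end EquivariantSheaf

/-- The category of `G`-sheaves on `T` whose underlying module is a vector bundle. -/
abbrev GVect :=
  ((IsVectorBundle (X := σ.diagram.T.left)).inverseImage
    (EquivariantSheaf.forget σ.diagram)).FullSubcategory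

variable {σ} in
/-- The functor `j^*` from vector bundles on `X` to `G`-equivariant vector bundles on `T`, for a
`G`-invariant morphism `j : T ⟶ X`. -/
noncomputable def pullbackVect (j : T ⟶ X) (hj : σ.act ≫ j = fst T G ≫ j) :
    Vect X.left ⥤ GVect σ :=
  ObjectProperty.lift _
    ((IsVectorBundle (X := X.left)).ι ⋙ EquivariantSheaf.pullbackFunctor (D := σ.diagram) j.left
      (congrArg (fun f ↦ f.left) hj))
    fun E ↦ E.property.pullback j.left

/-- The property of a vector bundle `E` on `X` of being trivialised by `j : T ⟶ X`, that is,
`j^* E ≅ 𝒪_T^n` for some natural number `n`. -/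
def IsTrivializedBy {S : Scheme.{u}} {T X : Over S} (j : T ⟶ X) : ObjectProperty (Vect X.left) := fun E ↦
  ∃ n : ℕ, Nonempty ((Scheme.Modules.pullback j.left).obj E.obj ≅
    SheafOfModules.free (R := T.left.ringCatSheaf) (ULift.{u} (Fin n)))

end Torsors

section Representations

open MonObj

variable {R : CommRingCat.{u}}

/-- An `R`-linear representation of an `R`-group scheme `G` on an `R`-module `V`: for every
`R`-scheme `Y`, a linear action of the group `G(Y)` on `Γ(Y, 𝒪_Y) ⊗ V`, functorial in `Y`. -/
structure LinearAction (G : Over (Spec R)) [GrpObj G] (V : ModuleCat.{u} R) where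
  /-- the action of `G(Y)` -/
  ρ : ∀ Y : Over (Spec R), (Y ⟶ G) → Module.End (GlobalFunctions Y) (GlobalFunctions Y ⊗[R] V)
  ρ_one : ∀ Y : Over (Spec R), ρ Y 1 = LinearMap.id
  ρ_mul : ∀ (Y : Over (Spec R)) (g h : Y ⟶ G), ρ Y (g * h) = ρ Y g ∘ₗ ρ Y h
  natural : ∀ {Y' Y : Over (Spec R)} (f : Y' ⟶ Y) (g : Y ⟶ G) (x : GlobalFunctions Y ⊗[R] V),
    ρ Y' (f ≫ g) ((pullFunctions f).toLinearMap.rTensor V x) =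
      (pullFunctions f).toLinearMap.rTensor V (ρ Y g x)

/-- A representation of `G` on a finitely generated free `R`-module; equivalently, a homomorphism
from `G` to the group functor `Y ↦ GL(Γ(Y, 𝒪_Y) ⊗ V)`. -/
structure FreeRep (G : Over (Spec R)) [GrpObj G] where
  /-- the underlying module -/
  V : ModuleCat.{u} R
  free : Module.Free R V
  finite : Module.Finite R V
  /-- the action -/
  action : LinearAction G V

namespace FreeRep

attribute [instance] FreeRep.free FreeRep.finite

variable {G : Over (Spec R)} [GrpObj G]

/-- Morphisms of representations: `R`-linear maps commuting with the actions. -/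
@[ext]
structure Hom (V W : FreeRep G) where
  /-- the underlying linear map -/
  hom : V.V ⟶ W.V
  comm : ∀ (Y : Over (Spec R)) (g : Y ⟶ G),
    hom.hom.baseChange (GlobalFunctions Y) ∘ₗ V.action.ρ Y g =
      W.action.ρ Y g ∘ₗ hom.hom.baseChange (GlobalFunctions Y)

instance : Category (FreeRep G) where
  Hom := Hom
  id V := { hom := 𝟙 _, comm := by intro Y g; simp }
  comp f g :=
    { hom := f.hom ≫ g.hom
      comm := by
        intro Y a
        rw [ModuleCat.hom_comp, LinearMap.baseChange_comp, LinearMap.comp_assoc, f.comm,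
          ← LinearMap.comp_assoc, g.comm, LinearMap.comp_assoc] }

@[ext]
lemma hom_ext {V W : FreeRep G} {f g : V ⟶ W} (h : f.hom = g.hom) : f = g :=
  Hom.ext h

/-- The module underlying a representation. -/
def mod (V : FreeRep G) : ModuleCat.{u} R := V.V

/-- The action on the module underlying a representation. -/
def act (V : FreeRep G) : LinearAction G V.mod := V.action

/-- The linear map underlying a morphism of representations. -/
def homLin (V W : FreeRep G) (f : V ⟶ W) : V.mod ⟶ W.mod := Hom.hom f

lemma homLin_comm {V W : FreeRep G} (f : V ⟶ W) (Y : Over (Spec R)) (g : Y ⟶ G) :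
    (homLin V W f).hom.baseChange (GlobalFunctions Y) ∘ₗ V.act.ρ Y g =
      W.act.ρ Y g ∘ₗ (homLin V W f).hom.baseChange (GlobalFunctions Y) :=
  f.comm Y g

end FreeRep

namespace LinearAction

variable {G : Over (Spec R)} [GrpObj G] {V : ModuleCat.{u} R}

/-- The automorphism of `θ^* Ṽ` given by the action of `g ∈ G(Y)`, for an `R`-scheme
`θ : Y ⟶ Spec R`. -/
noncomputable def tildeAut (a : LinearAction G V) {Y : Over (Spec R)} (g : Y ⟶ G) :
    (Scheme.Modules.pullback (str Y)).obj ((tildeFunctor R).obj V) ≅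
      (Scheme.Modules.pullback (str Y)).obj ((tildeFunctor R).obj V) where
  hom := tildeHom (a.ρ Y g)
  inv := tildeHom (a.ρ Y g⁻¹)
  hom_inv_id := by
    rw [← tildeHom_comp, ← a.ρ_mul, inv_mul_cancel, a.ρ_one, tildeHom_id]
  inv_hom_id := by
    rw [← tildeHom_comp, ← a.ρ_mul, mul_inv_cancel, a.ρ_one, tildeHom_id]

lemma tildeAut_mul (a : LinearAction G V) {Y : Over (Spec R)} (g h : Y ⟶ G) :
    (a.tildeAut (g * h)).hom = (a.tildeAut h).hom ≫ (a.tildeAut g).hom :=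
  (congrArg tildeHom (a.ρ_mul Y g h)).trans (tildeHom_comp (a.ρ Y h) (a.ρ Y g))

lemma baseChange_tildeAut (a : LinearAction G V) {Y' Y : Over (Spec R)} (f : Y' ⟶ Y)
    (hf : f.left ≫ str Y = str Y') (g : Y ⟶ G) :
    baseChange (a.tildeAut g).hom f.left (str Y') (str Y') hf hf = (a.tildeAut (f ≫ g)).hom :=
  (baseChange_eq hf (tildeIso f V) (tildeIso_hom f hf V) (a.tildeAut g).hom).trans
    (tildeIso_tildeHom f (a.ρ Y g) (a.ρ Y' (f ≫ g)) (a.natural f g))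

lemma tildeAut_cocycle (a : LinearAction G V) {Q P : Over (Spec R)} (p f s : Q ⟶ P)
    (hp : p.left ≫ str P = str Q) (hf : f.left ≫ str P = str Q) (hs : s.left ≫ str P = str Q)
    (g : P ⟶ G) (h : p ≫ g = (f ≫ g) * (s ≫ g)) :
    baseChange (a.tildeAut g).hom p.left (str Q) (str Q) hp hp =
      baseChange (a.tildeAut g).hom s.left (str Q) (str Q) hs hs ≫
        baseChange (a.tildeAut g).hom f.left (str Q) (str Q) hf hf := by
  rw [baseChange_tildeAut, baseChange_tildeAut, baseChange_tildeAut, h, tildeAut_mul]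

end LinearAction

lemma RightAction.productPair_snd {S : Scheme.{u}} {G T : Over S} [GrpObj G]
    (σ : RightAction G T) :
    σ.productPair ≫ snd T G = (σ.firstPair ≫ snd T G) * (σ.secondPair ≫ snd T G) := by
  rw [productPair, firstPair, secondPair, lift_snd, lift_snd]

namespace FreeRep

variable {G : Over (Spec R)} [GrpObj G]

/-- The automorphism of `θ^* Ṽ` given by the action of `g ∈ G(Y)` on a representation `V`. -/
noncomputable def aut {Y : Over (Spec R)} (g : Y ⟶ G) (V : FreeRep G) :
    (Scheme.Modules.pullback (str Y)).obj ((tildeFunctor R).obj V.mod) ≅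
      (Scheme.Modules.pullback (str Y)).obj ((tildeFunctor R).obj V.mod) :=
  V.act.tildeAut g

section

variable (D : ActionDiagram (Spec R))

lemma act_str : D.act.left ≫ str D.T = str D.P := str_w D.act

lemma pr_str : D.pr.left ≫ str D.T = str D.P := str_w D.pr

lemma first_str : D.first.left ≫ str D.P = str D.Q := str_w D.first

lemma second_str : D.second.left ≫ str D.P = str D.Q := str_w D.second

lemma prod_str : D.prod.left ≫ str D.P = str D.Q := str_w D.prod

end

lemma aut_cocycle (D : ActionDiagram (Spec R)) (g : D.P ⟶ G)
    (hg : D.prod ≫ g = (D.first ≫ g) * (D.second ≫ g)) (V : FreeRep G) :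
    baseChange (aut g V).hom D.prod.left (str D.Q) (str D.Q) (prod_str D) (prod_str D) =
      baseChange (aut g V).hom D.second.left (str D.Q) (str D.Q) (second_str D) (second_str D) ≫
        baseChange (aut g V).hom D.first.left (str D.Q) (str D.Q) (first_str D) (first_str D) :=
  V.act.tildeAut_cocycle D.prod D.first D.second (prod_str D) (first_str D) (second_str D) g hg

lemma aut_comm {Y : Over (Spec R)} (g : Y ⟶ G) (V W : FreeRep G) (f : V ⟶ W) :
    (Scheme.Modules.pullback (str Y)).map ((tildeFunctor R).map (homLin V W f)) ≫ (aut g W).hom =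
      (aut g V).hom ≫ (Scheme.Modules.pullback (str Y)).map ((tildeFunctor R).map (homLin V W f)) := by
  have e := congrArg tildeHom (homLin_comm f Y g)
  rw [tildeHom_comp, tildeHom_comp, tildeHom_baseChange] at e
  exact e.symm

lemma homLin_id (V : FreeRep G) : homLin V V (𝟙 V) = 𝟙 V.mod := rfl

lemma homLin_comp (U V W : FreeRep G) (f : U ⟶ V) (g : V ⟶ W) :
    homLin U W (f ≫ g) = homLin U V f ≫ homLin V W g := rfl

variable {D : ActionDiagram (Spec R)}

/-- The functor `V ↦ θ^* Ṽ` from representations of `G` to `G`-sheaves on `θ : T ⟶ Spec R`. The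
linearisation is given by the action on `V` of the element `g ∈ G(T × G)`, where `g` is the
projection `T × G ⟶ G`. -/
noncomputable def toEquivariantSheaf (g : D.P ⟶ G)
    (hg : D.prod ≫ g = (D.first ≫ g) * (D.second ≫ g)) :
    FreeRep G ⥤ EquivariantSheaf D :=
  EquivariantSheaf.lineariseFunctor (Z := Spec R) mod homLin homLin_id homLin_comp
    (tildeFunctor R) (str D.T) (str D.P) (str D.Q)
    (act_str D) (pr_str D) (first_str D) (second_str D) (prod_str D)
    (aut g) (aut_cocycle D g hg) (aut_comm g)

end FreeRep

variable {G T : Over (Spec R)} [GrpObj G]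

/-- The functor `V ↦ (θ ∘ j)^* Ṽ` from representations of `G` on finitely generated free modules
to `G`-equivariant vector bundles on `T`, where `θ ∘ j` is the structure morphism
`T ⟶ Spec R`. The linearisation at a point `(t, g)` is the action of `g` on `V`. -/
noncomputable def repToGVect (σ : RightAction G T) : FreeRep G ⥤ GVect σ :=
  ObjectProperty.lift _
    (FreeRep.toEquivariantSheaf (D := σ.diagram) (snd T G) σ.productPair_snd)
    fun V ↦ isVectorBundle_pullTilde T V.V

end Representations

end TorsorRep

/-!
Write `P = T × G` and `Q = T × G × G`, and let `a, p : P ⟶ T` be the action and the projection.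

**Descent.** Morphisms are descended along `j` on sections: for a vector bundle `E` on `X`, the
sections of `E` over `U` are the invariant sections of `j^* E` over `j⁻¹(U)`, because functions
descend along `j` (`exists_app_eq`; a function is a morphism to the affine line, and `j` is an
effective epimorphism). Hence `j^*` is fully faithful (`Fork.existsUnique_pullback_map_eq`), and an
equivariant bundle `F` descends as soon as it has frames of invariant sections locally on `X`
(`Fork.exists_iso_pullback`). Such frames exist (`Nerve.exists_invariant_frame`): for a local
section `f` of `F`, flat base change along `j` writes `φ(a^* f)` as a finite sum
`∑ a^* xₖ • p^* mₖ`; by the cocycle condition on `Q` and flatness of `j`, the `mₖ` may be taken to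
be invariant, and then `f = ∑ xₖ mₖ`, because `a` has a section. So the invariant sections generate
`F`, and a subfamily of them is a frame near any given point. The locus where it is a frame is open
and saturated for `j`, thus the preimage of an open subset of `X`. Modules are handled through
explicit frames and sections; no general descent theory for modules is used. Flat base change is
proved directly for sections of vector bundles over quasi-compact quasi-separated open sets
(`Square.inj_of_isCompact`, `Square.surj_of_isCompact`), with the equational criterion of flatness
in place of tensor products of modules of sections. The morphism `j` is quasi-separated because `G`
is (`IsTorsor.quasiSeparated`).

**Functions.** For a flat affine `R`-scheme `H`, the functions on `T × H` are those on `H`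
(`snd_appTop_bijective`). If `X` is quasi-compact and quasi-separated, so is `T`, and this is flat
base change. Otherwise `X` is integral and flat with integral special fibre; choose an affine open
subset `U₀` of `X` meeting the special fibre. Over `U₀`, a function on `T × H` is a sum `∑ wₖ ⊗ nₖ`
with `nₖ` linearly independent over `R`. Every `wₖ` extends to a global function on `T`, that is, to
an element of `R`: for `U ⊆ X` affine and `D(h)` a non-empty basic open subset of `U ∩ U₀` with `h` a
nonzerodivisor modulo the uniformiser, the cokernel of `Γ(j⁻¹(U)) ⟶ Γ(j⁻¹(D(h)))` is torsion-free,
so that `wₖ` extends to `j⁻¹(U)` because the sum does (`exists_eq_of_isPushout`), and extensions are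
unique because `T` is flat over the integral scheme `X`.

**Representations.** For finite free `V`, sections of `θ^* Ṽ` are elements of `Γ(Y, 𝒪_Y) ⊗ V`
(`tensorToSec_bijective`), so morphisms between such bundles are linear maps over `Γ(Y, 𝒪_Y)`. As the
functions on `T`, `P` and `Q` are those on `Spec R`, `G` and `G × G`, an equivariant morphism between
the bundles of two representations is an `R`-linear map which commutes with the universal element of
`G`, and a linearisation of `𝒪_T^n` is an automorphism of `Γ(G, 𝒪_G) ⊗ R^n` which satisfies the
cocycle condition over `G × G`, that is, a representation of `G` on `R^n`
(`FreeRep.existsUnique_toEquivariantSheaf_map_eq`, `FreeRep.exists_toEquivariantSheaf_iso`).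
-/

namespace TorsorRep

/-! ### Pulling back sections of modules -/

section PullbackSections

variable {X Y Z : Scheme.{u}}

/-- Restriction of sections of a module. -/
noncomputable def res (M : X.Modules) (U V : X.Opens) (h : V ≤ U) : Γ(M, U) →+ Γ(M, V) :=
  (M.presheaf.map (homOfLE h).op).hom

lemma res_res (M : X.Modules) (U V W : X.Opens) (h : V ≤ U) (h' : W ≤ V) (s : Γ(M, U)) :
    res M V W h' (res M U V h s) = res M U W (h'.trans h) s := by
  simp only [res]
  rw [← AddCommGrpCat.comp_apply, ← Functor.map_comp]
  rfl

@[simp]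
lemma res_self (M : X.Modules) (U : X.Opens) (h : U ≤ U) (s : Γ(M, U)) : res M U U h s = s := by
  have : (homOfLE h).op = 𝟙 (Opposite.op U) := rfl
  simp only [res]
  rw [this, CategoryTheory.Functor.map_id]
  rfl

lemma res_smul (M : X.Modules) (U V : X.Opens) (h : V ≤ U) (r : Γ(X, U)) (s : Γ(M, U)) :
    res M U V h (r • s) = X.presheaf.map (homOfLE h).op r • res M U V h s :=
  Scheme.Modules.map_smul M (homOfLE h) r s

lemma res_app {M N : X.Modules} (φ : M ⟶ N) (U V : X.Opens) (h : V ≤ U) (s : Γ(M, U)) :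
    res N U V h (φ.app U s) = φ.app V (res M U V h s) :=
  (congr($(φ.mapPresheaf.naturality (homOfLE h).op) s)).symm

/-- The unit `M ⟶ f_* f^* M` on sections over `U`. -/
noncomputable def pullOn (f : Y ⟶ X) (M : X.Modules) (U : X.Opens) :
    Γ(M, U) →+ Γ((Scheme.Modules.pullback f).obj M, f ⁻¹ᵁ U) :=
  (((Scheme.Modules.pullbackPushforwardAdjunction f).unit.app M).app U).hom

lemma pullOn_res (f : Y ⟶ X) (M : X.Modules) (U V : X.Opens) (h : V ≤ U) (s : Γ(M, U)) :
    pullOn f M V (res M U V h s) =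
      res _ (f ⁻¹ᵁ U) (f ⁻¹ᵁ V) (f.preimage_mono h) (pullOn f M U s) :=
  (res_app ((Scheme.Modules.pullbackPushforwardAdjunction f).unit.app M) U V h s).symm

lemma pullOn_smul (f : Y ⟶ X) (M : X.Modules) (U : X.Opens) (r : Γ(X, U)) (s : Γ(M, U)) :
    pullOn f M U (r • s) = f.app U r • pullOn f M U s :=
  Scheme.Modules.Hom.app_smul ((Scheme.Modules.pullbackPushforwardAdjunction f).unit.app M) r s

lemma app_pullOn {f : Y ⟶ X} {M N : X.Modules} (φ : M ⟶ N) (U : X.Opens) (s : Γ(M, U)) :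
    ((Scheme.Modules.pullback f).map φ).app (f ⁻¹ᵁ U) (pullOn f M U s) =
      pullOn f N U (φ.app U s) :=
  congr(($((Scheme.Modules.pullbackPushforwardAdjunction f).unit.naturality φ)).app U s).symm

/-- The pull-back to `W ⊆ f⁻¹(U)` of a section over `U` of a module `M`, as a section of `f^* M`. -/
noncomputable def pullLE (f : Y ⟶ X) (M : X.Modules) (U : X.Opens) (W : Y.Opens)
    (h : W ≤ f ⁻¹ᵁ U) : Γ(M, U) →+ Γ((Scheme.Modules.pullback f).obj M, W) :=
  (res _ (f ⁻¹ᵁ U) W h).comp (pullOn f M U)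

lemma pullLE_apply (f : Y ⟶ X) (M : X.Modules) (U : X.Opens) (W : Y.Opens)
    (h : W ≤ f ⁻¹ᵁ U) (s : Γ(M, U)) : pullLE f M U W h s = res _ _ W h (pullOn f M U s) := rfl

lemma pullLE_res_right (f : Y ⟶ X) (M : X.Modules) (U : X.Opens) (W W' : Y.Opens)
    (h : W ≤ f ⁻¹ᵁ U) (h' : W' ≤ W) (s : Γ(M, U)) :
    res _ W W' h' (pullLE f M U W h s) = pullLE f M U W' (h'.trans h) s :=
  res_res _ _ _ _ h h' _

lemma pullLE_res_left (f : Y ⟶ X) (M : X.Modules) (U U' : X.Opens) (W : Y.Opens)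
    (h : W ≤ f ⁻¹ᵁ U') (h' : U' ≤ U) (s : Γ(M, U)) :
    pullLE f M U' W h (res M U U' h' s) =
      pullLE f M U W (h.trans (f.preimage_mono h')) s := by
  rw [pullLE_apply, pullOn_res, res_res, pullLE_apply]

lemma app_pullLE {f : Y ⟶ X} {M N : X.Modules} (φ : M ⟶ N) (U : X.Opens) (W : Y.Opens)
    (h : W ≤ f ⁻¹ᵁ U) (s : Γ(M, U)) :
    ((Scheme.Modules.pullback f).map φ).app W (pullLE f M U W h s) =
      pullLE f N U W h (φ.app U s) := by
  rw [pullLE_apply, pullLE_apply, ← res_app, app_pullOn]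

lemma pullLE_smul (f : Y ⟶ X) (M : X.Modules) (U : X.Opens) (W : Y.Opens)
    (h : W ≤ f ⁻¹ᵁ U) (r : Γ(X, U)) (s : Γ(M, U)) :
    pullLE f M U W h (r • s) = f.appLE U W h r • pullLE f M U W h s := by
  rw [pullLE_apply, pullOn_smul, res_smul]
  rfl

/-- The isomorphism `f^* g^* N ≅ k^* N` attached to a factorisation `k = g ∘ f`. -/
noncomputable def pcompIso (f : X ⟶ Y) (g : Y ⟶ Z) (k : X ⟶ Z) (h : f ≫ g = k) (N : Z.Modules) :
    (Scheme.Modules.pullback f).obj ((Scheme.Modules.pullback g).obj N) ≅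
      (Scheme.Modules.pullback k).obj N :=
  (pcomp f g k h).app N

lemma pcompIso_hom_app_pullOn (f : X ⟶ Y) (g : Y ⟶ Z) (N : Z.Modules) (U : Z.Opens)
    (s : Γ(N, U)) :
    (pcompIso f g (f ≫ g) rfl N).hom.app (f ⁻¹ᵁ g ⁻¹ᵁ U)
      (pullOn f _ (g ⁻¹ᵁ U) (pullOn g N U s)) = pullOn (f ≫ g) N U s := by
  have := unit_conjugateEquiv ((Scheme.Modules.pullbackPushforwardAdjunction g).comp
    (Scheme.Modules.pullbackPushforwardAdjunction f))
    (Scheme.Modules.pullbackPushforwardAdjunction (f ≫ g))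
    (Scheme.Modules.pullbackComp f g).inv N
  rw [Scheme.Modules.conjugateEquiv_pullbackComp_inv] at this
  have h2 := congr($this ≫ (Scheme.Modules.pushforward (f ≫ g)).map
    ((Scheme.Modules.pullbackComp f g).hom.app N))
  rw [Category.assoc, Category.assoc, ← Functor.map_comp, Iso.inv_hom_id_app,
    CategoryTheory.Functor.map_id] at h2
  replace h2 := h2.trans (Category.comp_id _)
  have e : (pcompIso f g (f ≫ g) rfl N).hom = (Scheme.Modules.pullbackComp f g).hom.app N :=
    congr(($(pcomp_rfl f g)).hom.app N)
  rw [e]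
  exact congr((Scheme.Modules.Hom.app $h2 U) s)

lemma pcompIso_hom_app_pullLE (f : X ⟶ Y) (g : Y ⟶ Z) (k : X ⟶ Z) (h : f ≫ g = k) (N : Z.Modules)
    (U : Z.Opens) (V : Y.Opens) (W : X.Opens) (hV : V ≤ g ⁻¹ᵁ U) (hW : W ≤ f ⁻¹ᵁ V)
    (hW' : W ≤ k ⁻¹ᵁ U) (s : Γ(N, U)) :
    (pcompIso f g k h N).hom.app W (pullLE f _ V W hW (pullLE g N U V hV s)) =
      pullLE k N U W hW' s := by
  subst h
  rw [pullLE_apply g, pullLE_res_left, pullLE_apply, ← res_app]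
  exact congrArg (res _ _ W hW') (pcompIso_hom_app_pullOn f g N U s)

lemma inv_app_hom_app {M N : X.Modules} (e : M ≅ N) (U : X.Opens) (s : Γ(M, U)) :
    e.inv.app U (e.hom.app U s) = s := by
  rw [← AddCommGrpCat.comp_apply, ← Scheme.Modules.Hom.comp_app, Iso.hom_inv_id]
  rfl

lemma hom_app_inv_app {M N : X.Modules} (e : M ≅ N) (U : X.Opens) (s : Γ(N, U)) :
    e.hom.app U (e.inv.app U s) = s :=
  inv_app_hom_app e.symm U s

lemma pcompIso_inv_app_pullLE (f : X ⟶ Y) (g : Y ⟶ Z) (k : X ⟶ Z) (h : f ≫ g = k) (N : Z.Modules)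
    (U : Z.Opens) (V : Y.Opens) (W : X.Opens) (hV : V ≤ g ⁻¹ᵁ U) (hW : W ≤ f ⁻¹ᵁ V)
    (hW' : W ≤ k ⁻¹ᵁ U) (s : Γ(N, U)) :
    (pcompIso f g k h N).inv.app W (pullLE k N U W hW' s) =
      pullLE f _ V W hW (pullLE g N U V hV s) := by
  rw [← pcompIso_hom_app_pullLE f g k h N U V W hV hW hW', inv_app_hom_app]

lemma baseChange_eq_pcompIso {Y' Y X₁ X₂ : Scheme.{u}} {M₁ : X₁.Modules} {M₂ : X₂.Modules}
    {f₁ : Y ⟶ X₁} {f₂ : Y ⟶ X₂}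
    (φ : (Scheme.Modules.pullback f₁).obj M₁ ⟶ (Scheme.Modules.pullback f₂).obj M₂)
    (g : Y' ⟶ Y) (k₁ : Y' ⟶ X₁) (k₂ : Y' ⟶ X₂) (h₁ : g ≫ f₁ = k₁) (h₂ : g ≫ f₂ = k₂) :
    baseChange φ g k₁ k₂ h₁ h₂ = (pcompIso g f₁ k₁ h₁ M₁).inv ≫
      (Scheme.Modules.pullback g).map φ ≫ (pcompIso g f₂ k₂ h₂ M₂).hom := rfl

lemma transport_eq_pcompIso {P T Z : Scheme.{u}} {q : T ⟶ Z} {a b : P ⟶ T} {r : P ⟶ Z}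
    (ha : a ≫ q = r) (hb : b ≫ q = r) {N : Z.Modules}
    (α : (Scheme.Modules.pullback r).obj N ⟶ (Scheme.Modules.pullback r).obj N) :
    transport ha hb α = (pcompIso a q r ha N).hom ≫ α ≫ (pcompIso b q r hb N).inv := rfl

/-- The value of a base change of `φ` on a pulled back section. -/
lemma baseChange_app_pcompIso {Y' Y X₁ X₂ : Scheme.{u}} {M₁ : X₁.Modules} {M₂ : X₂.Modules}
    {f₁ : Y ⟶ X₁} {f₂ : Y ⟶ X₂}
    (φ : (Scheme.Modules.pullback f₁).obj M₁ ⟶ (Scheme.Modules.pullback f₂).obj M₂)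
    (g : Y' ⟶ Y) (k₁ : Y' ⟶ X₁) (k₂ : Y' ⟶ X₂) (h₁ : g ≫ f₁ = k₁) (h₂ : g ≫ f₂ = k₂)
    (U : Y.Opens) (W : Y'.Opens) (h : W ≤ g ⁻¹ᵁ U)
    (s : Γ((Scheme.Modules.pullback f₁).obj M₁, U)) :
    (baseChange φ g k₁ k₂ h₁ h₂).app W ((pcompIso g f₁ k₁ h₁ M₁).hom.app W
      (pullLE g _ U W h s)) =
    (pcompIso g f₂ k₂ h₂ M₂).hom.app W (pullLE g _ U W h (φ.app U s)) := by
  rw [← app_pullLE, baseChange_eq_pcompIso]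
  simp only [Scheme.Modules.Hom.comp_app, AddCommGrpCat.comp_apply]
  rw [inv_app_hom_app]

lemma pullback_hom_ext {f : Y ⟶ X} {M : X.Modules} {N : Y.Modules}
    {φ ψ : (Scheme.Modules.pullback f).obj M ⟶ N}
    (h : ∀ (U : X.Opens) (s : Γ(M, U)), φ.app (f ⁻¹ᵁ U) (pullLE f M U _ le_rfl s) =
      ψ.app (f ⁻¹ᵁ U) (pullLE f M U _ le_rfl s)) : φ = ψ := by
  apply ((Scheme.Modules.pullbackPushforwardAdjunction f).homEquiv M N).injective
  ext U s
  rw [Adjunction.homEquiv_unit, Adjunction.homEquiv_unit]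
  have := h U s
  rw [pullLE_apply, res_self] at this
  exact this

end PullbackSections

/-! ### Frames of modules -/

section Gluing

variable {X : Scheme.{u}}

lemma res_ext (M : X.Modules) {U : X.Opens} {s t : Γ(M, U)}
    (h : ∀ x ∈ U, ∃ (V : X.Opens) (hV : V ≤ U), x ∈ V ∧ res M U V hV s = res M U V hV t) :
    s = t := by
  choose V hV hx e using h
  refine TopCat.Sheaf.eq_of_locally_eq' ⟨M.presheaf, M.isSheaf⟩ (fun x : U ↦ V x x.2) U
    (fun x ↦ homOfLE (hV x x.2)) (fun x hxU ↦ ?_) s t fun x ↦ e x x.2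
  exact TopologicalSpace.Opens.mem_iSup.mpr ⟨⟨x, hxU⟩, hx x hxU⟩

/-- Sections characterised locally by a property which is stable under restriction and determines
them uniquely can be glued. -/
lemma res_glue (M : X.Modules) {U : X.Opens} (P : ∀ V : X.Opens, V ≤ U → Γ(M, V) → Prop)
    (hres : ∀ (V W : X.Opens) (hV : V ≤ U) (hW : W ≤ V) (s : Γ(M, V)),
      P V hV s → P W (hW.trans hV) (res M V W hW s))
    (huniq : ∀ (V : X.Opens) (hV : V ≤ U) (s t : Γ(M, V)), P V hV s → P V hV t → s = t)
    (hex : ∀ x ∈ U, ∃ (V : X.Opens) (hV : V ≤ U), x ∈ V ∧ ∃ s, P V hV s) :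
    ∃ s : Γ(M, U), ∀ x ∈ U, ∃ (V : X.Opens) (hV : V ≤ U), x ∈ V ∧ P V hV (res M U V hV s) := by
  choose V hV hx s hs using hex
  obtain ⟨t, ht, -⟩ := TopCat.Sheaf.existsUnique_gluing' ⟨M.presheaf, M.isSheaf⟩
    (fun x : U ↦ V x x.2) U
    (fun x ↦ homOfLE (hV x x.2)) (fun x hxU ↦
      TopologicalSpace.Opens.mem_iSup.mpr ⟨⟨x, hxU⟩, hx x hxU⟩) (fun x ↦ s x x.2) (fun x y ↦
      huniq _ (inf_le_left.trans (hV x x.2)) _ _ (hres _ _ (hV x x.2) inf_le_left _ (hs x x.2))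
        (hres _ _ (hV y y.2) inf_le_right _ (hs y y.2)))
  refine ⟨t, fun x hxU ↦ ⟨V x hxU, hV x hxU, hx x hxU, ?_⟩⟩
  have : res M U (V x hxU) (hV x hxU) t = s x hxU := ht ⟨x, hxU⟩
  rw [this]
  exact hs x hxU

lemma fun_ext {U : X.Opens} {s t : Γ(X, U)}
    (h : ∀ x ∈ U, ∃ (V : X.Opens) (hV : V ≤ U), x ∈ V ∧
      X.presheaf.map (homOfLE hV).op s = X.presheaf.map (homOfLE hV).op t) :
    s = t := by
  choose V hV hx e using h
  refine TopCat.Sheaf.eq_of_locally_eq' X.sheaf (fun x : U ↦ V x x.2) U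
    (fun x ↦ homOfLE (hV x x.2)) (fun x hxU ↦ ?_) s t fun x ↦ e x x.2
  exact TopologicalSpace.Opens.mem_iSup.mpr ⟨⟨x, hxU⟩, hx x hxU⟩

/-- Functions characterised locally by a property which is stable under restriction and determines
them uniquely can be glued. -/
lemma fun_glue {U : X.Opens} (P : ∀ V : X.Opens, V ≤ U → Γ(X, V) → Prop)
    (hres : ∀ (V W : X.Opens) (hV : V ≤ U) (hW : W ≤ V) (s : Γ(X, V)),
      P V hV s → P W (hW.trans hV) (X.presheaf.map (homOfLE hW).op s))
    (huniq : ∀ (V : X.Opens) (hV : V ≤ U) (s t : Γ(X, V)), P V hV s → P V hV t → s = t)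
    (hex : ∀ x ∈ U, ∃ (V : X.Opens) (hV : V ≤ U), x ∈ V ∧ ∃ s, P V hV s) :
    ∃ s : Γ(X, U), ∀ x ∈ U, ∃ (V : X.Opens) (hV : V ≤ U), x ∈ V ∧
      P V hV (X.presheaf.map (homOfLE hV).op s) := by
  choose V hV hx s hs using hex
  obtain ⟨t, ht, -⟩ := TopCat.Sheaf.existsUnique_gluing' X.sheaf
    (fun x : U ↦ V x x.2) U
    (fun x ↦ homOfLE (hV x x.2)) (fun x hxU ↦
      TopologicalSpace.Opens.mem_iSup.mpr ⟨⟨x, hxU⟩, hx x hxU⟩) (fun x ↦ s x x.2) (fun x y ↦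
      huniq _ (inf_le_left.trans (hV x x.2)) _ _ (hres _ _ (hV x x.2) inf_le_left _ (hs x x.2))
        (hres _ _ (hV y y.2) inf_le_right _ (hs y y.2)))
  refine ⟨t, fun x hxU ↦ ⟨V x hxU, hV x hxU, hx x hxU, ?_⟩⟩
  have : X.presheaf.map (homOfLE (hV x hxU)).op t = s x hxU := ht ⟨x, hxU⟩
  rw [this]
  exact hs x hxU

end Gluing

section Free

variable (X : Scheme.{u}) (I : Type u)

/-- The module `𝒪_X`. -/
noncomputable abbrev unitMod : X.Modules := SheafOfModules.unit X.ringCatSheaf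

/-- The free module `𝒪_X^I`. -/
noncomputable abbrev freeMod : X.Modules := SheafOfModules.free (R := X.ringCatSheaf) I

variable {X I}

/-- Compatible families of sections of a module are sections over the whole space. -/
noncomputable def sectionsEquiv (M : X.Modules) : SheafOfModules.sections M ≃ Γ(M, ⊤) where
  toFun s := s.val (.op ⊤)
  invFun s := ⟨fun U ↦ M.presheaf.map (homOfLE le_top).op s, fun {U V} i ↦ by
    exact res_res M ⊤ U.unop V.unop le_top i.unop.le s⟩
  left_inv s := Subtype.ext (funext fun U ↦ s.2 (homOfLE le_top).op)
  right_inv s := res_self M ⊤ le_rfl s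

/-- Morphisms out of `𝒪_X` are global sections. -/
noncomputable def homUnit (M : X.Modules) : (unitMod X ⟶ M) ≃ Γ(M, ⊤) :=
  (SheafOfModules.unitHomEquiv M).trans (sectionsEquiv M)

/-- Morphisms out of `𝒪_X^I` are families of global sections. -/
noncomputable def homFree (M : X.Modules) : (freeMod X I ⟶ M) ≃ (I → Γ(M, ⊤)) :=
  (SheafOfModules.freeHomEquiv M).trans (Equiv.piCongrRight fun _ ↦ sectionsEquiv M)

variable (X) in
/-- The standard sections of `𝒪_X^I`. -/
noncomputable def stdSec (i : I) : Γ(freeMod X I, ⊤) := homFree _ (𝟙 _) i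

lemma homFree_apply (M : X.Modules) (f : freeMod X I ⟶ M) (i : I) :
    homFree M f i = f.app ⊤ (stdSec X i) :=
  rfl

variable (X) in
/-- A function, as a section of `𝒪_X`. -/
def unitSec (U : X.Opens) (c : Γ(X, U)) : Γ(unitMod X, U) := c

lemma unitSec_mul (U : X.Opens) (c d : Γ(X, U)) : unitSec X U (c * d) = c • unitSec X U d := rfl

lemma unitSec_map (U V : X.Opens) (h : V ≤ U) (c : Γ(X, U)) :
    unitSec X V (X.presheaf.map (homOfLE h).op c) = res _ U V h (unitSec X U c) := rfl

lemma homUnit_apply (M : X.Modules) (f : unitMod X ⟶ M) :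
    homUnit M f = f.app ⊤ (unitSec X ⊤ 1) :=
  rfl

lemma app_unitSec (M : X.Modules) (f : unitMod X ⟶ M) (U : X.Opens) (c : Γ(X, U)) :
    f.app U (unitSec X U c) = c • res M ⊤ U le_top (homUnit M f) := by
  rw [homUnit_apply, res_app, ← unitSec_map, map_one]
  conv_lhs => rw [← mul_one c, unitSec_mul]
  rw [Scheme.Modules.Hom.app_smul]

end Free

section Frames

variable {X : Scheme.{u}} {I : Type u} [Fintype I]

/-- The section `∑ cᵢ eᵢ`. -/
noncomputable def comb {M : X.Modules} {U : X.Opens} (e : I → Γ(M, U)) (V : X.Opens) (h : V ≤ U)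
    (c : I → Γ(X, V)) : Γ(M, V) :=
  ∑ i, c i • res M U V h (e i)

/-- A family of sections `eᵢ` over `U` is a frame of `M` on `U` if it is a basis of `M` on every
open subset of `U`. -/
def IsFrame (M : X.Modules) (U : X.Opens) (e : I → Γ(M, U)) : Prop :=
  ∀ (V : X.Opens) (h : V ≤ U), Function.Bijective (comb e V h)

lemma res_comb {M : X.Modules} {U : X.Opens} (e : I → Γ(M, U)) (V W : X.Opens) (h : V ≤ U)
    (h' : W ≤ V) (c : I → Γ(X, V)) :
    res M V W h' (comb e V h c) =
      comb e W (h'.trans h) fun i ↦ X.presheaf.map (homOfLE h').op (c i) := by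
  simp only [comb, map_sum, res_smul, res_res]

lemma comb_res {M : X.Modules} {U : X.Opens} (e : I → Γ(M, U)) (V W : X.Opens) (h : V ≤ U)
    (h' : W ≤ V) (c : I → Γ(X, W)) :
    comb (fun i ↦ res M U V h (e i)) W h' c = comb e W (h'.trans h) c := by
  simp only [comb, res_res]

lemma app_comb {M N : X.Modules} (φ : M ⟶ N) {U : X.Opens} (e : I → Γ(M, U)) (V : X.Opens)
    (h : V ≤ U) (c : I → Γ(X, V)) :
    φ.app V (comb e V h c) = comb (fun i ↦ φ.app U (e i)) V h c := by
  simp only [comb, map_sum, Scheme.Modules.Hom.app_smul, res_app]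

lemma IsFrame.res {M : X.Modules} {U : X.Opens} {e : I → Γ(M, U)} (he : IsFrame M U e)
    (V : X.Opens) (h : V ≤ U) : IsFrame M V fun i ↦ res M U V h (e i) := by
  intro W h'
  convert he W (h'.trans h) using 1
  funext c
  exact comb_res e V W h h' c

lemma IsFrame.app_iso {M N : X.Modules} (φ : M ≅ N) {U : X.Opens} {e : I → Γ(M, U)}
    (he : IsFrame M U e) : IsFrame N U fun i ↦ φ.hom.app U (e i) := by
  intro V h
  have : comb (fun i ↦ φ.hom.app U (e i)) V h = φ.hom.app V ∘ comb e V h :=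
    funext fun c ↦ (app_comb φ.hom e V h c).symm
  rw [this]
  refine Function.Bijective.comp ⟨?_, ?_⟩ (he V h)
  · exact Function.LeftInverse.injective (inv_app_hom_app φ V)
  · exact Function.RightInverse.surjective (hom_app_inv_app φ V)

lemma comb_add {M : X.Modules} {U : X.Opens} (e : I → Γ(M, U)) (V : X.Opens) (h : V ≤ U)
    (c d : I → Γ(X, V)) : comb e V h (c + d) = comb e V h c + comb e V h d := by
  simp [comb, add_smul, Finset.sum_add_distrib]

lemma sum_app {ι : Type*} {M N : X.Modules} (s : Finset ι) (f : ι → (M ⟶ N)) (U : X.Opens)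
    (x : Γ(M, U)) :
    Scheme.Modules.Hom.app (∑ i ∈ s, f i) U x = ∑ i ∈ s, (f i).app U x := by
  classical
  induction s using Finset.induction_on with
  | empty => simp
  | insert a s ha ih =>
    rw [Finset.sum_insert ha, Finset.sum_insert ha, ← ih]
    rfl

variable (X I) in
lemma isFrame_stdSec : IsFrame (freeMod X I) ⊤ (stdSec X) := by
  classical
  let π (i : I) : freeMod X I ⟶ unitMod X :=
    (homFree _).symm fun k ↦ if k = i then unitSec X ⊤ 1 else unitSec X ⊤ 0
  let ι (i : I) : unitMod X ⟶ freeMod X I := (homUnit _).symm (stdSec X i)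
  have hπ (i k : I) : (π i).app ⊤ (stdSec X k) =
      if k = i then unitSec X ⊤ 1 else unitSec X ⊤ 0 := by
    rw [← homFree_apply, Equiv.apply_symm_apply]
  have hι (i : I) (U : X.Opens) (c : Γ(X, U)) :
      (ι i).app U (unitSec X U c) = c • res _ ⊤ U le_top (stdSec X i) := by
    rw [app_unitSec, Equiv.apply_symm_apply]
  have hsum : ∑ i, π i ≫ ι i = 𝟙 _ := by
    apply (homFree _).injective
    funext k
    rw [homFree_apply, sum_app]
    simp only [Scheme.Modules.Hom.comp_app, AddCommGrpCat.comp_apply, hπ]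
    rw [Finset.sum_eq_single k]
    · rw [if_pos rfl, hι, one_smul, res_self]
      rfl
    · intro i _ hi
      rw [if_neg (Ne.symm hi), hι, zero_smul]
    · simp
  intro V h
  constructor
  · intro c d hcd
    funext k
    have hk (c : I → Γ(X, V)) : (π k).app V (comb (stdSec X) V h c) = unitSec X V (c k) := by
      rw [app_comb]
      simp only [comb, hπ]
      rw [Finset.sum_eq_single k]
      · rw [if_pos rfl, ← unitSec_map, map_one, ← unitSec_mul, mul_one]
      · intro i _ hi
        rw [if_neg hi, ← unitSec_map, map_zero, ← unitSec_mul, mul_zero]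
        rfl
      · simp
    exact (hk c).symm.trans ((congrArg _ hcd).trans (hk d))
  · intro s
    refine ⟨fun i ↦ (π i).app V s, ?_⟩
    have := congr(Scheme.Modules.Hom.app $hsum V s)
    rw [sum_app] at this
    refine Eq.trans ?_ this
    refine Finset.sum_congr rfl fun i _ ↦ ?_
    exact (hι i V _).symm

/-- A family of global sections that represents the functor `N ↦ Γ(N, ⊤)^I` comes from an
isomorphism with `𝒪_X^I`. -/
lemma exists_iso_of_bijective {I : Type u} {M : X.Modules} (e : I → Γ(M, ⊤))
    (h : ∀ N : X.Modules, Function.Bijective fun (φ : M ⟶ N) (i : I) ↦ φ.app ⊤ (e i)) :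
    ∃ α : freeMod X I ≅ M, ∀ i, α.hom.app ⊤ (stdSec X i) = e i := by
  have h₁ : ∀ i, ((homFree M).symm e).app ⊤ (stdSec X i) = e i := fun i ↦ by
    rw [← homFree_apply, Equiv.apply_symm_apply]
  obtain ⟨β, hβ⟩ := (h (freeMod X I)).2 (stdSec X)
  refine ⟨⟨(homFree M).symm e, β, ?_, ?_⟩, h₁⟩
  · apply (homFree _).injective
    funext i
    rw [homFree_apply, Scheme.Modules.Hom.comp_app, AddCommGrpCat.comp_apply, h₁]
    exact congrFun hβ i
  · apply (h M).1
    funext i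
    have := congrFun hβ i
    dsimp only at this ⊢
    rw [Scheme.Modules.Hom.comp_app, AddCommGrpCat.comp_apply, this, h₁]
    rfl

lemma isFrame_of_bijective {M : X.Modules} (e : I → Γ(M, ⊤))
    (h : ∀ N : X.Modules, Function.Bijective fun (φ : M ⟶ N) (i : I) ↦ φ.app ⊤ (e i)) :
    IsFrame M ⊤ e := by
  obtain ⟨α, hα⟩ := exists_iso_of_bijective e h
  convert (isFrame_stdSec X I).app_iso α using 1
  exact funext fun i ↦ (hα i).symm

/-- A morphism of modules which is bijective on all small open sets is an isomorphism. -/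
lemma isIso_of_locally_bijective {M N : X.Modules} (φ : M ⟶ N)
    (h : ∀ x : X, ∃ U : X.Opens, x ∈ U ∧ ∀ V ≤ U, Function.Bijective (φ.app V)) : IsIso φ := by
  rw [Scheme.Modules.Hom.isIso_iff_isIso_app]
  intro U
  have hinj (U : X.Opens) : Function.Injective (φ.app U) := by
    intro s t hst
    apply res_ext
    intro x hx
    obtain ⟨V, hxV, hV⟩ := h x
    refine ⟨U ⊓ V, inf_le_left, ⟨hx, hxV⟩, (hV (U ⊓ V) inf_le_right).1 ?_⟩
    rw [← res_app, hst, res_app]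
  rw [ConcreteCategory.isIso_iff_bijective]
  refine ⟨hinj U, fun t ↦ ?_⟩
  obtain ⟨s, hs⟩ := res_glue M (fun V hV s ↦ φ.app V s = res N U V hV t)
    (fun V W hV hW s hs ↦ by rw [← res_app, hs, res_res])
    (fun V hV s s' hs hs' ↦ hinj V (hs.trans hs'.symm)) (fun x hx ↦ by
      obtain ⟨V, hxV, hV⟩ := h x
      exact ⟨U ⊓ V, inf_le_left, ⟨hx, hxV⟩, (hV (U ⊓ V) inf_le_right).2 _⟩)
  refine ⟨s, res_ext N fun x hx ↦ ?_⟩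
  obtain ⟨V, hV, hxV, e⟩ := hs x hx
  exact ⟨V, hV, hxV, (res_app _ _ _ _ _).trans e⟩

lemma isIso_of_isFrame {M N : X.Modules} (φ : M ⟶ N)
    (h : ∀ x : X, ∃ (U : X.Opens) (I : Type u) (_ : Fintype I) (e : I → Γ(M, U)), x ∈ U ∧
      IsFrame M U e ∧ IsFrame N U fun i ↦ φ.app U (e i)) : IsIso φ := by
  refine isIso_of_locally_bijective φ fun x ↦ ?_
  obtain ⟨U, I, _, e, hx, he, he'⟩ := h x
  refine ⟨U, hx, fun V hV ↦ ?_⟩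
  have : comb (fun i ↦ φ.app U (e i)) V hV = φ.app V ∘ comb e V hV :=
    funext fun c ↦ (app_comb φ e V hV c).symm
  have h₂ := he' V hV
  rw [this] at h₂
  exact (Function.Bijective.of_comp_iff _ (he V hV)).mp h₂

lemma exists_iso_of_isFrame {M : X.Modules} (e : I → Γ(M, ⊤)) (he : IsFrame M ⊤ e) :
    ∃ α : freeMod X I ≅ M, ∀ i, α.hom.app ⊤ (stdSec X i) = e i := by
  have h₁ : ∀ i, ((homFree M).symm e).app ⊤ (stdSec X i) = e i := fun i ↦ by
    rw [← homFree_apply, Equiv.apply_symm_apply]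
  have : IsIso ((homFree M).symm e) := isIso_of_isFrame _ fun x ↦
    ⟨⊤, I, inferInstance, stdSec X, trivial, isFrame_stdSec X I, by
      rw [funext h₁]; exact he⟩
  exact ⟨asIso ((homFree M).symm e), h₁⟩

lemma bijective_of_isFrame {M : X.Modules} (e : I → Γ(M, ⊤)) (he : IsFrame M ⊤ e)
    (N : X.Modules) : Function.Bijective fun (φ : M ⟶ N) (i : I) ↦ φ.app ⊤ (e i) := by
  obtain ⟨α, hα⟩ := exists_iso_of_isFrame e he
  have : (fun (φ : M ⟶ N) (i : I) ↦ φ.app ⊤ (e i)) =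
      homFree N ∘ fun φ ↦ α.hom ≫ φ := by
    funext φ i
    rw [Function.comp_apply, homFree_apply, Scheme.Modules.Hom.comp_app, AddCommGrpCat.comp_apply,
      hα]
  rw [this]
  exact (homFree N).bijective.comp (α.symm.homFromEquiv (Z := N)).bijective

end Frames

section PullbackFrames

variable {X Y : Scheme.{u}} {I : Type u} [Fintype I]

/-- Sections of `M` over an open subset of `U`, as sections of the restriction of `M` to `U`. -/
noncomputable def toRestrict (M : X.Modules) (U : X.Opens) (W : U.toScheme.Opens) :
    Γ(M, U.ι ''ᵁ W) →+ Γ(M.restrict U.ι, W) :=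
  (M.restrictAppIso U.ι W).inv.hom

lemma toRestrict_bijective (M : X.Modules) (U : X.Opens) (W : U.toScheme.Opens) :
    Function.Bijective (toRestrict M U W) :=
  Function.bijective_id

lemma toRestrict_smul (M : X.Modules) (U : X.Opens) (W : U.toScheme.Opens)
    (c : Γ(X, U.ι ''ᵁ W)) (s : Γ(M, U.ι ''ᵁ W)) :
    toRestrict M U W (c • s) = (U.ι.appIso W).hom c • toRestrict M U W s :=
  congr($(M.smul_restrictAppIso_inv U.ι W c) s)

lemma res_toRestrict (M : X.Modules) (U : X.Opens) (W W' : U.toScheme.Opens) (h : W' ≤ W)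
    (s : Γ(M, U.ι ''ᵁ W)) :
    res _ W W' h (toRestrict M U W s) =
      toRestrict M U W' (res M _ _ (U.ι.image_mono h) s) := rfl

/-- Restriction to an open subset and pull-back to it agree. -/
noncomputable def restrictIso (M : X.Modules) (U : X.Opens) :
    M.restrict U.ι ≅ (Scheme.Modules.pullback U.ι).obj M :=
  (Scheme.Modules.restrictFunctorIsoPullback U.ι).app M

lemma image_le_of_le_preimage {U V : X.Opens} {W : U.toScheme.Opens} (h : W ≤ U.ι ⁻¹ᵁ V) :
    U.ι ''ᵁ W ≤ V := by
  rintro _ ⟨x, hx, rfl⟩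
  exact h hx

lemma pullOn_ι (M : X.Modules) (U V : X.Opens) (s : Γ(M, V)) :
    pullOn U.ι M V s = (restrictIso M U).hom.app (U.ι ⁻¹ᵁ V)
      (toRestrict M U _ (res M V _ (image_le_of_le_preimage le_rfl) s)) :=
  congr(($(((Scheme.Modules.restrictAdjunction U.ι).unit_leftAdjointUniq_hom_app
    (Scheme.Modules.pullbackPushforwardAdjunction U.ι) M))).app V s).symm

lemma pullLE_ι (M : X.Modules) (U V : X.Opens) (W : U.toScheme.Opens) (h : W ≤ U.ι ⁻¹ᵁ V)
    (s : Γ(M, V)) :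
    pullLE U.ι M V W h s = (restrictIso M U).hom.app W
      (toRestrict M U _ (res M V _ (image_le_of_le_preimage h) s)) := by
  rw [pullLE_apply, pullOn_ι, res_app, res_toRestrict, res_res]

lemma app_bijective {M N : X.Modules} (e : M ≅ N) (U : X.Opens) :
    Function.Bijective (e.hom.app U) :=
  ⟨Function.LeftInverse.injective (inv_app_hom_app e U),
    Function.RightInverse.surjective (hom_app_inv_app e U)⟩

lemma res_bijective (M : X.Modules) {U V : X.Opens} (h : V ≤ U) (h' : U ≤ V) :
    Function.Bijective (res M U V h) := by
  obtain rfl := le_antisymm h h'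
  rw [show (res M V V h : Γ(M, V) → Γ(M, V)) = id from funext (res_self M V h)]
  exact Function.bijective_id

lemma map_bijective {U V : X.Opens} (h : V ≤ U) (h' : U ≤ V) :
    Function.Bijective (X.presheaf.map (homOfLE h).op) := by
  obtain rfl := le_antisymm h h'
  rw [show (homOfLE h).op = 𝟙 _ from rfl, CategoryTheory.Functor.map_id]
  exact Function.bijective_id

lemma pullLE_ι_bijective (M : X.Modules) (U : X.Opens) :
    Function.Bijective (pullLE U.ι M U ⊤ (by simp)) := by
  have : (pullLE U.ι M U ⊤ (by simp) : Γ(M, U) → _) =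
      (restrictIso M U).hom.app ⊤ ∘ toRestrict M U ⊤ ∘
        res M U (U.ι ''ᵁ ⊤) (image_le_of_le_preimage (by simp)) :=
    funext fun s ↦ pullLE_ι M U U ⊤ _ s
  rw [this]
  exact (app_bijective _ _).comp ((toRestrict_bijective M U ⊤).comp (res_bijective M _ (by simp)))

lemma isFrame_restrict_iff (M : X.Modules) (U : X.Opens) (e : I → Γ(M, U)) :
    IsFrame (M.restrict U.ι) ⊤ (fun i ↦ toRestrict M U ⊤
      (res M U _ (image_le_of_le_preimage (by simp)) (e i))) ↔ IsFrame M U e := by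
  have key (W : U.toScheme.Opens) (h : U.ι ''ᵁ W ≤ U) (c : I → Γ(X, U.ι ''ᵁ W)) :
      comb (fun i ↦ toRestrict M U ⊤
        (res M U _ (image_le_of_le_preimage (by simp)) (e i))) W le_top
          (fun i ↦ (U.ι.appIso W).hom (c i)) = toRestrict M U W (comb e _ h c) := by
    simp only [comb, map_sum, toRestrict_smul, res_toRestrict, res_res]
  have hb (W : U.toScheme.Opens) : Function.Bijective
      fun (c : I → Γ(X, U.ι ''ᵁ W)) (i : I) ↦ (U.ι.appIso W).hom (c i) := by
    have h₁ := (ConcreteCategory.isIso_iff_bijective (U.ι.appIso W).hom).mp inferInstance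
    exact ⟨fun c d hcd ↦ funext fun i ↦ h₁.1 (congrFun hcd i),
      fun c ↦ ⟨fun i ↦ (h₁.2 (c i)).choose, funext fun i ↦ (h₁.2 (c i)).choose_spec⟩⟩
  have main (W : U.toScheme.Opens) (h : U.ι ''ᵁ W ≤ U) :
      Function.Bijective (comb (fun i ↦ toRestrict M U ⊤
        (res M U _ (image_le_of_le_preimage (by simp)) (e i))) W le_top) ↔
      Function.Bijective (comb e _ h) := by
    rw [← Function.Bijective.of_comp_iff _ (hb W),
      ← Function.Bijective.of_comp_iff' (toRestrict_bijective M U W)]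
    exact iff_of_eq (congrArg Function.Bijective (funext fun c ↦ key W h c))
  constructor
  · intro H V hV
    have h₁ : U.ι ''ᵁ (U.ι ⁻¹ᵁ V) = V := by
      rw [Scheme.Hom.image_preimage_eq_opensRange_inf, Scheme.Opens.opensRange_ι,
        inf_eq_right.mpr hV]
    have h₂ : U.ι ''ᵁ (U.ι ⁻¹ᵁ V) ≤ U := h₁.trans_le hV
    have h₃ := (main (U.ι ⁻¹ᵁ V) h₂).mp (H _ le_top)
    generalize U.ι ''ᵁ (U.ι ⁻¹ᵁ V) = V' at h₁ h₂ h₃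
    subst h₁
    exact h₃
  · intro H W _
    exact (main W (by simpa using U.ι_image_le W)).mpr (H _ _)

lemma isFrame_pullLE_ι_iff (M : X.Modules) (U : X.Opens) (e : I → Γ(M, U)) :
    IsFrame ((Scheme.Modules.pullback U.ι).obj M) ⊤
      (fun i ↦ pullLE U.ι M U ⊤ (by simp) (e i)) ↔ IsFrame M U e := by
  rw [← isFrame_restrict_iff M U e]
  simp only [pullLE_ι]
  constructor
  · intro h
    convert h.app_iso (restrictIso M U).symm using 1
    funext i
    exact (inv_app_hom_app _ _ _).symm
  · intro h
    exact h.app_iso (restrictIso M U)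

lemma IsFrame.pullLE_top {f : Y ⟶ X} {M : X.Modules} {e : I → Γ(M, ⊤)} (he : IsFrame M ⊤ e) :
    IsFrame ((Scheme.Modules.pullback f).obj M) ⊤ fun i ↦ pullLE f M ⊤ ⊤ le_top (e i) := by
  apply isFrame_of_bijective
  intro N
  have h₁ (i : I) : pullLE f M ⊤ ⊤ le_top (e i) = pullOn f M ⊤ (e i) := res_self _ _ _ _
  have h₂ : (fun (φ : (Scheme.Modules.pullback f).obj M ⟶ N) (i : I) ↦
      φ.app ⊤ (pullLE f M ⊤ ⊤ le_top (e i))) =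
      (fun (φ : M ⟶ (Scheme.Modules.pushforward f).obj N) (i : I) ↦ φ.app ⊤ (e i)) ∘
        (Scheme.Modules.pullbackPushforwardAdjunction f).homEquiv M N := by
    funext φ i
    rw [Function.comp_apply, Adjunction.homEquiv_unit, h₁]
    rfl
  rw [h₂]
  exact (bijective_of_isFrame e he _).comp (Equiv.bijective _)

/-- The pull-back of a frame is a frame. -/
lemma IsFrame.pullLE {f : Y ⟶ X} {M : X.Modules} {U : X.Opens} {e : I → Γ(M, U)}
    (he : IsFrame M U e) (W : Y.Opens) (hW : W ≤ f ⁻¹ᵁ U) :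
    IsFrame ((Scheme.Modules.pullback f).obj M) W fun i ↦ TorsorRep.pullLE f M U W hW (e i) := by
  suffices h : IsFrame ((Scheme.Modules.pullback f).obj M) (f ⁻¹ᵁ U)
      fun i ↦ TorsorRep.pullLE f M U _ le_rfl (e i) by
    convert h.res W hW using 1
    funext i
    rw [pullLE_res_right]
  rw [← isFrame_pullLE_ι_iff]
  have h₁ := ((isFrame_pullLE_ι_iff M U e).mpr he).pullLE_top (f := f ∣_ U)
  have h₂ := (h₁.app_iso (pcompIso (f ∣_ U) U.ι _ (morphismRestrict_ι f U) M)).app_iso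
    (pcompIso (f ⁻¹ᵁ U).ι f _ rfl M).symm
  convert h₂ using 1
  funext i
  rw [pcompIso_hom_app_pullLE _ _ _ _ M U ⊤ ⊤ (by simp) le_top
    (by simp)]
  exact (pcompIso_inv_app_pullLE _ _ _ _ M U _ ⊤ le_rfl (by simp) (by simp) _).symm

/-- A vector bundle has frames locally. -/
lemma IsVectorBundle.exists_isFrame {E : X.Modules} (hE : IsVectorBundle E) (x : X) :
    ∃ (U : X.Opens) (n : ℕ) (e : ULift.{u} (Fin n) → Γ(E, U)), x ∈ U ∧ IsFrame E U e := by
  obtain ⟨U, n, hx, ⟨α⟩⟩ := hE x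
  have h := (isFrame_stdSec U.toScheme (ULift.{u} (Fin n))).app_iso α.symm
  choose e he using fun i ↦ (pullLE_ι_bijective E U).2
    (α.symm.hom.app ⊤ (stdSec U.toScheme i))
  refine ⟨U, n, e, hx, (isFrame_pullLE_ι_iff E U e).mp ?_⟩
  rw [funext he]
  exact h

lemma isVectorBundle_of_exists_isFrame {E : X.Modules}
    (h : ∀ x : X, ∃ (U : X.Opens) (n : ℕ) (e : ULift.{u} (Fin n) → Γ(E, U)),
      x ∈ U ∧ IsFrame E U e) : IsVectorBundle E := by
  intro x
  obtain ⟨U, n, e, hx, he⟩ := h x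
  obtain ⟨α, -⟩ := exists_iso_of_isFrame _ ((isFrame_pullLE_ι_iff E U e).mpr he)
  exact ⟨U, n, hx, ⟨α.symm⟩⟩

end PullbackFrames

/-! ### Descent of functions -/

section FunctionDescent

variable {T P X : Scheme.{u}} {a p : P ⟶ T} {j : T ⟶ X}

lemma appLE_apply_appLE {X Y Z : Scheme.{u}} (f : X ⟶ Y) (g : Y ⟶ Z) (k : X ⟶ Z) (hk : f ≫ g = k)
    (U : Z.Opens) (V : Y.Opens) (W : X.Opens) (h₁ : V ≤ g ⁻¹ᵁ U) (h₂ : W ≤ f ⁻¹ᵁ V)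
    (h₃ : W ≤ k ⁻¹ᵁ U) (c : Γ(Z, U)) :
    f.appLE V W h₂ (g.appLE U V h₁ c) = k.appLE U W h₃ c := by
  subst hk
  exact congr($(Scheme.Hom.appLE_comp_appLE f g U V W h₁ h₂) c)

lemma le_preimage_top {X Y : Scheme.{u}} (f : X ⟶ Y) (W : X.Opens) : W ≤ f ⁻¹ᵁ ⊤ := fun _ _ ↦ trivial

lemma le_preimage_comp {X Y Z : Scheme.{u}} {f : X ⟶ Y} {g : Y ⟶ Z} {k : X ⟶ Z} (hk : f ≫ g = k)
    {U : Z.Opens} {V : Y.Opens} {W : X.Opens} (h₁ : V ≤ g ⁻¹ᵁ U) (h₂ : W ≤ f ⁻¹ᵁ V) :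
    W ≤ k ⁻¹ᵁ U := by
  subst hk
  exact fun x hx ↦ h₁ (h₂ hx)

lemma le_preimage_preimage {X Y Z : Scheme.{u}} {f : X ⟶ Y} {g : Y ⟶ Z} {k : X ⟶ Z}
    (hk : f ≫ g = k) {U : Z.Opens} {W : X.Opens} (h : W ≤ k ⁻¹ᵁ U) : W ≤ f ⁻¹ᵁ g ⁻¹ᵁ U := by
  subst hk
  exact h

lemma map_apply_appLE {X Y : Scheme.{u}} (f : X ⟶ Y) (U : Y.Opens) (V W : X.Opens)
    (h₁ : V ≤ f ⁻¹ᵁ U) (h₂ : W ≤ V) (c : Γ(Y, U)) :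
    X.presheaf.map (homOfLE h₂).op (f.appLE U V h₁ c) = f.appLE U W (h₂.trans h₁) c :=
  congr($(f.appLE_map h₁ (homOfLE h₂).op) c)

lemma appLE_apply_map {X Y : Scheme.{u}} (f : X ⟶ Y) (U U' : Y.Opens) (V : X.Opens)
    (h₁ : V ≤ f ⁻¹ᵁ U') (h₂ : U' ≤ U) (c : Γ(Y, U)) :
    f.appLE U' V h₁ (Y.presheaf.map (homOfLE h₂).op c) =
      f.appLE U V (h₁.trans (f.preimage_mono h₂)) c :=
  congr($(f.map_appLE h₁ (homOfLE h₂).op) c)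

lemma map_map_apply {U V W : X.Opens} (h : V ≤ U) (h' : W ≤ V) (c : Γ(X, U)) :
    X.presheaf.map (homOfLE h').op (X.presheaf.map (homOfLE h).op c) =
      X.presheaf.map (homOfLE (h'.trans h)).op c := by
  rw [← CommRingCat.comp_apply, ← Functor.map_comp]
  rfl

lemma appTop_apply {X Y : Scheme.{u}} (f : X ⟶ Y) (c : Γ(Y, ⊤)) :
    f.appTop c = f.appLE ⊤ ⊤ (le_preimage_top f ⊤) c :=
  congr($(f.app_eq_appLE (U := ⊤)) c)

lemma app_apply {X Y : Scheme.{u}} (f : X ⟶ Y) (U : Y.Opens) (c : Γ(Y, U)) :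
    f.app U c = f.appLE U _ le_rfl c :=
  congr($(f.app_eq_appLE) c)

lemma appLE_ι_bijective {X : Scheme.{u}} (U : X.Opens) :
    Function.Bijective (U.ι.appLE U ⊤ (by simp)) := by
  rw [Scheme.Opens.ι_appLE]
  exact map_bijective _ (by simp)

/-- Functions are morphisms to the affine line, and a faithfully flat morphism is an
epimorphism. -/
lemma app_injective [Flat j] [Surjective j] (U : X.Opens) : Function.Injective (j.app U) := by
  have : Surjective (j ∣_ U) := IsZariskiLocalAtTarget.restrict ‹_› U
  have := Flat.epi_of_flat_of_surjective (j ∣_ U)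
  have h (c : Γ(X, U)) : ((j ∣_ U).appTop) (U.ι.appLE U ⊤ (by simp) c) =
      (j ⁻¹ᵁ U).ι.appLE (j ⁻¹ᵁ U) ⊤ (by simp) (j.app U c) := by
    rw [app_apply, appTop_apply,
      appLE_apply_appLE _ _ _ (morphismRestrict_ι j U) _ _ _ _ _ (by simp),
      appLE_apply_appLE _ _ _ rfl]
  have hinj : Function.Injective (j ∣_ U).appTop := by
    intro c d hcd
    have := (AffineSpace.toSpecMvPolyIntEquiv (X := U) PUnit.{u + 1}).symm.injective.eq_iff
      (a := fun _ ↦ c) (b := fun _ ↦ d)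
    refine congrFun (this.mp ?_) ⟨⟩
    rw [← cancel_epi (j ∣_ U)]
    apply (AffineSpace.toSpecMvPolyIntEquiv PUnit.{u + 1}).injective
    funext i
    rw [AffineSpace.toSpecMvPolyIntEquiv_comp, AffineSpace.toSpecMvPolyIntEquiv_comp,
      Equiv.apply_symm_apply, Equiv.apply_symm_apply]
    exact hcd
  intro c d hcd
  apply (appLE_ι_bijective U).1
  apply hinj
  rw [h, h, hcd]

/-- Functions descend along a faithfully flat quasi-compact morphism: they are morphisms to the
affine line, and the morphism is an effective epimorphism. -/
lemma exists_app_eq [Flat j] [Surjective j] [QuasiCompact j] (hP : IsPullback a p j j)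
    (U : X.Opens) (c : Γ(T, j ⁻¹ᵁ U))
    (hc : a.appLE (j ⁻¹ᵁ U) ((p ≫ j) ⁻¹ᵁ U) (le_preimage_preimage hP.w le_rfl) c =
      p.appLE (j ⁻¹ᵁ U) ((p ≫ j) ⁻¹ᵁ U) (le_preimage_preimage rfl le_rfl) c) :
    ∃ c₀ : Γ(X, U), j.app U c₀ = c := by
  have : Surjective (j ∣_ U) := IsZariskiLocalAtTarget.restrict ‹_› U
  have : QuasiCompact (j ∣_ U) := inferInstance
  let c' : Γ((j ⁻¹ᵁ U).toScheme, ⊤) := (j ⁻¹ᵁ U).ι.appLE (j ⁻¹ᵁ U) ⊤ (by simp) c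
  let e := (AffineSpace.toSpecMvPolyIntEquiv PUnit.{u + 1}).symm fun _ ↦ c'
  have he {Z : Scheme.{u}} (g₁ g₂ : Z ⟶ (j ⁻¹ᵁ U).toScheme)
      (h : g₁ ≫ (j ∣_ U) = g₂ ≫ (j ∣_ U)) : g₁ ≫ e = g₂ ≫ e := by
    apply (AffineSpace.toSpecMvPolyIntEquiv PUnit.{u + 1}).injective
    funext i
    rw [AffineSpace.toSpecMvPolyIntEquiv_comp, AffineSpace.toSpecMvPolyIntEquiv_comp,
      Equiv.apply_symm_apply]
    have h' : (g₁ ≫ (j ⁻¹ᵁ U).ι) ≫ j = (g₂ ≫ (j ⁻¹ᵁ U).ι) ≫ j := by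
      simpa using congr($h ≫ U.ι)
    let g := hP.lift _ _ h'
    have h₁ : g ≫ a = g₁ ≫ (j ⁻¹ᵁ U).ι := hP.lift_fst _ _ h'
    have h₂ : g ≫ p = g₂ ≫ (j ⁻¹ᵁ U).ι := hP.lift_snd _ _ h'
    have htop : (⊤ : Z.Opens) ≤ g ⁻¹ᵁ (p ≫ j) ⁻¹ᵁ U := by
      intro z _
      change (g ≫ p ≫ j) z ∈ U
      rw [reassoc_of% h₂]
      exact (g₂ z).2
    have h₃ : (⊤ : Z.Opens) ≤ (g₁ ≫ (j ⁻¹ᵁ U).ι) ⁻¹ᵁ j ⁻¹ᵁ U := by simp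
    have h₄ : (⊤ : Z.Opens) ≤ (g₂ ≫ (j ⁻¹ᵁ U).ι) ⁻¹ᵁ j ⁻¹ᵁ U := by simp
    have h₅ := congr(g.appLE _ ⊤ htop $hc)
    rw [appLE_apply_appLE g a _ h₁ _ _ _ _ _ h₃,
      appLE_apply_appLE g p _ h₂ _ _ _ _ _ h₄] at h₅
    rw [appTop_apply, appTop_apply, appLE_apply_appLE g₁ _ _ rfl _ _ _ _ _ h₃,
      appLE_apply_appLE g₂ _ _ rfl _ _ _ _ _ h₄]
    exact h₅
  let d := EffectiveEpi.desc (j ∣_ U) e he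
  have hd : (j ∣_ U) ≫ d = e := EffectiveEpi.fac (j ∣_ U) e he
  obtain ⟨c₀, hc₀⟩ := (appLE_ι_bijective U).2 (AffineSpace.toSpecMvPolyIntEquiv PUnit.{u + 1} d ⟨⟩)
  refine ⟨c₀, (appLE_ι_bijective (j ⁻¹ᵁ U)).1 ?_⟩
  have h := congrFun (congrArg (AffineSpace.toSpecMvPolyIntEquiv PUnit.{u + 1}) hd) ⟨⟩
  rw [AffineSpace.toSpecMvPolyIntEquiv_comp, Equiv.apply_symm_apply, ← hc₀] at h
  refine Eq.trans ?_ h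
  rw [app_apply, appTop_apply,
    appLE_apply_appLE _ _ _ (morphismRestrict_ι j U) _ _ _ _ _ (by simp),
    appLE_apply_appLE _ _ _ rfl]

end FunctionDescent

/-! ### Invariant sections -/

/-- A pair of morphisms `a, p : P ⟶ T` with `j ∘ a = r = j ∘ p`. -/
structure Fork (X : Scheme.{u}) where
  /-- the source of the pair -/
  P : Scheme.{u}
  /-- the target of the pair -/
  T : Scheme.{u}
  /-- the first morphism -/
  a : P ⟶ T
  /-- the second morphism -/
  p : P ⟶ T
  /-- the morphism which equalises the pair -/
  j : T ⟶ X
  /-- the composite -/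
  r : P ⟶ X
  ha : a ≫ j = r
  hp : p ≫ j = r

section PullPush

variable {P T X : Scheme.{u}}

/-- A section of `M` over `f⁻¹(U)`, as a section of `f_* M` over `U`. -/
noncomputable def toPush (f : T ⟶ X) (M : T.Modules) (U : X.Opens) :
    Γ(M, f ⁻¹ᵁ U) →+ Γ((Scheme.Modules.pushforward f).obj M, U) :=
  AddMonoidHom.id Γ(M, f ⁻¹ᵁ U)

lemma toPush_bijective (f : T ⟶ X) (M : T.Modules) (U : X.Opens) :
    Function.Bijective (toPush f M U) := Function.bijective_id

lemma app_toPush (f : T ⟶ X) {M N : T.Modules} (φ : M ⟶ N) (U : X.Opens) (s : Γ(M, f ⁻¹ᵁ U)) :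
    ((Scheme.Modules.pushforward f).map φ).app U (toPush f M U s) =
      toPush f N U (φ.app (f ⁻¹ᵁ U) s) := rfl

lemma unit_app_eq_toPush (f : T ⟶ X) (M : X.Modules) (U : X.Opens) (s : Γ(M, U)) :
    ((Scheme.Modules.pullbackPushforwardAdjunction f).unit.app M).app U s =
      toPush f _ U (pullLE f M U _ le_rfl s) :=
  (res_self _ _ _ (pullOn f M U s)).symm

/-- Pulling back sections along `g`, as a morphism `j_* F ⟶ r_* g^* F`, where `r = j ∘ g`. -/
noncomputable def pullPush (g : P ⟶ T) (j : T ⟶ X) (r : P ⟶ X) (h : g ≫ j = r) (F : T.Modules) :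
    (Scheme.Modules.pushforward j).obj F ⟶
      (Scheme.Modules.pushforward r).obj ((Scheme.Modules.pullback g).obj F) :=
  (Scheme.Modules.pushforward j).map ((Scheme.Modules.pullbackPushforwardAdjunction g).unit.app F) ≫
    (Scheme.Modules.pushforwardComp g j).hom.app _ ≫ (Scheme.Modules.pushforwardCongr h).hom.app _

lemma pullPush_app (g : P ⟶ T) (j : T ⟶ X) (r : P ⟶ X) (h : g ≫ j = r) (F : T.Modules)
    (U : X.Opens) (s : Γ(F, j ⁻¹ᵁ U)) :
    (pullPush g j r h F).app U (toPush j F U s) =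
      toPush r _ U (pullLE g F _ _ (le_preimage_preimage h le_rfl) s) := by
  subst h
  rfl

/-- The functor of sections over `U`. -/
noncomputable def sectionsOver (U : X.Opens) : X.Modules ⥤ Ab.{u} :=
  Scheme.Modules.toPresheaf X ⋙ (evaluation (TopologicalSpace.Opens X)ᵒᵖ Ab.{u}).obj (.op U)

instance (U : X.Opens) {J : Type} [SmallCategory J] [FinCategory J] :
    PreservesLimitsOfShape J (sectionsOver U) := by
  have : PreservesLimitsOfShape J
      ((evaluation (TopologicalSpace.Opens X)ᵒᵖ Ab.{u}).obj (.op U)) :=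
    evaluation_preservesLimitsOfShape _
  exact comp_preservesLimitsOfShape (Scheme.Modules.toPresheaf X)
    ((evaluation (TopologicalSpace.Opens X)ᵒᵖ Ab.{u}).obj (.op U))

instance (U : X.Opens) : (sectionsOver U).PreservesZeroMorphisms where
  map_zero _ _ := rfl

lemma app_injective_of_mono {M N : X.Modules} (α : M ⟶ N) [Mono α] (U : X.Opens) :
    Function.Injective (α.app U) := by
  have : Mono ((sectionsOver U).map α) := inferInstance
  exact (AddCommGrpCat.mono_iff_injective _).mp this

lemma exists_kernel_app_eq {M N : X.Modules} (d : M ⟶ N) (U : X.Opens) (s : Γ(M, U))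
    (hs : d.app U s = 0) : ∃ t : Γ(kernel d, U), (kernel.ι d).app U t = s := by
  let G := sectionsOver U
  let hc := isLimitForkMapOfIsLimit' G (kernel.condition d) (kernelIsKernel d)
  -- elements of an abelian group are homomorphisms from `ℤ`
  let f : AddCommGrpCat.of (ULift.{u} ℤ) ⟶ G.obj M :=
    AddCommGrpCat.ofHom (((zmultiplesHom Γ(M, U)) s).comp AddEquiv.ulift.toAddMonoidHom)
  have hf : f ≫ G.map d = 0 := by
    ext ⟨n⟩
    change d.app U (n • s) = 0
    rw [map_zsmul, hs, smul_zero]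
  let l := KernelFork.IsLimit.lift' hc f hf
  refine ⟨l.1 ⟨1⟩, ?_⟩
  refine (congr($(l.2) ⟨1⟩)).trans ?_
  change (1 : ℤ) • s = s
  simp

end PullPush

namespace Fork

variable {X : Scheme.{u}} (C : Fork X) {F : C.T.Modules}
  (φ : (Scheme.Modules.pullback C.a).obj F ⟶ (Scheme.Modules.pullback C.p).obj F)

lemma le_a (U : X.Opens) : C.r ⁻¹ᵁ U ≤ C.a ⁻¹ᵁ C.j ⁻¹ᵁ U := le_preimage_preimage C.ha le_rfl

lemma le_p (U : X.Opens) : C.r ⁻¹ᵁ U ≤ C.p ⁻¹ᵁ C.j ⁻¹ᵁ U := le_preimage_preimage C.hp le_rfl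

/-- A section `s` of `F` over `j⁻¹(U)` is invariant with respect to `φ : a^* F ⟶ p^* F` if
`φ(a^* s) = p^* s`. -/
def Inv (U : X.Opens) (s : Γ(F, C.j ⁻¹ᵁ U)) : Prop :=
  φ.app (C.r ⁻¹ᵁ U) (pullLE C.a F _ _ (C.le_a U) s) = pullLE C.p F _ _ (C.le_p U) s

variable {φ} in
lemma Inv.res {U : X.Opens} {s : Γ(F, C.j ⁻¹ᵁ U)} (hs : C.Inv φ U s) (V : X.Opens) (h : V ≤ U) :
    C.Inv φ V (TorsorRep.res F _ _ (C.j.preimage_mono h) s) := by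
  have := congrArg (TorsorRep.res _ _ (C.r ⁻¹ᵁ V) (C.r.preimage_mono h)) hs
  rw [res_app, pullLE_res_right, pullLE_res_right] at this
  rw [Inv, pullLE_res_left, pullLE_res_left]
  exact this

/-- The difference of the two pull-backs of sections to `P`. -/
noncomputable def diff : (Scheme.Modules.pushforward C.j).obj F ⟶
    (Scheme.Modules.pushforward C.r).obj ((Scheme.Modules.pullback C.p).obj F) :=
  pullPush C.a C.j C.r C.ha F ≫ (Scheme.Modules.pushforward C.r).map φ -
    pullPush C.p C.j C.r C.hp F

lemma diff_app (U : X.Opens) (s : Γ(F, C.j ⁻¹ᵁ U)) :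
    (C.diff φ).app U (toPush C.j F U s) = toPush C.r _ U
      (φ.app (C.r ⁻¹ᵁ U) (pullLE C.a F _ _ (C.le_a U) s) - pullLE C.p F _ _ (C.le_p U) s) := by
  rw [map_sub, ← app_toPush, ← pullPush_app C.a C.j C.r C.ha, ← pullPush_app C.p C.j C.r C.hp]
  rfl

lemma diff_app_eq_zero_iff (U : X.Opens) (s : Γ(F, C.j ⁻¹ᵁ U)) :
    (C.diff φ).app U (toPush C.j F U s) = 0 ↔ C.Inv φ U s := by
  rw [diff_app, Inv, ← sub_eq_zero (b := pullLE C.p F _ _ (C.le_p U) s)]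
  exact (injective_iff_map_eq_zero' _).mp (toPush_bijective C.r _ U).1 _

/-- The module of invariant sections. -/
noncomputable def invariants : X.Modules := kernel (C.diff φ)

/-- The inclusion of the invariant sections into `j_* F`. -/
noncomputable def incl : C.invariants φ ⟶ (Scheme.Modules.pushforward C.j).obj F :=
  kernel.ι (C.diff φ)

instance : Mono (C.incl φ) := inferInstanceAs (Mono (kernel.ι _))

/-- The inclusion `incl` over `U`, with values in the sections of `F` over `j⁻¹(U)`. -/
noncomputable def inclOn (U : X.Opens) : Γ(C.invariants φ, U) →+ Γ(F, C.j ⁻¹ᵁ U) :=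
  ((C.incl φ).app U).hom

lemma incl_app (U : X.Opens) (s : Γ(C.invariants φ, U)) :
    (C.incl φ).app U s = toPush C.j F U (C.inclOn φ U s) := rfl

lemma inclOn_injective (U : X.Opens) : Function.Injective (C.inclOn φ U) :=
  app_injective_of_mono (C.incl φ) U

lemma inv_inclOn (U : X.Opens) (s : Γ(C.invariants φ, U)) : C.Inv φ U (C.inclOn φ U s) := by
  rw [← diff_app_eq_zero_iff, ← incl_app, ← AddCommGrpCat.comp_apply, ← Scheme.Modules.Hom.comp_app]
  have : C.incl φ ≫ C.diff φ = 0 := kernel.condition _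
  rw [this]
  rfl

lemma exists_inclOn_eq (U : X.Opens) (s : Γ(F, C.j ⁻¹ᵁ U)) (hs : C.Inv φ U s) :
    ∃ t, C.inclOn φ U t = s :=
  exists_kernel_app_eq (C.diff φ) U (toPush C.j F U s) ((C.diff_app_eq_zero_iff φ U s).mpr hs)

lemma inclOn_res (U V : X.Opens) (h : V ≤ U) (s : Γ(C.invariants φ, U)) :
    C.inclOn φ V (TorsorRep.res _ U V h s) =
      TorsorRep.res F _ _ (C.j.preimage_mono h) (C.inclOn φ U s) :=
  (res_app (C.incl φ) U V h s).symm

lemma inclOn_smul (U : X.Opens) (c : Γ(X, U)) (s : Γ(C.invariants φ, U)) :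
    C.inclOn φ U (c • s) = C.j.app U c • C.inclOn φ U s :=
  Scheme.Modules.Hom.app_smul (C.incl φ) c s

/-- Morphisms into `j_* F` whose values are invariant sections factor through `invariants`. -/
lemma exists_comp_incl_eq {M : X.Modules} (α : M ⟶ (Scheme.Modules.pushforward C.j).obj F)
    (h : ∀ (U : X.Opens) (s : Γ(M, U)) (t : Γ(F, C.j ⁻¹ᵁ U)), α.app U s = toPush C.j F U t →
      C.Inv φ U t) : ∃ β : M ⟶ C.invariants φ, β ≫ C.incl φ = α := by
  refine ⟨kernel.lift _ α ?_, kernel.lift_ι _ _ _⟩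
  ext U s
  obtain ⟨t, ht⟩ := (toPush_bijective C.j F U).2 (α.app U s)
  rw [Scheme.Modules.Hom.comp_app, AddCommGrpCat.comp_apply, ← ht,
    (C.diff_app_eq_zero_iff φ U t).mpr (h U s t ht.symm)]
  rfl

end Fork

/-! ### Descent of modules with invariant frames -/

namespace Fork

variable {X : Scheme.{u}} (C : Fork X)

/-- Invariant functions on `T` descend uniquely to `X`. -/
def Exact : Prop :=
  ∀ (U : X.Opens) (c : Γ(C.T, C.j ⁻¹ᵁ U)),
    C.a.appLE _ _ (C.le_a U) c = C.p.appLE _ _ (C.le_p U) c → ∃! c₀ : Γ(X, U), C.j.app U c₀ = c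

/-- The identification `a^* j^* E ≅ r^* E ≅ p^* j^* E`. -/
noncomputable def canon (E : X.Modules) :
    (Scheme.Modules.pullback C.a).obj ((Scheme.Modules.pullback C.j).obj E) ⟶
      (Scheme.Modules.pullback C.p).obj ((Scheme.Modules.pullback C.j).obj E) :=
  transport C.ha C.hp (𝟙 _)

lemma canon_eq (E : X.Modules) :
    C.canon E = (pcompIso C.a C.j C.r C.ha E).hom ≫ (pcompIso C.p C.j C.r C.hp E).inv := by
  rw [canon, transport_eq_pcompIso, Category.id_comp]

lemma inv_pullLE (E : X.Modules) (U : X.Opens) (s : Γ(E, U)) :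
    C.Inv (C.canon E) U (pullLE C.j E U _ le_rfl s) := by
  rw [Inv, canon_eq, Scheme.Modules.Hom.comp_app, AddCommGrpCat.comp_apply,
    pcompIso_hom_app_pullLE _ _ _ _ _ _ _ _ _ _ le_rfl]
  exact pcompIso_inv_app_pullLE _ _ _ _ _ _ _ _ _ _ _ _

variable {C} {I : Type u} [Fintype I]

lemma inclOn_comb {F : C.T.Modules}
    (φ : (Scheme.Modules.pullback C.a).obj F ⟶ (Scheme.Modules.pullback C.p).obj F)
    {U : X.Opens} (e : I → Γ(C.invariants φ, U)) (V : X.Opens) (h : V ≤ U) (c : I → Γ(X, V)) :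
    C.inclOn φ V (comb e V h c) = comb (fun i ↦ C.inclOn φ U (e i)) (C.j ⁻¹ᵁ V)
      (C.j.preimage_mono h) fun i ↦ C.j.app V (c i) := by
  simp only [comb, map_sum, inclOn_smul, inclOn_res]

lemma pullLE_comb {Y Z : Scheme.{u}} (f : Y ⟶ Z) {M : Z.Modules} {U : Z.Opens} (e : I → Γ(M, U))
    (V : Z.Opens) (h : V ≤ U) (W W' : Y.Opens) (hW : W ≤ f ⁻¹ᵁ V) (hW' : W' ≤ f ⁻¹ᵁ U)
    (hWW' : W ≤ W') (c : I → Γ(Z, V)) :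
    pullLE f M V W hW (comb e V h c) = comb (fun i ↦ pullLE f M U W' hW' (e i)) W hWW'
      fun i ↦ f.appLE V W hW (c i) := by
  simp only [comb, map_sum, pullLE_smul, pullLE_res_left, pullLE_res_right]

/-- A frame of invariant sections is a frame of the module of invariants: the coordinates of an
invariant section are invariant functions, and these descend. -/
lemma isFrame_invariants (hC : C.Exact) {F : C.T.Modules}
    {φ : (Scheme.Modules.pullback C.a).obj F ⟶ (Scheme.Modules.pullback C.p).obj F}
    {U : X.Opens} (e : I → Γ(C.invariants φ, U))
    (he : IsFrame F (C.j ⁻¹ᵁ U) fun i ↦ C.inclOn φ U (e i)) :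
    IsFrame (C.invariants φ) U e := by
  intro V h
  have hj := C.j.preimage_mono h
  constructor
  · intro c d hcd
    have h₁ := congrArg (C.inclOn φ V) hcd
    rw [inclOn_comb, inclOn_comb] at h₁
    have h₂ := (he _ hj).1 h₁
    funext i
    have h₃ : C.j.app V (c i) = C.j.app V (d i) := congrFun h₂ i
    have h₄ : C.a.appLE _ _ (C.le_a V) (C.j.app V (d i)) =
        C.p.appLE _ _ (C.le_p V) (C.j.app V (d i)) := by
      rw [app_apply, appLE_apply_appLE _ _ _ C.ha _ _ _ _ _ le_rfl,
        appLE_apply_appLE _ _ _ C.hp _ _ _ _ _ le_rfl]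
    exact (hC V _ h₄).unique h₃ rfl
  · intro s
    obtain ⟨c, hc⟩ := (he _ hj).2 (C.inclOn φ V s)
    have hr := C.r.preimage_mono h
    have h₁ := C.inv_inclOn φ V s
    have h₂ (i : I) := C.inv_inclOn φ U (e i)
    rw [Inv, ← hc, pullLE_comb C.a _ _ hj _ (C.r ⁻¹ᵁ U) _ (C.le_a U) hr,
      pullLE_comb C.p _ _ hj _ (C.r ⁻¹ᵁ U) _ (C.le_p U) hr, app_comb, funext h₂] at h₁
    have h₃ := (he.pullLE (f := C.p) (C.r ⁻¹ᵁ U) (C.le_p U) _ hr).1 h₁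
    choose c₀ hc₀ _ using fun i ↦ hC V (c i) (congrFun h₃ i)
    refine ⟨c₀, C.inclOn_injective φ V ?_⟩
    rw [inclOn_comb, ← hc, funext hc₀]

/-- The morphism from `E` to the invariants of `j^* E`. -/
lemma exists_toInvariants (E : X.Modules) : ∃ β : E ⟶ C.invariants (C.canon E),
    β ≫ C.incl (C.canon E) = (Scheme.Modules.pullbackPushforwardAdjunction C.j).unit.app E := by
  refine C.exists_comp_incl_eq (C.canon E) _ fun U s t ht ↦ ?_
  rw [unit_app_eq_toPush] at ht
  obtain rfl := (toPush_bijective _ _ _).1 ht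
  exact C.inv_pullLE E U s

lemma isIso_toInvariants (hC : C.Exact) {E : X.Modules} (hE : IsVectorBundle E)
    (β : E ⟶ C.invariants (C.canon E))
    (hβ : β ≫ C.incl (C.canon E) =
      (Scheme.Modules.pullbackPushforwardAdjunction C.j).unit.app E) : IsIso β := by
  refine isIso_of_isFrame β fun x ↦ ?_
  obtain ⟨U, n, e, hx, he⟩ := hE.exists_isFrame x
  refine ⟨U, _, inferInstance, e, hx, he, isFrame_invariants hC _ ?_⟩
  have h₁ (s : Γ(E, U)) : C.inclOn (C.canon E) U (β.app U s) = pullLE C.j E U _ le_rfl s := by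
    apply (toPush_bijective C.j _ U).1
    rw [← incl_app, ← AddCommGrpCat.comp_apply, ← Scheme.Modules.Hom.comp_app, hβ,
      unit_app_eq_toPush]
  simp only [h₁]
  exact he.pullLE _ _

/-- Pulling back is fully faithful from vector bundles to modules with descent data. -/
lemma existsUnique_pullback_map_eq (hC : C.Exact) {E E' : X.Modules} (hE' : IsVectorBundle E')
    (ψ : (Scheme.Modules.pullback C.j).obj E ⟶ (Scheme.Modules.pullback C.j).obj E')
    (hψ : (Scheme.Modules.pullback C.a).map ψ ≫ C.canon E' =
      C.canon E ≫ (Scheme.Modules.pullback C.p).map ψ) :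
    ∃! f : E ⟶ E', (Scheme.Modules.pullback C.j).map f = ψ := by
  let adj := Scheme.Modules.pullbackPushforwardAdjunction C.j
  obtain ⟨β, hβ⟩ := exists_toInvariants (C := C) E'
  have := isIso_toInvariants hC hE' β hβ
  have : Mono (adj.unit.app E') := by
    rw [← hβ]
    infer_instance
  have key (f : E ⟶ E') : (Scheme.Modules.pullback C.j).map f = ψ ↔
      f ≫ adj.unit.app E' = adj.homEquiv _ _ ψ := by
    rw [← (adj.homEquiv _ _).apply_eq_iff_eq, adj.homEquiv_unit]
    exact iff_of_eq (congrArg (· = _) (adj.unit.naturality f).symm)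
  simp only [key]
  obtain ⟨γ, hγ⟩ := C.exists_comp_incl_eq (C.canon E') (adj.homEquiv _ _ ψ) fun U s t ht ↦ by
    have h₁ : t = ψ.app _ (pullLE C.j E U _ le_rfl s) := by
      apply (toPush_bijective C.j _ U).1
      rw [← ht, adj.homEquiv_unit, ← app_toPush, ← unit_app_eq_toPush]
      rfl
    rw [h₁, Inv, ← app_pullLE, ← app_pullLE, ← C.inv_pullLE E U s, ← AddCommGrpCat.comp_apply,
      ← Scheme.Modules.Hom.comp_app, hψ]
    rfl
  refine ⟨γ ≫ inv β, ?_, fun f hf ↦ ?_⟩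
  · change (γ ≫ inv β) ≫ adj.unit.app E' = _
    rw [← hβ, ← hγ]
    simp
  · rw [← cancel_mono (adj.unit.app E')]
    refine Eq.trans hf ?_
    rw [← hβ, ← hγ]
    simp

/-- A module with a descent datum that has invariant frames locally on `X` descends to a vector
bundle. -/
lemma exists_iso_pullback (hC : C.Exact) {F : C.T.Modules}
    (φ : (Scheme.Modules.pullback C.a).obj F ⟶ (Scheme.Modules.pullback C.p).obj F)
    (h : ∀ x : X, ∃ (U : X.Opens) (n : ℕ) (e : ULift.{u} (Fin n) → Γ(F, C.j ⁻¹ᵁ U)),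
      x ∈ U ∧ (∀ i, C.Inv φ U (e i)) ∧ IsFrame F (C.j ⁻¹ᵁ U) e) :
    ∃ (E : X.Modules) (ε : (Scheme.Modules.pullback C.j).obj E ≅ F), IsVectorBundle E ∧
      (Scheme.Modules.pullback C.a).map ε.hom ≫ φ =
        C.canon E ≫ (Scheme.Modules.pullback C.p).map ε.hom := by
  let adj := Scheme.Modules.pullbackPushforwardAdjunction C.j
  let E := C.invariants φ
  let ε : (Scheme.Modules.pullback C.j).obj E ⟶ F := (adj.homEquiv _ _).symm (C.incl φ)
  have hε (U : X.Opens) (s : Γ(E, U)) :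
      ε.app _ (pullLE C.j E U _ le_rfl s) = C.inclOn φ U s := by
    apply (toPush_bijective C.j _ U).1
    rw [← app_toPush, ← unit_app_eq_toPush, ← incl_app, ← AddCommGrpCat.comp_apply,
      ← Scheme.Modules.Hom.comp_app]
    have := (adj.homEquiv_unit E F ε).symm.trans ((adj.homEquiv E F).apply_symm_apply _)
    exact congr(($this).app U s)
  have hfr (x : X) : ∃ (U : X.Opens) (n : ℕ) (e : ULift.{u} (Fin n) → Γ(E, U)),
      x ∈ U ∧ IsFrame E U e ∧ IsFrame F (C.j ⁻¹ᵁ U) fun i ↦ C.inclOn φ U (e i) := by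
    obtain ⟨U, n, e, hx, he, he'⟩ := h x
    choose e₀ he₀ using fun i ↦ C.exists_inclOn_eq φ U (e i) (he i)
    obtain rfl := funext he₀
    exact ⟨U, n, e₀, hx, isFrame_invariants hC e₀ he', he'⟩
  have : IsIso ε := isIso_of_isFrame ε fun t ↦ by
    obtain ⟨U, n, e, hx, he, he'⟩ := hfr (C.j t)
    refine ⟨C.j ⁻¹ᵁ U, _, inferInstance, _, hx, he.pullLE (f := C.j) _ le_rfl, ?_⟩
    simp only [hε]
    exact he'
  refine ⟨E, asIso ε, isVectorBundle_of_exists_isFrame fun x ↦ ?_, ?_⟩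
  · obtain ⟨U, n, e, hx, he, -⟩ := hfr x
    exact ⟨U, n, e, hx, he⟩
  · rw [← cancel_epi (pcompIso C.a C.j C.r C.ha E).inv]
    refine pullback_hom_ext fun U s ↦ ?_
    simp only [Scheme.Modules.Hom.comp_app, AddCommGrpCat.comp_apply]
    rw [pcompIso_inv_app_pullLE _ _ _ _ _ _ _ _ le_rfl (C.le_a U), C.inv_pullLE E U s]
    simp only [asIso_hom]
    rw [app_pullLE, app_pullLE, hε]
    exact C.inv_inclOn φ U s

end Fork

/-! ### Flat base change for sections of vector bundles -/

section Pushout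

variable {A B C D : CommRingCat.{u}} {ψ : A ⟶ B} {γ : A ⟶ C} {b : B ⟶ D} {c : C ⟶ D}

/-- Elements of `B ⊗ C` are finite sums of pure tensors. -/
lemma exists_sum_of_isPushout (h : IsPushout ψ γ b c) (d : D) :
    ∃ (κ : Type) (_ : Fintype κ) (x : κ → C) (y : κ → B), d = ∑ k, c (x k) * b (y k) := by
  let := ψ.hom.toAlgebra
  let := γ.hom.toAlgebra
  let := b.hom.toAlgebra
  let := c.hom.toAlgebra
  let := (b.hom.comp ψ.hom).toAlgebra
  have : IsScalarTower A B D := .of_algebraMap_eq fun _ ↦ rfl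
  have : IsScalarTower A C D := .of_algebraMap_eq fun x ↦ congr($(h.w) x)
  have hP : Algebra.IsPushout A B C D := CommRingCat.isPushout_iff_isPushout.mp h
  obtain ⟨t, rfl⟩ := (Algebra.IsPushout.symm hP).out.equiv.surjective d
  obtain ⟨s, rfl⟩ := TensorProduct.exists_finset t
  refine ⟨Fin s.card, inferInstance, fun k ↦ (s.equivFin.symm k).1.1,
    fun k ↦ (s.equivFin.symm k).1.2, ?_⟩
  rw [map_sum, ← Finset.sum_coe_sort, ← s.equivFin.symm.sum_comp]
  refine Finset.sum_congr rfl fun k _ ↦ ?_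
  rw [IsBaseChange.equiv_tmul, Algebra.smul_def]
  rfl

/-- The equational criterion of flatness: if `C` is flat over `A`, then a relation `∑ xₖ ⊗ yₖ = 0`
in `C ⊗ B^I` follows from relations with coefficients in `A` between the `yₖ`. -/
lemma exists_refinement_of_isPushout (h : IsPushout ψ γ b c) (hγ : γ.hom.Flat) {I : Type u}
    [Fintype I] {κ : Type} [Fintype κ] (x : κ → C) (y : κ → I → B)
    (hxy : ∀ i, ∑ k, c (x k) * b (y k i) = 0) :
    ∃ (κ' : Type) (_ : Fintype κ') (a : κ → κ' → A) (x' : κ' → C),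
      (∀ k, x k = ∑ l, γ (a k l) * x' l) ∧ ∀ l i, ∑ k, ψ (a k l) * y k i = 0 := by
  classical
  let := ψ.hom.toAlgebra
  let := γ.hom.toAlgebra
  let := b.hom.toAlgebra
  let := c.hom.toAlgebra
  let := (b.hom.comp ψ.hom).toAlgebra
  have : IsScalarTower A B D := .of_algebraMap_eq fun _ ↦ rfl
  have : IsScalarTower A C D := .of_algebraMap_eq fun x ↦ congr($(h.w) x)
  have hP : Algebra.IsPushout A B C D := CommRingCat.isPushout_iff_isPushout.mp h
  have hP' := Algebra.IsPushout.symm hP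
  have : Module.Flat A C := hγ
  have h₀ : ∑ k, x k ⊗ₜ[A] y k = 0 := by
    apply (TensorProduct.piRight A A C fun _ : I ↦ B).injective
    rw [map_sum, map_zero]
    funext i
    rw [Finset.sum_apply]
    apply hP'.out.equiv.injective
    rw [map_sum, Pi.zero_apply, map_zero, ← hxy i]
    refine Finset.sum_congr rfl fun k _ ↦ ?_
    rw [TensorProduct.piRight_apply, TensorProduct.piRightHom_tmul, IsBaseChange.equiv_tmul,
      Algebra.smul_def]
    rfl
  have h₁ : ∑ k, y k ⊗ₜ[A] x k = 0 := by
    simpa using congrArg (TensorProduct.comm A C (I → B)) h₀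
  obtain ⟨n, a, x', hx, hy⟩ :=
    TensorProduct.vanishesTrivially_of_sum_tmul_eq_zero_of_rTensor_injective A
      (Module.Flat.rTensor_preserves_injective_linearMap _ (Submodule.subtype_injective _)) h₁
  refine ⟨Fin n, inferInstance, a, x', fun k ↦ ?_, fun l i ↦ ?_⟩
  · rw [hx]
    exact Finset.sum_congr rfl fun l _ ↦ Algebra.smul_def _ _
  · refine Eq.trans ?_ (congrFun (hy l) i)
    rw [Finset.sum_apply]
    exact Finset.sum_congr rfl fun k _ ↦ (Algebra.smul_def _ _).symm

end Pushout

lemma compact_induction_of_isBasis {X : Scheme.{u}} {B : Set X.Opens}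
    (hB : TopologicalSpace.Opens.IsBasis B) (hc : ∀ U ∈ B, IsCompact (U : Set X))
    {P : X.Opens → Prop} (h₁ : P ⊥)
    (h₂ : ∀ U V : X.Opens, IsCompact (U : Set X) → V ∈ B → P U → P (U ⊔ V)) (U : X.Opens)
    (hU : IsCompact (U : Set X)) : P U := by
  obtain ⟨s, hs, hfin, rfl⟩ := hB.exists_finite_of_isCompact hU
  have key : ∀ t : Set X.Opens, t.Finite → t ⊆ B → IsCompact ((sSup t : X.Opens) : Set X) ∧ P (sSup t) := by
    intro t ht
    induction t, ht using Set.Finite.induction_on with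
    | empty => exact fun _ ↦ by simpa using h₁
    | insert _ _ ih =>
      intro h
      rw [sSup_insert, sup_comm]
      obtain ⟨h₃, h₄⟩ := ih ((Set.subset_insert _ _).trans h)
      refine ⟨?_, h₂ _ _ h₃ (h (Set.mem_insert _ _)) h₄⟩
      rw [TopologicalSpace.Opens.coe_sup]
      exact h₃.union (hc _ (h (Set.mem_insert _ _)))
  exact (key s hfin hs).2

/-- Affine open sets on which a vector bundle has a frame form a basis of the topology. -/
lemma IsVectorBundle.isBasis {X : Scheme.{u}} {M : X.Modules} (hM : IsVectorBundle M) :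
    TopologicalSpace.Opens.IsBasis {U : X.Opens | IsAffineOpen U ∧
      ∃ (n : ℕ) (e : ULift.{u} (Fin n) → Γ(M, U)), IsFrame M U e} := by
  rw [TopologicalSpace.Opens.isBasis_iff_nbhd]
  intro U x hx
  obtain ⟨V, n, e, hxV, he⟩ := hM.exists_isFrame x
  obtain ⟨W, hW, hxW, hWV⟩ := TopologicalSpace.Opens.isBasis_iff_nbhd.mp X.isBasis_affineOpens
    (show x ∈ U ⊓ V from ⟨hx, hxV⟩)
  exact ⟨W, ⟨hW, n, _, he.res W (hWV.trans inf_le_right)⟩, hxW, hWV.trans inf_le_left⟩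

/-- A cartesian square of schemes with `Z = Y ×_S V`, together with open subsets `US` of `S` and
`UV` of `V`, the second lying over the first. -/
structure Square where
  /-- the base -/
  S : Scheme.{u}
  /-- a scheme over the base -/
  Y : Scheme.{u}
  /-- a scheme over the base -/
  V : Scheme.{u}
  /-- the fibre product -/
  Z : Scheme.{u}
  /-- the first projection -/
  h : Z ⟶ Y
  /-- the second projection -/
  q : Z ⟶ V
  /-- the first structure morphism -/
  f : Y ⟶ S
  /-- the second structure morphism -/
  g : V ⟶ S
  isPullback : IsPullback h q f g
  /-- an open subset of the base -/
  US : S.Opens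
  /-- an open subset of `V` -/
  UV : V.Opens
  le : UV ≤ g ⁻¹ᵁ US

namespace Square

variable (C : Square.{u}) {M : C.Y.Modules}

/-- The part of `Z` lying over `W ⊆ Y` and over `UV ⊆ V`. -/
def cut (W : C.Y.Opens) : C.Z.Opens := C.h ⁻¹ᵁ W ⊓ C.q ⁻¹ᵁ C.UV

lemma cut_le_h (W : C.Y.Opens) : C.cut W ≤ C.h ⁻¹ᵁ W := inf_le_left

lemma cut_le_q (W : C.Y.Opens) : C.cut W ≤ C.q ⁻¹ᵁ C.UV := inf_le_right

lemma cut_mono {W W' : C.Y.Opens} (h : W' ≤ W) : C.cut W' ≤ C.cut W :=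
  inf_le_inf_right _ (C.h.preimage_mono h)

/-- The section `∑ q^* xₖ • h^* mₖ` of `h^* M`. -/
noncomputable def mix {κ : Type} [Fintype κ] (W : C.Y.Opens) (x : κ → Γ(C.V, C.UV))
    (m : κ → Γ(M, W)) : Γ((Scheme.Modules.pullback C.h).obj M, C.cut W) :=
  ∑ k, C.q.appLE C.UV _ (C.cut_le_q W) (x k) • pullLE C.h M W _ (C.cut_le_h W) (m k)

variable {C} {κ κ' : Type} [Fintype κ] [Fintype κ'] {W W' : C.Y.Opens}

lemma res_mix (h : W' ≤ W) (x : κ → Γ(C.V, C.UV)) (m : κ → Γ(M, W)) :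
    res _ _ _ (C.cut_mono h) (C.mix W x m) = C.mix W' x fun k ↦ res M W W' h (m k) := by
  simp only [mix, map_sum, res_smul, pullLE_res_right, pullLE_res_left, map_apply_appLE]

lemma appLE_appLE_comm (hW : W ≤ C.f ⁻¹ᵁ C.US) (a : Γ(C.S, C.US)) :
    C.h.appLE W _ (C.cut_le_h W) (C.f.appLE _ _ hW a) =
      C.q.appLE C.UV _ (C.cut_le_q W) (C.g.appLE _ _ C.le a) := by
  have h₁ : C.cut W ≤ (C.h ≫ C.f) ⁻¹ᵁ C.US := le_preimage_comp rfl hW (C.cut_le_h W)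
  rw [appLE_apply_appLE _ _ _ rfl _ _ _ _ _ h₁,
    appLE_apply_appLE _ _ _ C.isPullback.w.symm _ _ _ _ _ h₁]

/-- The sum `∑ q^* xₖ • h^* mₖ` is bilinear over `Γ(S, US)`. -/
lemma mix_refine (hW : W ≤ C.f ⁻¹ᵁ C.US) {x : κ → Γ(C.V, C.UV)} (m : κ → Γ(M, W))
    (a : κ → κ' → Γ(C.S, C.US)) {x' : κ' → Γ(C.V, C.UV)}
    (hx : ∀ k, x k = ∑ l, C.g.appLE _ _ C.le (a k l) * x' l) :
    C.mix W x m = C.mix W x' fun l ↦ ∑ k, C.f.appLE _ _ hW (a k l) • m k := by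
  simp only [mix, map_sum, pullLE_smul, appLE_appLE_comm, Finset.smul_sum, hx, Finset.sum_smul,
    map_mul, smul_smul]
  rw [Finset.sum_comm]
  exact Finset.sum_congr rfl fun l _ ↦ Finset.sum_congr rfl fun k _ ↦ by rw [mul_comm]

variable (C M) in
/-- Injectivity of `Γ(V, UV) ⊗ Γ(M, W) ⟶ Γ(h^* M, cut W)`, where the tensor product is taken over
`Γ(S, US)`, when `Γ(V, UV)` is flat: all relations are consequences of relations in `Γ(M, W)`. -/
def Inj (W : C.Y.Opens) (hW : W ≤ C.f ⁻¹ᵁ C.US) : Prop :=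
  ∀ (κ : Type) [Fintype κ] (x : κ → Γ(C.V, C.UV)) (m : κ → Γ(M, W)), C.mix W x m = 0 →
    ∃ (κ' : Type) (_ : Fintype κ') (a : κ → κ' → Γ(C.S, C.US)) (x' : κ' → Γ(C.V, C.UV)),
      (∀ k, x k = ∑ l, C.g.appLE _ _ C.le (a k l) * x' l) ∧
        ∀ l, ∑ k, C.f.appLE _ _ hW (a k l) • m k = 0

variable (C M) in
/-- Surjectivity of `Γ(V, UV) ⊗ Γ(M, W) ⟶ Γ(h^* M, cut W)`. -/
def Surj (W : C.Y.Opens) : Prop :=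
  ∀ z : Γ((Scheme.Modules.pullback C.h).obj M, C.cut W),
    ∃ (κ : Type) (_ : Fintype κ) (x : κ → Γ(C.V, C.UV)) (m : κ → Γ(M, W)), z = C.mix W x m

lemma eq_zero_of_bot {X : Scheme.{u}} (M : X.Modules) {U : X.Opens} (hU : U ≤ ⊥) (s : Γ(M, U)) :
    s = 0 :=
  res_ext M fun _ hx ↦ (hU hx).elim

lemma inj_bot (h : ⊥ ≤ C.f ⁻¹ᵁ C.US) : C.Inj M ⊥ h := by
  classical
  intro κ _ x m _
  refine ⟨κ, inferInstance, fun k l ↦ if k = l then 1 else 0, x, fun k ↦ ?_, fun l ↦ ?_⟩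
  · rw [Finset.sum_eq_single k]
    · simp only [if_pos, map_one, one_mul]
    · intro l _ hl
      simp only [if_neg hl.symm, map_zero, zero_mul]
    · simp
  · exact eq_zero_of_bot M le_rfl _

lemma surj_bot : C.Surj M ⊥ := fun z ↦
  ⟨Empty, inferInstance, Empty.elim, Empty.elim, by
    rw [mix, Fintype.sum_empty]
    exact eq_zero_of_bot _ (C.cut_le_h ⊥) z⟩

omit [Fintype κ] in
lemma comp_refine {κ'' : Type} [Fintype κ''] {x : κ → Γ(C.V, C.UV)} {a : κ → κ' → Γ(C.S, C.US)}
    {x' : κ' → Γ(C.V, C.UV)} {a' : κ' → κ'' → Γ(C.S, C.US)} {x'' : κ'' → Γ(C.V, C.UV)}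
    (hx : ∀ k, x k = ∑ l, C.g.appLE _ _ C.le (a k l) * x' l)
    (hx' : ∀ k, x' k = ∑ l, C.g.appLE _ _ C.le (a' k l) * x'' l) (k : κ) :
    x k = ∑ n, C.g.appLE _ _ C.le (∑ l, a k l * a' l n) * x'' n := by
  simp only [hx, hx', map_sum, map_mul, Finset.mul_sum, Finset.sum_mul, mul_assoc]
  rw [Finset.sum_comm]

/-- Injectivity over `W₁` lets one rewrite a relation over `W₁ ∪ W₂` with elements `mₗ` that vanish
on `W₁`; injectivity over `W₂` then makes them vanish on `W₂` too. -/
lemma inj_sup (W₁ W₂ : C.Y.Opens) (h : W₁ ⊔ W₂ ≤ C.f ⁻¹ᵁ C.US)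
    (h₁ : C.Inj M W₁ (le_sup_left.trans h)) (h₂ : C.Inj M W₂ (le_sup_right.trans h)) :
    C.Inj M (W₁ ⊔ W₂) h := by
  intro κ _ x m hm
  obtain ⟨κ', _, a, x', hx, ha⟩ := h₁ κ x (fun k ↦ res M _ _ le_sup_left (m k)) (by
    rw [← res_mix, hm, map_zero])
  rw [mix_refine h m a hx] at hm
  obtain ⟨κ'', _, a', x'', hx', ha'⟩ := h₂ κ' x' (fun k ↦ res M _ _ le_sup_right _) (by
    rw [← res_mix, hm, map_zero])
  have e (n : κ'') : ∑ k, C.f.appLE _ _ h (∑ l, a k l * a' l n) • m k =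
      ∑ l, C.f.appLE _ _ h (a' l n) • ∑ k, C.f.appLE _ _ h (a k l) • m k := by
    simp only [map_sum, map_mul, Finset.sum_smul, Finset.smul_sum, smul_smul]
    rw [Finset.sum_comm]
    exact Finset.sum_congr rfl fun l _ ↦ Finset.sum_congr rfl fun k _ ↦ by rw [mul_comm]
  refine ⟨κ'', inferInstance, fun k n ↦ ∑ l, a k l * a' l n, x'', comp_refine hx hx', fun n ↦ ?_⟩
  rw [e]
  refine res_ext M fun y hy ↦ ?_
  rcases hy with hy | hy
  · refine ⟨W₁, le_sup_left, hy, ?_⟩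
    rw [map_zero, map_sum]
    refine Finset.sum_eq_zero fun l _ ↦ ?_
    rw [res_smul, map_sum]
    simp only [res_smul, map_apply_appLE]
    rw [ha, smul_zero]
  · refine ⟨W₂, le_sup_right, hy, ?_⟩
    rw [map_zero, map_sum, ← ha' n]
    refine Finset.sum_congr rfl fun l _ ↦ ?_
    rw [res_smul, map_apply_appLE]

lemma exists_glue {X : Scheme.{u}} (M : X.Modules) {U V : X.Opens} (s : Γ(M, U)) (t : Γ(M, V))
    (h : res M U (U ⊓ V) inf_le_left s = res M V (U ⊓ V) inf_le_right t) :
    ∃ w : Γ(M, U ⊔ V), res M _ _ le_sup_left w = s ∧ res M _ _ le_sup_right w = t := by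
  obtain ⟨w, hw⟩ := res_glue M (U := U ⊔ V) (fun W _ w ↦
    res M W (U ⊓ W) inf_le_right w = res M U _ inf_le_left s ∧
      res M W (V ⊓ W) inf_le_right w = res M V _ inf_le_left t)
    (fun V' W hV hW w hw ↦ ⟨by
      have := congrArg (res M _ (U ⊓ W) (inf_le_inf_left _ hW)) hw.1
      simpa only [res_res] using this, by
      have := congrArg (res M _ (V ⊓ W) (inf_le_inf_left _ hW)) hw.2
      simpa only [res_res] using this⟩)
    (fun W hW w w' hw hw' ↦ res_ext M fun x hx ↦ by
      rcases hW hx with h | h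
      · exact ⟨U ⊓ W, inf_le_right, ⟨h, hx⟩, hw.1.trans hw'.1.symm⟩
      · exact ⟨V ⊓ W, inf_le_right, ⟨h, hx⟩, hw.2.trans hw'.2.symm⟩)
    (fun x hx ↦ by
      rcases hx with hx | hx
      · refine ⟨U, le_sup_left, hx, s, ?_, ?_⟩
        · rfl
        · have := congrArg (res M _ (V ⊓ U) (by rw [inf_comm])) h
          simpa only [res_res] using this
      · refine ⟨V, le_sup_right, hx, t, ?_, rfl⟩
        exact h.symm)
  refine ⟨w, res_ext M fun x hx ↦ ?_, res_ext M fun x hx ↦ ?_⟩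
  · obtain ⟨W, hW, hxW, h₁, -⟩ := hw x (Or.inl hx)
    refine ⟨U ⊓ W, inf_le_left, ⟨hx, hxW⟩, ?_⟩
    simpa only [res_res] using h₁
  · obtain ⟨W, hW, hxW, -, h₁⟩ := hw x (Or.inr hx)
    refine ⟨V ⊓ W, inf_le_left, ⟨hx, hxW⟩, ?_⟩
    simpa only [res_res] using h₁

/-- Two expressions of a section over `W₁` and over `W₂` are made to agree on `W₁ ∩ W₂` by
injectivity there, and are then glued. -/
lemma surj_sup (W₁ W₂ : C.Y.Opens) (h : W₁ ⊔ W₂ ≤ C.f ⁻¹ᵁ C.US)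
    (h₁ : C.Surj M W₁) (h₂ : C.Surj M W₂)
    (h₃ : C.Inj M (W₁ ⊓ W₂) ((inf_le_left.trans le_sup_left).trans h)) :
    C.Surj M (W₁ ⊔ W₂) := by
  intro z
  obtain ⟨κ₁, _, x₁, m₁, hz₁⟩ := h₁ (res _ _ _ (C.cut_mono le_sup_left) z)
  obtain ⟨κ₂, _, x₂, m₂, hz₂⟩ := h₂ (res _ _ _ (C.cut_mono le_sup_right) z)
  obtain ⟨κ, _, a, x', hx, ha⟩ := h₃ (κ₁ ⊕ κ₂) (Sum.elim x₁ x₂)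
    (Sum.elim (fun k ↦ res M _ _ inf_le_left (m₁ k)) fun k ↦ -res M _ _ inf_le_right (m₂ k)) (by
      have e : C.mix (W₁ ⊓ W₂) (Sum.elim x₁ x₂)
          (Sum.elim (fun k ↦ res M _ _ inf_le_left (m₁ k)) fun k ↦ -res M _ _ inf_le_right (m₂ k)) =
          C.mix (W₁ ⊓ W₂) x₁ (fun k ↦ res M _ _ inf_le_left (m₁ k)) -
            C.mix (W₁ ⊓ W₂) x₂ (fun k ↦ res M _ _ inf_le_right (m₂ k)) := by
        simp [mix, Fintype.sum_sum_type, sub_eq_add_neg]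
      rw [e, ← res_mix, ← res_mix, ← hz₁, ← hz₂, res_res, res_res, sub_self])
  have hW₁ := le_sup_left.trans h
  have hW₂ := le_sup_right.trans h
  have hg (l : κ) := exists_glue M (∑ k, C.f.appLE _ _ hW₁ (a (.inl k) l) • m₁ k)
    (∑ k, C.f.appLE _ _ hW₂ (a (.inr k) l) • m₂ k) (by
      have := ha l
      simp only [Fintype.sum_sum_type, Sum.elim_inl, Sum.elim_inr, smul_neg, Finset.sum_neg_distrib,
        add_neg_eq_zero] at this
      simpa only [map_sum, res_smul, map_apply_appLE] using this)
  choose m hm₁ hm₂ using hg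
  refine ⟨κ, inferInstance, x', m, res_ext _ fun y hy ↦ ?_⟩
  have hy' : C.h y ∈ W₁ ⊔ W₂ := C.cut_le_h _ hy
  rcases hy' with hy' | hy'
  · refine ⟨C.cut W₁, C.cut_mono le_sup_left, ⟨hy', C.cut_le_q _ hy⟩, ?_⟩
    rw [hz₁, res_mix le_sup_left, funext hm₁]
    exact mix_refine hW₁ m₁ (fun k ↦ a (.inl k)) fun k ↦ hx (.inl k)
  · refine ⟨C.cut W₂, C.cut_mono le_sup_right, ⟨hy', C.cut_le_q _ hy⟩, ?_⟩
    rw [hz₂, res_mix le_sup_right, funext hm₂]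
    exact mix_refine hW₂ m₂ (fun k ↦ a (.inr k)) fun k ↦ hx (.inr k)

variable {I : Type u} [Fintype I]

lemma isPushout (hUS : IsAffineOpen C.US) (hUV : IsAffineOpen C.UV) (hW : W ≤ C.f ⁻¹ᵁ C.US)
    (hWa : IsAffineOpen W) : IsPushout (C.f.appLE _ _ hW) (C.g.appLE _ _ C.le)
      (C.h.appLE _ _ (C.cut_le_h W)) (C.q.appLE _ _ (C.cut_le_q W)) :=
  (isIso_pushoutSection_iff C.isPullback C.le hW rfl).mp
    (isIso_pushoutSection_of_isAffineOpen C.isPullback C.le hW rfl hUS hUV hWa)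

lemma mix_comb (e : I → Γ(M, W)) (x : κ → Γ(C.V, C.UV)) (y : κ → I → Γ(C.Y, W)) :
    C.mix W x (fun k ↦ comb e W le_rfl (y k)) =
      comb (fun i ↦ pullLE C.h M W (C.cut W) (C.cut_le_h W) (e i)) (C.cut W) le_rfl
        fun i ↦ ∑ k, C.q.appLE _ _ (C.cut_le_q W) (x k) * C.h.appLE _ _ (C.cut_le_h W) (y k i) := by
  simp only [mix, comb, res_self, map_sum, pullLE_smul, Finset.smul_sum, smul_smul, Finset.sum_smul]
  rw [Finset.sum_comm]

lemma inj_of_isFrame (hUS : IsAffineOpen C.US) (hUV : IsAffineOpen C.UV)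
    (hflat : (C.g.appLE _ _ C.le).hom.Flat) (hW : W ≤ C.f ⁻¹ᵁ C.US)
    (hWa : IsAffineOpen W) {e : I → Γ(M, W)} (he : IsFrame M W e) : C.Inj M W hW := by
  intro κ _ x m hm
  choose y hy using fun k ↦ (he W le_rfl).2 (m k)
  obtain rfl := funext hy
  rw [mix_comb] at hm
  have h₀ := (he.pullLE (f := C.h) (C.cut W) (C.cut_le_h W) _ le_rfl).1
    (hm.trans (show 0 = comb _ _ le_rfl (fun _ : I ↦ 0) by simp [comb]))
  obtain ⟨κ', _, a, x', hx, hy⟩ := exists_refinement_of_isPushout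
    (C.isPushout hUS hUV hW hWa) hflat x y (congrFun h₀)
  refine ⟨κ', inferInstance, a, x', hx, fun l ↦ ?_⟩
  simp only [comb, res_self, Finset.smul_sum, smul_smul]
  rw [Finset.sum_comm]
  simp only [← Finset.sum_smul, hy, zero_smul, Finset.sum_const_zero]

lemma surj_of_isFrame (hUS : IsAffineOpen C.US) (hUV : IsAffineOpen C.UV)
    (hW : W ≤ C.f ⁻¹ᵁ C.US)
    (hWa : IsAffineOpen W) {e : I → Γ(M, W)} (he : IsFrame M W e) : C.Surj M W := by
  intro z
  obtain ⟨d, hd⟩ := (he.pullLE (f := C.h) (C.cut W) (C.cut_le_h W) _ le_rfl).2 z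
  choose κ _ x y hxy using fun i ↦
    exists_sum_of_isPushout (C.isPushout hUS hUV hW hWa) (d i)
  let ε := (Fintype.equivFin I).symm
  refine ⟨Σ j, κ (ε j), inferInstance, fun k ↦ x _ k.2, fun k ↦ y _ k.2 • e (ε k.1), ?_⟩
  rw [← hd, mix, Fintype.sum_sigma, comb, ← ε.sum_comp]
  refine Finset.sum_congr rfl fun j _ ↦ ?_
  rw [hxy, Finset.sum_smul]
  refine Finset.sum_congr rfl fun k _ ↦ ?_
  rw [pullLE_smul, smul_smul, res_self]

/-- **Flat base change**, injectivity over quasi-compact open sets. -/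
lemma inj_of_isCompact (hM : IsVectorBundle M) (hUS : IsAffineOpen C.US) (hUV : IsAffineOpen C.UV)
    (hflat : (C.g.appLE _ _ C.le).hom.Flat) (hW : W ≤ C.f ⁻¹ᵁ C.US) (hWc : IsCompact (W : Set C.Y)) :
    C.Inj M W hW := by
  suffices h : ∀ hW : W ≤ C.f ⁻¹ᵁ C.US, C.Inj M W hW from h hW
  refine compact_induction_of_isBasis (P := fun W ↦ ∀ hW : W ≤ C.f ⁻¹ᵁ C.US, C.Inj M W hW)
    hM.isBasis (fun U hU ↦ hU.1.isCompact) (fun h ↦ inj_bot h) ?_ W hWc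
  rintro U V - ⟨hV, n, e, he⟩ h hUV'
  exact inj_sup U V hUV' (h _) (inj_of_isFrame hUS hUV hflat _ hV he)

/-- **Flat base change**, surjectivity over quasi-compact quasi-separated open sets. -/
lemma surj_of_isCompact (hM : IsVectorBundle M) (hUS : IsAffineOpen C.US) (hUV : IsAffineOpen C.UV)
    (hflat : (C.g.appLE _ _ C.le).hom.Flat) (hW : W ≤ C.f ⁻¹ᵁ C.US) (hWc : IsCompact (W : Set C.Y))
    (hWq : IsQuasiSeparated (W : Set C.Y)) : C.Surj M W := by
  refine compact_induction_of_isBasis (P := fun W' ↦ W' ≤ W → C.Surj M W')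
    hM.isBasis (fun U hU ↦ hU.1.isCompact) (fun _ ↦ surj_bot) ?_ W hWc le_rfl
  rintro U V hU ⟨hV, n, e, he⟩ h hUV'
  refine surj_sup U V (hUV'.trans hW) (h (le_sup_left.trans hUV'))
    (surj_of_isFrame hUS hUV ((le_sup_right.trans hUV').trans hW) hV he)
    (inj_of_isCompact hM hUS hUV hflat _ ?_)
  exact hWq U V (le_sup_left.trans hUV') U.2 hU (le_sup_right.trans hUV') V.2 hV.isCompact

end Square

/-! ### Changing frames -/

section ChangeOfFrame

open Matrix

variable {X Y : Scheme.{u}} {I J : Type u} [Fintype I] [Fintype J]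

lemma IsFrame.comp_equiv {M : X.Modules} {U : X.Opens} {e : I → Γ(M, U)} (he : IsFrame M U e)
    (ε : J ≃ I) : IsFrame M U (e ∘ ε) := by
  intro V h
  have : comb (e ∘ ε) V h = comb e V h ∘ (ε.arrowCongr (Equiv.refl Γ(X, V))) := by
    funext c
    simp only [comb, Function.comp_apply]
    rw [← ε.sum_comp]
    simp
  rw [this]
  exact (he V h).comp (Equiv.bijective _)

/-- Being a frame can be checked locally. -/
lemma isFrame_of_locally {M : X.Modules} {U : X.Opens} {e : I → Γ(M, U)}
    (h : ∀ x ∈ U, ∃ (V : X.Opens) (hV : V ≤ U), x ∈ V ∧ IsFrame M V fun i ↦ res M U V hV (e i)) :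
    IsFrame M U e := by
  rw [← isFrame_pullLE_ι_iff]
  have h₁ : ∀ i, ((homFree _).symm fun i ↦ pullLE U.ι M U ⊤ (by simp) (e i)).app ⊤
      (stdSec U.toScheme i) = pullLE U.ι M U ⊤ (by simp) (e i) := fun i ↦ by
    rw [← homFree_apply, Equiv.apply_symm_apply]
  have : IsIso ((homFree _).symm fun i ↦ pullLE U.ι M U ⊤ (by simp) (e i)) :=
    isIso_of_isFrame _ fun x ↦ by
      obtain ⟨V, hV, hx, hf⟩ := h (U.ι x) x.2
      refine ⟨U.ι ⁻¹ᵁ V, I, inferInstance, _, hx,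
        (isFrame_stdSec U.toScheme I).res _ le_top, ?_⟩
      simp only [← res_app, h₁]
      convert hf.pullLE (f := U.ι) (U.ι ⁻¹ᵁ V) le_rfl using 1
      funext i
      rw [pullLE_res_right, pullLE_res_left]
  have h₂ := (isFrame_stdSec U.toScheme I).app_iso
    (@asIso _ _ _ _ _ this)
  simp only [asIso_hom, h₁] at h₂
  exact h₂

lemma comb_vecMul {M : X.Modules} {U : X.Opens} (f : J → Γ(M, U)) (A : Matrix I J Γ(X, U))
    (V : X.Opens) (h : V ≤ U) (c : I → Γ(X, V)) :
    comb (fun i ↦ comb f U le_rfl (A i)) V h c =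
      comb f V h (c ᵥ* A.map (X.presheaf.map (homOfLE h).op)) := by
  simp only [comb, res_self, map_sum, res_smul, Finset.smul_sum, smul_smul, vecMul, dotProduct,
    Finset.sum_smul, Matrix.map_apply]
  exact Finset.sum_comm

variable [DecidableEq I]

lemma isFrame_of_isUnit_det {M : X.Modules} {U : X.Opens} {f : I → Γ(M, U)} (hf : IsFrame M U f)
    (A : Matrix I I Γ(X, U)) (hA : IsUnit A.det) :
    IsFrame M U fun i ↦ comb f U le_rfl (A i) := by
  intro V h
  let φ := (X.presheaf.map (homOfLE h).op).hom
  have h₁ : IsUnit (A.map φ) := ((Matrix.isUnit_iff_isUnit_det A).mpr hA).map φ.mapMatrix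
  have h₂ : comb (fun i ↦ comb f U le_rfl (A i)) V h =
      comb f V h ∘ fun c ↦ c ᵥ* A.map φ := funext fun c ↦ comb_vecMul f A V h c
  rw [h₂]
  refine (hf V h).comp ?_
  obtain ⟨B, hB⟩ := h₁
  refine Function.bijective_iff_has_inverse.mpr ⟨fun c ↦ c ᵥ* (B⁻¹).1, fun c ↦ ?_, fun c ↦ ?_⟩
  · dsimp only
    rw [← hB, vecMul_vecMul, Units.mul_inv, vecMul_one]
  · dsimp only
    rw [← hB, vecMul_vecMul, Units.inv_mul, vecMul_one]

lemma isUnit_det_of_isFrame {M : X.Modules} {U : X.Opens} {f : I → Γ(M, U)} (hf : IsFrame M U f)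
    (A : Matrix I I Γ(X, U)) (hA : IsFrame M U fun i ↦ comb f U le_rfl (A i)) :
    IsUnit A.det := by
  choose B₀ hB using fun i ↦ (hA U le_rfl).2 (f i)
  let B : Matrix I I Γ(X, U) := B₀
  have h₁ : B * A = 1 := by
    ext i k
    have h₂ := hB i
    rw [comb_vecMul] at h₂
    have h₃ : comb f U le_rfl ((1 : Matrix I I Γ(X, U)) i) = f i := by
      simp only [comb, res_self, Matrix.one_apply, ite_smul, one_smul, zero_smul,
        Finset.sum_ite_eq, Finset.mem_univ, if_true]
    have h₄ : A.map (X.presheaf.map (homOfLE (le_refl U)).op) = A := by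
      ext i k
      exact congr($(X.presheaf.map_id (.op U)) (A i k))
    rw [h₄] at h₂
    exact congrFun ((hf U le_rfl).1 (h₂.trans h₃.symm)) k
  exact (Matrix.isUnit_iff_isUnit_det A).mp (IsUnit.of_mul_eq_one_right _ h₁)

omit [DecidableEq I] in
/-- A family of sections is a frame at a point if it is a frame on some neighbourhood. -/
def IsFrameAt (M : X.Modules) (U : X.Opens) (e : I → Γ(M, U)) (x : X) : Prop :=
  ∃ (V : X.Opens) (h : V ≤ U), x ∈ V ∧ IsFrame M V fun i ↦ res M U V h (e i)

/-- A family with matrix `A` with respect to a frame is a frame exactly where `det A` is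
invertible. -/
lemma isFrameAt_iff {M : X.Modules} {U : X.Opens} {f : I → Γ(M, U)} (hf : IsFrame M U f)
    (A : Matrix I I Γ(X, U)) (x : X) :
    IsFrameAt M U (fun i ↦ comb f U le_rfl (A i)) x ↔ x ∈ X.basicOpen A.det := by
  have key (V : X.Opens) (h : V ≤ U) (i : I) : res M U V h (comb f U le_rfl (A i)) =
      comb (fun i ↦ res M U V h (f i)) V le_rfl (A.map (X.presheaf.map (homOfLE h).op) i) := by
    rw [res_comb, comb_res]
    rfl
  have hdet (V : X.Opens) (h : V ≤ U) : (A.map (X.presheaf.map (homOfLE h).op)).det =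
      X.presheaf.map (homOfLE h).op A.det :=
    (RingHom.map_det (X.presheaf.map (homOfLE h).op).hom A).symm
  constructor
  · rintro ⟨V, h, hx, he⟩
    simp only [key] at he
    have := isUnit_det_of_isFrame (hf.res V h) _ he
    rw [hdet] at this
    have h₂ : X.basicOpen (X.presheaf.map (homOfLE h).op A.det) = V ⊓ X.basicOpen A.det :=
      X.basicOpen_res _ _
    rw [Scheme.basicOpen_of_isUnit _ this] at h₂
    exact (h₂.le hx).2
  · intro hx
    refine ⟨X.basicOpen A.det, X.basicOpen_le _, hx, ?_⟩
    simp only [key]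
    refine isFrame_of_isUnit_det (hf.res _ _) _ ?_
    rw [hdet]
    exact RingedSpace.isUnit_res_basicOpen X.toRingedSpace A.det

omit [DecidableEq I] in
lemma card_eq_of_isFrame {M : X.Modules} {U : X.Opens} {e : I → Γ(M, U)} {f : J → Γ(M, U)}
    (he : IsFrame M U e) (hf : IsFrame M U f) (x : X) (hx : x ∈ U) :
    Nonempty (I ≃ J) := by
  have : Nonempty U := ⟨x, hx⟩
  have hlin {K : Type u} [Fintype K] (e : K → Γ(M, U)) :
      ∃ l : (K → Γ(X, U)) →ₗ[Γ(X, U)] Γ(M, U), ∀ c, l c = comb e U le_rfl c :=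
    ⟨{ toFun := comb e U le_rfl
       map_add' := comb_add e U le_rfl
       map_smul' := fun a c ↦ by simp [comb, Finset.smul_sum, smul_smul] }, fun _ ↦ rfl⟩
  obtain ⟨l, hl⟩ := hlin e
  obtain ⟨m, hm⟩ := hlin f
  have h₁ : Function.Bijective l := by rw [show ⇑l = comb e U le_rfl from funext hl]; exact he U le_rfl
  have h₂ : Function.Bijective m := by rw [show ⇑m = comb f U le_rfl from funext hm]; exact hf U le_rfl
  have := card_eq_of_linearEquiv Γ(X, U)
    ((LinearEquiv.ofBijective l h₁).trans (LinearEquiv.ofBijective m h₂).symm)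
  exact Fintype.card_eq.mp this

omit [DecidableEq I] in
/-- A family of sections of a vector bundle is a frame wherever its pull-back is a frame. -/
lemma isFrameAt_of_pullLE {M : X.Modules} (hM : IsVectorBundle M) (g : Y ⟶ X) {U : X.Opens}
    {W : Y.Opens} (hW : W ≤ g ⁻¹ᵁ U) (e : I → Γ(M, U)) (y : Y)
    (h : IsFrameAt ((Scheme.Modules.pullback g).obj M) W (fun i ↦ pullLE g M U W hW (e i)) y) :
    IsFrameAt M U e (g y) := by
  classical
  obtain ⟨N, hN, hy, he⟩ := h
  obtain ⟨V₀, n, f₀, hgy, hf₀⟩ := hM.exists_isFrame (g y)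
  let V := V₀ ⊓ U
  have hV : V ≤ U := inf_le_right
  have hgyV : g y ∈ V := ⟨hgy, hW (hN hy)⟩
  have hf₁ := hf₀.res V inf_le_left
  let N' := N ⊓ g ⁻¹ᵁ V
  have hN' : N' ≤ g ⁻¹ᵁ V := inf_le_right
  have hyN' : y ∈ N' := ⟨hy, hgyV⟩
  have he' := he.res N' inf_le_left
  obtain ⟨ε⟩ := card_eq_of_isFrame he' (hf₁.pullLE (f := g) N' hN') y hyN'
  have hf := hf₁.comp_equiv ε
  choose A hA using fun i ↦ (hf V le_rfl).2 (res M U V hV (e i))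
  have h₁ : IsFrameAt M V (fun i ↦ res M U V hV (e i)) (g y) := by
    rw [← funext hA, isFrameAt_iff hf A]
    have h₂ : IsFrameAt ((Scheme.Modules.pullback g).obj M) N' (fun i ↦ comb (fun i ↦
        pullLE g M V N' hN' ((fun i ↦ res M V₀ V inf_le_left (f₀ i)) (ε i))) N' le_rfl
        fun k ↦ g.appLE V N' hN' (A i k)) y := by
      refine ⟨N', le_rfl, hyN', ?_⟩
      convert he' using 1
      funext i
      have h₃ := congrArg (pullLE g M V N' hN') (hA i)
      rw [Fork.pullLE_comb g _ V le_rfl N' N' hN' hN' le_rfl] at h₃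
      rw [res_self]
      refine h₃.trans ?_
      rw [pullLE_res_left, pullLE_res_right, pullLE_res_right]
    have h₄ := (isFrameAt_iff (hf.pullLE (f := g) N' hN')
      (fun i k ↦ g.appLE V N' hN' (A i k)) y).mp h₂
    have h₅ : Matrix.det (fun i k ↦ g.appLE V N' hN' (A i k)) = g.appLE V N' hN' (Matrix.det A) :=
      (RingHom.map_det (g.appLE V N' hN').hom A).symm
    rw [h₅, Scheme.basicOpen_appLE] at h₄
    exact h₄.2
  obtain ⟨V', hV', hx', h₂⟩ := h₁
  refine ⟨V', hV'.trans hV, hx', ?_⟩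
  simpa only [res_res] using h₂

/-- Among vectors which generate `K^I`, there are vectors that form a basis. -/
lemma exists_det_ne_zero {K : Type u} [Field K] {L : Type} [Fintype L] (n : L → I → K)
    (b : I → L → K) (h : ∀ i k, ∑ l, b i l * n l k = if i = k then 1 else 0) :
    ∃ s : I → L, Matrix.det (fun i ↦ n (s i)) ≠ 0 := by
  obtain ⟨κ, a, ha, hsp, hli⟩ := exists_linearIndependent' K n
  have htop : ⊤ ≤ Submodule.span K (Set.range (n ∘ a)) := by
    rw [hsp, ← (Pi.basisFun K I).span_eq, Submodule.span_le]
    rintro _ ⟨i, rfl⟩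
    have : Pi.basisFun K I i = ∑ l, b i l • n l := by
      funext k
      rw [Finset.sum_apply]
      simp only [Pi.basisFun_apply, Pi.smul_apply, smul_eq_mul, h, Pi.single_apply, eq_comm]
    rw [this]
    exact Submodule.sum_mem _ fun l _ ↦ Submodule.smul_mem _ _
      (Submodule.subset_span (Set.mem_range_self l))
  let β := Module.Basis.mk hli htop
  let ε := (Pi.basisFun K I).indexEquiv β
  refine ⟨a ∘ ε, ?_⟩
  let N : Matrix I I K := fun i ↦ n ((a ∘ ε) i)
  have : LinearIndependent K N.row := hli.comp ε ε.injective
  rw [Matrix.linearIndependent_rows_iff_isUnit, Matrix.isUnit_iff_isUnit_det] at this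
  exact this.ne_zero

omit [DecidableEq I] in
/-- Among sections whose multiples generate a vector bundle near a point, there is a frame. -/
lemma exists_isFrameAt {M : X.Modules} {V : X.Opens} {f : I → Γ(M, V)} (hf : IsFrame M V f)
    {L : Type} [Fintype L] (n : L → Γ(M, V)) (b : I → L → Γ(X, V))
    (h : ∀ i, f i = ∑ l, b i l • n l) (x : X) (hx : x ∈ V) :
    ∃ s : I → L, IsFrameAt M V (fun i ↦ n (s i)) x := by
  classical
  choose A hA using fun l ↦ (hf V le_rfl).2 (n l)
  have h₁ (i k : I) : ∑ l, b i l * A l k = if i = k then 1 else 0 := by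
    have h₂ : comb f V le_rfl (fun k ↦ ∑ l, b i l * A l k) =
        comb f V le_rfl (fun k ↦ if i = k then 1 else 0) := by
      have e₁ : comb f V le_rfl (fun k ↦ ∑ l, b i l * A l k) = f i := by
        rw [h i, ← funext hA]
        simp only [comb, res_self, Finset.smul_sum, smul_smul, Finset.sum_smul]
        rw [Finset.sum_comm]
      rw [e₁]
      simp [comb]
    exact congrFun ((hf V le_rfl).1 h₂) k
  let ev := (X.evaluation V x hx).hom
  obtain ⟨s, hs⟩ := exists_det_ne_zero (fun l k ↦ ev (A l k)) (fun i l ↦ ev (b i l)) fun i k ↦ by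
    simp only [← map_mul, ← map_sum, h₁]
    split <;> simp
  refine ⟨s, ?_⟩
  have h₃ : (fun i ↦ n (s i)) = fun i ↦ comb f V le_rfl (A (s i)) := funext fun i ↦ (hA _).symm
  rw [h₃, isFrameAt_iff hf (fun i ↦ A (s i)), ← Scheme.evaluation_ne_zero_iff_mem_basicOpen _ _ hx]
  intro h₄
  refine hs (Eq.trans ?_ h₄)
  exact (RingHom.map_det ev (fun i ↦ A (s i))).symm

end ChangeOfFrame

/-! ### Existence of invariant frames -/

/-- The diagram `Q ⇶ P ⇉ T ⟶ X` attached to a torsor `j : T ⟶ X`, with `P = T × G` and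
`Q = T × G × G`, together with the properties that make descent along `j` work. -/
structure Nerve (X : Scheme.{u}) extends Fork X where
  /-- the scheme `T × G × G` -/
  Q : Scheme.{u}
  /-- `(t, g, h) ↦ (t, g)` -/
  first : Q ⟶ P
  /-- `(t, g, h) ↦ (t g, h)` -/
  second : Q ⟶ P
  /-- `(t, g, h) ↦ (t, g h)` -/
  prod : Q ⟶ P
  second_p : second ≫ p = first ≫ a
  prod_p : prod ≫ p = first ≫ p
  prod_a : prod ≫ a = second ≫ a
  /-- `t ↦ (t, 1)` -/
  unit : T ⟶ P
  unit_a : unit ≫ a = 𝟙 T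
  isPullback : IsPullback p a j j
  isPullback_first : IsPullback first (second ≫ a) r j
  flat : Flat j
  surjective : Surjective j
  quasiCompact : QuasiCompact j
  quasiSeparated : QuasiSeparated j

attribute [instance] Nerve.flat Nerve.surjective Nerve.quasiCompact Nerve.quasiSeparated

/-- Pulling back sections of a vector bundle is injective if pulling back functions is. -/
lemma pullLE_injective {X Y : Scheme.{u}} {I : Type u} [Fintype I] (g : Y ⟶ X) {M : X.Modules}
    {U : X.Opens} {f : I → Γ(M, U)} (hf : IsFrame M U f) (W : Y.Opens) (h : W ≤ g ⁻¹ᵁ U)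
    (hg : Function.Injective (g.appLE U W h)) : Function.Injective (pullLE g M U W h) := by
  intro s t hst
  obtain ⟨c, rfl⟩ := (hf U le_rfl).2 s
  obtain ⟨d, rfl⟩ := (hf U le_rfl).2 t
  rw [Fork.pullLE_comb g f U le_rfl W W h h le_rfl,
    Fork.pullLE_comb g f U le_rfl W W h h le_rfl] at hst
  have := (hf.pullLE (f := g) W h _ le_rfl).1 hst
  congr 1
  funext i
  exact hg (congrFun this i)

namespace Nerve

variable {X : Scheme.{u}} (C : Nerve X) {F : C.T.Modules}

/-- The cocycle condition for a descent datum. -/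
def Cocycle (φ : (Scheme.Modules.pullback C.a).obj F ⟶ (Scheme.Modules.pullback C.p).obj F) :
    Prop :=
  baseChange φ C.prod (C.second ≫ C.a) (C.first ≫ C.p) C.prod_a C.prod_p =
    baseChange φ C.second (C.second ≫ C.a) (C.first ≫ C.a) rfl C.second_p ≫
      baseChange φ C.first (C.first ≫ C.a) (C.first ≫ C.p) rfl rfl

/-- Invariant functions descend along the faithfully flat morphism `j`. -/
lemma exact : C.toFork.Exact := by
  intro U c hc
  obtain ⟨c₀, hc₀⟩ := exists_app_eq C.isPullback.flip U c (by
    have e : C.p ≫ C.j = C.r := C.hp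
    have h : (C.p ≫ C.j) ⁻¹ᵁ U ≤ C.r ⁻¹ᵁ U := le_of_eq (by rw [e])
    have := congrArg (C.P.presheaf.map (homOfLE h).op) hc
    rwa [map_apply_appLE, map_apply_appLE] at this)
  exact ⟨c₀, hc₀, fun c₁ hc₁ ↦ app_injective U (hc₁.trans hc₀.symm)⟩

/-- The cartesian square formed by `p`, `a` and twice `j`. -/
@[simps]
def square (U : X.Opens) (V : C.T.Opens) (h : V ≤ C.j ⁻¹ᵁ U) : Square where
  S := X
  Y := C.T
  V := C.T
  Z := C.P
  h := C.p
  q := C.a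
  f := C.j
  g := C.j
  isPullback := C.isPullback
  US := U
  UV := V
  le := h

/-- The cartesian square formed by `(t, g, h) ↦ (t, g)`, `(t, g, h) ↦ t g h`, `r` and `j`. -/
@[simps]
def square' (U : X.Opens) (V : C.T.Opens) (h : V ≤ C.j ⁻¹ᵁ U) : Square where
  S := X
  Y := C.P
  V := C.T
  Z := C.Q
  h := C.first
  q := C.second ≫ C.a
  f := C.r
  g := C.j
  isPullback := C.isPullback_first
  US := U
  UV := V
  le := h

section Generation

variable (φ : (Scheme.Modules.pullback C.a).obj F ≅ (Scheme.Modules.pullback C.p).obj F)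
  (hφ : C.Cocycle φ.hom) (U : X.Opens) (V : C.T.Opens) (hV : V ≤ C.j ⁻¹ᵁ U)

/-- The set of pairs `(t, g)` with `t` over `U` and `t g` in `V`. -/
def cutP : C.P.Opens := C.p ⁻¹ᵁ C.j ⁻¹ᵁ U ⊓ C.a ⁻¹ᵁ V

/-- The set of triples `(t, g, h)` with `t` over `U` and `t g h` in `V`. -/
def cutQ : C.Q.Opens := C.first ⁻¹ᵁ C.r ⁻¹ᵁ U ⊓ (C.second ≫ C.a) ⁻¹ᵁ V

lemma cutP_le_a : C.cutP U V ≤ C.a ⁻¹ᵁ V := inf_le_right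

lemma cutP_le_p : C.cutP U V ≤ C.p ⁻¹ᵁ C.j ⁻¹ᵁ U := inf_le_left

lemma cutQ_le_first : C.cutQ U V ≤ C.first ⁻¹ᵁ C.r ⁻¹ᵁ U := inf_le_left

lemma cutQ_le : C.cutQ U V ≤ (C.second ≫ C.a) ⁻¹ᵁ V := inf_le_right

lemma cutQ_le_second : C.cutQ U V ≤ C.second ⁻¹ᵁ C.cutP U V := by
  have h : C.cutQ U V ≤ (C.second ≫ C.p) ⁻¹ᵁ C.j ⁻¹ᵁ U := by
    rw [C.second_p]
    exact le_preimage_comp rfl (C.le_a U) (C.cutQ_le_first U V)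
  exact fun y hy ↦ ⟨h hy, C.cutQ_le U V hy⟩

lemma cutQ_le_prod : C.cutQ U V ≤ C.prod ⁻¹ᵁ C.cutP U V := by
  have h : C.cutQ U V ≤ (C.prod ≫ C.p) ⁻¹ᵁ C.j ⁻¹ᵁ U := by
    rw [C.prod_p]
    exact le_preimage_comp rfl (C.le_p U) (C.cutQ_le_first U V)
  have h' : C.cutQ U V ≤ (C.prod ≫ C.a) ⁻¹ᵁ V := by
    rw [C.prod_a]
    exact C.cutQ_le U V
  exact fun y hy ↦ ⟨h hy, h' hy⟩

variable {κ : Type} [Fintype κ] (x : κ → Γ(C.T, V)) (m : κ → Γ(F, C.j ⁻¹ᵁ U))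

/-- The section `∑ a^* xₖ • p^* mₖ` of `p^* F`. -/
noncomputable def mixP : Γ((Scheme.Modules.pullback C.p).obj F, C.cutP U V) :=
  ∑ k, C.a.appLE V _ (C.cutP_le_a U V) (x k) • pullLE C.p F _ _ (C.cutP_le_p U V) (m k)

lemma pcompIso_app_pullLE_mixP (g : C.Q ⟶ C.P) (k : C.Q ⟶ C.T) (hk : g ≫ C.p = k)
    (hg : g ≫ C.a = C.second ≫ C.a) (hle : C.cutQ U V ≤ g ⁻¹ᵁ C.cutP U V) :
    (pcompIso g C.p k hk F).hom.app (C.cutQ U V) (pullLE g _ _ _ hle (C.mixP U V x m)) =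
    ∑ i, (C.second ≫ C.a).appLE V _ (C.cutQ_le U V) (x i) •
      pullLE k F (C.j ⁻¹ᵁ U) (C.cutQ U V) (le_preimage_comp hk (C.cutP_le_p U V) hle) (m i) := by
  simp only [mixP, map_sum, pullLE_smul, Scheme.Modules.Hom.app_smul]
  refine Finset.sum_congr rfl fun i _ ↦ ?_
  rw [appLE_apply_appLE _ _ _ hg _ _ _ _ _ (C.cutQ_le U V),
    pcompIso_hom_app_pullLE _ _ _ _ _ _ _ _ _ _ (le_preimage_comp hk (C.cutP_le_p U V) hle)]

include hφ in
/-- If `φ(a^* f) = ∑ a^* xₖ • p^* mₖ`, then `∑ xₖ ⊗ (φ(a^* mₖ) - p^* mₖ)` vanishes on `Q`: this is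
the cocycle condition applied to `f`. -/
lemma sum_diff_eq_zero (f : Γ(F, V))
    (h : φ.hom.app _ (pullLE C.a F V _ (C.cutP_le_a U V) f) = C.mixP U V x m) :
    ∑ k, (C.second ≫ C.a).appLE V _ (C.cutQ_le U V) (x k) •
      pullLE C.first _ (C.r ⁻¹ᵁ U) _ (C.cutQ_le_first U V)
        (φ.hom.app (C.r ⁻¹ᵁ U) (pullLE C.a F _ _ (C.le_a U) (m k)) -
          pullLE C.p F _ _ (C.le_p U) (m k)) = 0 := by
  have hN := C.cutQ_le_first U V
  have hNV := C.cutQ_le U V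
  have hNa : C.cutQ U V ≤ (C.first ≫ C.a) ⁻¹ᵁ C.j ⁻¹ᵁ U := le_preimage_comp rfl (C.le_a U) hN
  have hNp : C.cutQ U V ≤ (C.first ≫ C.p) ⁻¹ᵁ C.j ⁻¹ᵁ U := le_preimage_comp rfl (C.le_p U) hN
  apply (app_bijective (pcompIso C.first C.p (C.first ≫ C.p) rfl F) (C.cutQ U V)).1
  have e₁ (k : κ) : (pcompIso C.first C.p (C.first ≫ C.p) rfl F).hom.app (C.cutQ U V)
      (pullLE C.first _ (C.r ⁻¹ᵁ U) _ hN
        (φ.hom.app (C.r ⁻¹ᵁ U) (pullLE C.a F _ _ (C.le_a U) (m k)))) =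
      (baseChange φ.hom C.first (C.first ≫ C.a) (C.first ≫ C.p) rfl rfl).app (C.cutQ U V)
        (pullLE (C.first ≫ C.a) F _ _ hNa (m k)) := by
    rw [← baseChange_app_pcompIso φ.hom C.first _ _ rfl rfl _ _ hN,
      pcompIso_hom_app_pullLE _ _ _ _ _ _ _ _ _ _ hNa]
  have e₂ (k : κ) : (pcompIso C.first C.p (C.first ≫ C.p) rfl F).hom.app (C.cutQ U V)
      (pullLE C.first _ (C.r ⁻¹ᵁ U) _ hN (pullLE C.p F _ _ (C.le_p U) (m k))) =
      pullLE (C.first ≫ C.p) F _ _ hNp (m k) :=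
    pcompIso_hom_app_pullLE _ _ _ _ _ _ _ _ _ _ _ _
  have e₃ (g : C.Q ⟶ C.P) (k : C.Q ⟶ C.T) (hk : g ≫ C.p = k)
      (hg : g ≫ C.a = C.second ≫ C.a) (hle : C.cutQ U V ≤ g ⁻¹ᵁ C.cutP U V) :
      (baseChange φ.hom g (C.second ≫ C.a) k hg hk).app _
          (pullLE (C.second ≫ C.a) F V _ hNV f) =
        ∑ i, (C.second ≫ C.a).appLE V _ hNV (x i) • pullLE k F (C.j ⁻¹ᵁ U) _
          (le_preimage_comp hk (C.cutP_le_p U V) hle) (m i) := by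
    rw [← C.pcompIso_app_pullLE_mixP U V x m g k hk hg hle, ← h,
      ← baseChange_app_pcompIso φ.hom g _ _ hg hk _ _ hle,
      pcompIso_hom_app_pullLE _ _ _ _ _ _ _ _ _ _ hNV]
  -- the cocycle condition compares the pull-backs of `φ(a^* f)` along `(t, g, h) ↦ (t g, h)` and
  -- `(t, g, h) ↦ (t, g h)`
  have e₄ := e₃ C.second (C.first ≫ C.a) C.second_p rfl (C.cutQ_le_second U V)
  have e₅ := e₃ C.prod (C.first ≫ C.p) C.prod_p C.prod_a (C.cutQ_le_prod U V)
  have e₆ := congr(($hφ).app (C.cutQ U V) (pullLE (C.second ≫ C.a) F V _ hNV f))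
  rw [e₅, Scheme.Modules.Hom.comp_app, AddCommGrpCat.comp_apply, e₄, map_sum] at e₆
  simp only [Scheme.Modules.Hom.app_smul, ← e₁, ← e₂] at e₆
  simp only [map_sub, smul_sub, map_sum, Finset.sum_sub_distrib,
    Scheme.Modules.Hom.app_smul, map_zero]
  exact sub_eq_zero.mpr e₆.symm

end Generation

end Nerve

namespace Nerve

variable {X : Scheme.{u}} (C : Nerve X) {F : C.T.Modules}
  (φ : (Scheme.Modules.pullback C.a).obj F ≅ (Scheme.Modules.pullback C.p).obj F)

instance : QuasiCompact C.p := MorphismProperty.of_isPullback C.isPullback.flip inferInstance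

lemma isCompact_preimage_j {U : X.Opens} (hU : IsAffineOpen U) :
    IsCompact ((C.j ⁻¹ᵁ U : C.T.Opens) : Set C.T) :=
  C.j.isCompact_preimage hU.isCompact

lemma isCompact_preimage_r {U : X.Opens} (hU : IsAffineOpen U) :
    IsCompact ((C.r ⁻¹ᵁ U : C.P.Opens) : Set C.P) := by
  have : IsCompact ((C.p ⁻¹ᵁ C.j ⁻¹ᵁ U : C.P.Opens) : Set C.P) :=
    C.p.isCompact_preimage (C.isCompact_preimage_j hU)
  rw [show C.r ⁻¹ᵁ U = C.p ⁻¹ᵁ C.j ⁻¹ᵁ U from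
    le_antisymm (C.le_p U) (le_preimage_comp C.hp le_rfl le_rfl)]
  exact this

lemma id_appLE_apply {T : Scheme.{u}} (V : T.Opens) (h : V ≤ (𝟙 T) ⁻¹ᵁ V) (c : Γ(T, V)) :
    (𝟙 T : T ⟶ T).appLE V V h c = c := by
  have e : (𝟙 T : T ⟶ T).appLE V V h = 𝟙 _ :=
    (Category.id_comp _).trans (T.presheaf.map_id (.op V))
  rw [e]
  rfl

/-- Pulling back functions along `a` is injective, since `t ↦ (t, 1)` is a section of `a`. -/
lemma appLE_a_injective {U : X.Opens} {V : C.T.Opens} (hV : V ≤ C.j ⁻¹ᵁ U) :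
    Function.Injective (C.a.appLE V (C.cutP U V) (C.cutP_le_a U V)) := by
  have h₁ : V ≤ C.unit ⁻¹ᵁ C.a ⁻¹ᵁ V := le_preimage_preimage C.unit_a le_rfl
  have h₂ : V ≤ C.unit ⁻¹ᵁ C.p ⁻¹ᵁ C.j ⁻¹ᵁ U := by
    have : C.unit ≫ C.p ≫ C.j = C.j := by
      rw [C.hp, ← C.ha, ← Category.assoc, C.unit_a, Category.id_comp]
    exact le_preimage_preimage rfl (le_preimage_preimage ((Category.assoc _ _ _).trans this) hV)
  have h : V ≤ C.unit ⁻¹ᵁ C.cutP U V := fun y hy ↦ ⟨h₂ hy, h₁ hy⟩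
  refine Function.LeftInverse.injective (g := C.unit.appLE (C.cutP U V) V h) fun c ↦ ?_
  rw [appLE_apply_appLE _ _ _ C.unit_a V _ V _ _ (le_preimage_comp C.unit_a le_rfl h₁)]
  exact id_appLE_apply V _ c

section

variable {U : X.Opens} (hU : IsAffineOpen U) {V : C.T.Opens} (hV : IsAffineOpen V)
  (hVU : V ≤ C.j ⁻¹ᵁ U)

include hU hV hVU

lemma exists_eq_mixP (hF : IsVectorBundle F)
    (z : Γ((Scheme.Modules.pullback C.p).obj F, C.cutP U V)) :
    ∃ (κ : Type) (_ : Fintype κ) (x : κ → Γ(C.T, V)) (m : κ → Γ(F, C.j ⁻¹ᵁ U)),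
      z = C.mixP U V x m :=
  Square.surj_of_isCompact (C := C.square U V hVU) (M := F) hF hU hV
    (C.j.flat_appLE hU hV hVU) (le_refl (C.j ⁻¹ᵁ U)) (C.isCompact_preimage_j hU)
    (C.j.isQuasiSeparated_preimage hU.isQuasiSeparated) z

lemma exists_refinement_of_sum_eq_zero {M : C.P.Modules} (hM : IsVectorBundle M) {κ : Type}
    [Fintype κ] (x : κ → Γ(C.T, V)) (m : κ → Γ(M, C.r ⁻¹ᵁ U))
    (h : ∑ k, (C.second ≫ C.a).appLE V _ (C.cutQ_le U V) (x k) •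
      pullLE C.first _ (C.r ⁻¹ᵁ U) _ (C.cutQ_le_first U V) (m k) = 0) :
    ∃ (L : Type) (_ : Fintype L) (α : κ → L → Γ(X, U)) (b : L → Γ(C.T, V)),
      (∀ k, x k = ∑ l, C.j.appLE U V hVU (α k l) * b l) ∧
        ∀ l, ∑ k, C.r.appLE U _ le_rfl (α k l) • m k = 0 :=
  Square.inj_of_isCompact (C := C.square' U V hVU) hM hU hV
    (C.j.flat_appLE hU hV hVU) (le_refl (C.r ⁻¹ᵁ U)) (C.isCompact_preimage_r hU) κ x m h

omit hU hV in
lemma mixP_refine {κ L : Type} [Fintype κ] [Fintype L] {x : κ → Γ(C.T, V)}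
    (m : κ → Γ(F, C.j ⁻¹ᵁ U)) (α : κ → L → Γ(X, U)) {b : L → Γ(C.T, V)}
    (hx : ∀ k, x k = ∑ l, C.j.appLE U V hVU (α k l) * b l) :
    C.mixP U V x m = C.mixP U V b fun l ↦ ∑ k, C.j.appLE U _ le_rfl (α k l) • m k :=
  Square.mix_refine (C := C.square U V hVU) (le_refl (C.j ⁻¹ᵁ U)) m α hx

omit hU hV in
lemma app_pullLE_sum_eq_mixP {L : Type} [Fintype L] (b : L → Γ(C.T, V))
    (n : L → Γ(F, C.j ⁻¹ᵁ U)) (hn : ∀ l, C.Inv φ.hom U (n l)) :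
    φ.hom.app (C.cutP U V) (pullLE C.a F V _ (C.cutP_le_a U V)
      (∑ l, b l • res F _ V hVU (n l))) = C.mixP U V b n := by
  have hr : C.cutP U V ≤ C.r ⁻¹ᵁ U := le_preimage_comp C.hp le_rfl (C.cutP_le_p U V)
  simp only [mixP, map_sum, pullLE_smul, Scheme.Modules.Hom.app_smul]
  refine Finset.sum_congr rfl fun l _ ↦ ?_
  have := congrArg (res _ _ (C.cutP U V) hr) (hn l)
  rw [res_app, pullLE_res_right, pullLE_res_right] at this
  rw [pullLE_res_left, this]

end

/-- Locally, `F` is generated by invariant sections: writing `φ(a^* f) = ∑ a^* xₖ • p^* mₖ` in such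
a way that the `mₖ` are invariant, one gets `f = ∑ xₖ mₖ` because pull-back along `a` is
injective. -/
lemma exists_invariant_generators (hF : IsVectorBundle F) (hφ : C.Cocycle φ.hom)
    {U : X.Opens} (hU : IsAffineOpen U) {V : C.T.Opens} (hV : IsAffineOpen V)
    (hVU : V ≤ C.j ⁻¹ᵁ U) {d : ℕ} {f : ULift.{u} (Fin d) → Γ(F, V)} (hf : IsFrame F V f) :
    ∃ (L : Type) (_ : Fintype L) (n : L → Γ(F, C.j ⁻¹ᵁ U)) (b : ULift.{u} (Fin d) → L → Γ(C.T, V)),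
      (∀ l, C.Inv φ.hom U (n l)) ∧ ∀ i, f i = ∑ l, b i l • res F _ V hVU (n l) := by
  have key (i : ULift.{u} (Fin d)) : ∃ (L : Type) (_ : Fintype L) (n : L → Γ(F, C.j ⁻¹ᵁ U))
      (b : L → Γ(C.T, V)), (∀ l, C.Inv φ.hom U (n l)) ∧
        f i = ∑ l, b l • res F _ V hVU (n l) := by
    obtain ⟨κ, _, x, m, h⟩ := C.exists_eq_mixP hU hV hVU hF
      (φ.hom.app (C.cutP U V) (pullLE C.a F V _ (C.cutP_le_a U V) (f i)))
    obtain ⟨L, _, α, b, hx, hα⟩ := C.exists_refinement_of_sum_eq_zero hU hV hVU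
      (hF.pullback C.p) x _ (C.sum_diff_eq_zero φ hφ U V x m (f i) h)
    let n (l : L) : Γ(F, C.j ⁻¹ᵁ U) := ∑ k, C.j.appLE U (C.j ⁻¹ᵁ U) le_rfl (α k l) • m k
    have hn (l : L) : C.Inv φ.hom U (n l) := by
      refine sub_eq_zero.mp (Eq.trans ?_ (hα l))
      simp only [n, map_sum, pullLE_smul, Scheme.Modules.Hom.app_smul, smul_sub,
        Finset.sum_sub_distrib]
      congr 1 <;> refine Finset.sum_congr rfl fun k _ ↦ ?_ <;> congr 1
      · exact appLE_apply_appLE _ _ _ C.ha _ _ _ _ _ _ _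
      · exact appLE_apply_appLE _ _ _ C.hp _ _ _ _ _ _ _
    refine ⟨L, inferInstance, n, b, hn, ?_⟩
    apply pullLE_injective C.a hf (C.cutP U V) (C.cutP_le_a U V) (C.appLE_a_injective hVU)
    apply (app_bijective φ (C.cutP U V)).1
    rw [h, C.mixP_refine hVU m α hx]
    exact (C.app_pullLE_sum_eq_mixP φ hVU b n hn).symm
  choose L _ n b hn hb using key
  classical
  refine ⟨Σ k : Fin d, L ⟨k⟩, inferInstance, fun k ↦ n _ k.2,
    fun i k ↦ if h : ⟨k.1⟩ = i then b i (h ▸ k.2) else 0, fun l ↦ hn _ _, ?_⟩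
  rintro ⟨i⟩
  rw [hb, Fintype.sum_sigma, Finset.sum_eq_single i]
  · exact Finset.sum_congr rfl fun l _ ↦ by dsimp only; rw [dif_pos rfl]
  · intro k _ hk
    refine Finset.sum_eq_zero fun l _ ↦ ?_
    dsimp only
    rw [dif_neg (fun h ↦ hk (congrArg ULift.down h)), zero_smul]
  · simp

/-- The locus where invariant sections form a frame is saturated: two points in the same fibre are
the images under `a` and `p` of a point of `P`, and `φ` identifies the pull-backs of the sections. -/
lemma isFrameAt_congr (hF : IsVectorBundle F) {U : X.Opens} {I : Type u} [Fintype I]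
    {n : I → Γ(F, C.j ⁻¹ᵁ U)} (hn : ∀ l, C.Inv φ.hom U (n l)) {t t' : C.T} (h : C.j t = C.j t')
    (ht : IsFrameAt F (C.j ⁻¹ᵁ U) n t) : IsFrameAt F (C.j ⁻¹ᵁ U) n t' := by
  obtain ⟨y, rfl, rfl⟩ := Scheme.exists_preimage_of_isPullback C.isPullback.flip t t' h
  apply isFrameAt_of_pullLE hF C.p (C.le_p U)
  obtain ⟨N, hN, hy, he⟩ := ht
  have hr : C.a ⁻¹ᵁ N ≤ C.r ⁻¹ᵁ U := (C.a.preimage_mono hN).trans (le_preimage_comp C.ha le_rfl le_rfl)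
  refine ⟨C.a ⁻¹ᵁ N, hr, hy, ?_⟩
  have := (he.pullLE (f := C.a) (C.a ⁻¹ᵁ N) le_rfl).app_iso φ
  convert this using 2 with i
  dsimp only
  rw [← hn i, res_app, pullLE_res_right, pullLE_res_left]

/-- A linearised vector bundle has invariant frames locally on the base: the locus where given
invariant sections form a frame is the preimage of an open subset of `X`. -/
lemma exists_invariant_frame (hF : IsVectorBundle F) (hφ : C.Cocycle φ.hom) (x : X) :
    ∃ (U : X.Opens) (d : ℕ) (e : ULift.{u} (Fin d) → Γ(F, C.j ⁻¹ᵁ U)),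
      x ∈ U ∧ (∀ i, C.Inv φ.hom U (e i)) ∧ IsFrame F (C.j ⁻¹ᵁ U) e := by
  obtain ⟨t, rfl⟩ := C.j.surjective x
  obtain ⟨U, hU, hx, -⟩ := TopologicalSpace.Opens.isBasis_iff_nbhd.mp X.isBasis_affineOpens
    (show C.j t ∈ (⊤ : X.Opens) from trivial)
  obtain ⟨V, ⟨hV, d, f, hf⟩, ht, hVU⟩ := TopologicalSpace.Opens.isBasis_iff_nbhd.mp hF.isBasis
    (show t ∈ C.j ⁻¹ᵁ U from hx)
  obtain ⟨L, _, n, b, hn, hb⟩ := C.exists_invariant_generators φ hF hφ hU hV hVU hf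
  classical
  obtain ⟨s, N, hN, htN, hs⟩ := exists_isFrameAt hf (fun l ↦ res F _ V hVU (n l)) b hb t ht
  let e i := n (s i)
  let D : Set C.T := {t | IsFrameAt F (C.j ⁻¹ᵁ U) e t}
  have hD : IsOpen D := isOpen_iff_forall_mem_open.mpr fun t ⟨N, hN, htN, hs⟩ ↦
    ⟨N, fun t' ht' ↦ ⟨N, hN, ht', hs⟩, N.2, htN⟩
  have hjD : C.j ⁻¹' (C.j '' D) = D := by
    refine Set.Subset.antisymm ?_ (Set.subset_preimage_image _ _)
    rintro t' ⟨t, ht, h⟩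
    exact C.isFrameAt_congr φ hF (fun i ↦ hn (s i)) h ht
  have hjD' : IsOpen (C.j '' D) := by
    rw [← (Flat.isQuotientMap_of_surjective C.j).isOpen_preimage]
    rwa [hjD]
  -- `j` is a topological quotient map, so the image of the saturated open set `D` is open
  let U' : X.Opens := ⟨C.j '' D, hjD'⟩
  have hU' : U' ≤ U := by
    rintro _ ⟨t, ⟨N, hN, ht, -⟩, rfl⟩
    exact hN ht
  refine ⟨U', d, fun i ↦ res F _ _ (C.j.preimage_mono hU') (e i), ?_, fun i ↦ Fork.Inv.res C.toFork (hn _) U' hU', ?_⟩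
  · refine ⟨t, ⟨N, hN.trans hVU, htN, ?_⟩, rfl⟩
    simpa only [res_res] using hs
  · refine isFrame_of_locally fun t' ht' ↦ ?_
    obtain ⟨N, hN, h, hs⟩ : t' ∈ D := by rw [← hjD]; exact ht'
    have hND : N ≤ C.j ⁻¹ᵁ U' := fun t ht ↦ ⟨t, ⟨N, hN, ht, hs⟩, rfl⟩
    refine ⟨N, hND, h, ?_⟩
    simpa only [res_res] using hs

end Nerve

/-! ### Vector bundles on the base of a torsor -/

/-- An isomorphism of the underlying modules which is compatible with the linearisations is an
isomorphism of equivariant sheaves. -/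
def EquivariantSheaf.isoMk {S : Scheme.{u}} {D : ActionDiagram S} {F F' : EquivariantSheaf D}
    (ε : F.sheaf ≅ F'.sheaf) (h : (Scheme.Modules.pullback D.act.left).map ε.hom ≫ F'.φ.hom =
      F.φ.hom ≫ (Scheme.Modules.pullback D.pr.left).map ε.hom) : F ≅ F' where
  hom := ⟨ε.hom, h⟩
  inv := ⟨ε.inv, by
    rw [← cancel_mono ((Scheme.Modules.pullback D.pr.left).map ε.hom), Category.assoc,
      Category.assoc, ← h, ← Functor.map_comp, ← Functor.map_comp_assoc, ε.inv_hom_id]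
    simp⟩
  hom_inv_id := EquivariantSheaf.hom_ext ε.hom_inv_id
  inv_hom_id := EquivariantSheaf.hom_ext ε.inv_hom_id

/-- The pair `act, pr : T × G ⟶ T` over a scheme `X`. -/
def ActionDiagram.fork {S X : Scheme.{u}} (D : ActionDiagram S) (j : D.T.left ⟶ X)
    (hj : D.act.left ≫ j = D.pr.left ≫ j) : Fork X where
  P := D.P.left
  T := D.T.left
  a := D.act.left
  p := D.pr.left
  j := j
  r := D.pr.left ≫ j
  ha := hj
  hp := rfl

namespace EquivariantSheaf

variable {S X : Scheme.{u}} {D : ActionDiagram S} {j : D.T.left ⟶ X}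
  {hj : D.act.left ≫ j = D.pr.left ≫ j}

lemma canon_fork (E : X.Modules) : (D.fork j hj).canon E = (ofInvariant j hj E).φ.hom := rfl

lemma ofInvariant_comm {E E' : X.Modules}
    (ψ : (pullbackFunctor j hj).obj E ⟶ (pullbackFunctor j hj).obj E') :
    (Scheme.Modules.pullback D.act.left).map ψ.hom ≫ (ofInvariant j hj E').φ.hom =
      (ofInvariant j hj E).φ.hom ≫ (Scheme.Modules.pullback D.pr.left).map ψ.hom :=
  ψ.comm

lemma existsUnique_pullbackFunctor_map_eq (hC : (D.fork j hj).Exact) {E E' : X.Modules}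
    (hE' : IsVectorBundle E') (ψ : (pullbackFunctor j hj).obj E ⟶ (pullbackFunctor j hj).obj E') :
    ∃! f : E ⟶ E', (pullbackFunctor j hj).map f = ψ := by
  obtain ⟨f, hf, hf'⟩ := Fork.existsUnique_pullback_map_eq hC hE' ψ.hom
    ((congrArg ((Scheme.Modules.pullback D.act.left).map ψ.hom ≫ ·) (canon_fork E')).trans
      ((ofInvariant_comm ψ).trans
        (congrArg (· ≫ (Scheme.Modules.pullback D.pr.left).map ψ.hom) (canon_fork E).symm)))
  exact ⟨f, hom_ext hf, fun g hg ↦ hf' g congr(($hg).hom)⟩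

lemma exists_pullbackFunctor_iso (hC : (D.fork j hj).Exact) (F : EquivariantSheaf D)
    (h : ∀ x : X, ∃ (U : X.Opens) (n : ℕ) (e : ULift.{u} (Fin n) → Γ(F.sheaf, j ⁻¹ᵁ U)),
      x ∈ U ∧ (∀ i, (D.fork j hj).Inv F.φ.hom U (e i)) ∧ IsFrame F.sheaf (j ⁻¹ᵁ U) e) :
    ∃ E, IsVectorBundle E ∧ Nonempty ((pullbackFunctor j hj).obj E ≅ F) := by
  obtain ⟨E, ε, hE, h⟩ := Fork.exists_iso_pullback hC F.φ.hom h
  exact ⟨E, hE, ⟨isoMk ε (h.trans (congrArg (· ≫ (Scheme.Modules.pullback D.pr.left).map ε.hom)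
    (canon_fork E)))⟩⟩

end EquivariantSheaf

section

open MonObj

namespace IsTorsor

variable {S : Scheme.{u}} {G T X : Over S} [GrpObj G] {σ : RightAction G T} {j : T ⟶ X}

lemma isPullback_act (hj : IsTorsor σ j) : IsPullback σ.act (fst T G) j j := by
  have := hj.isIso
  exact IsPullback.of_iso_pullback ⟨hj.invariant⟩
    (asIso (pullback.lift σ.act (fst T G) hj.invariant)) (pullback.lift_fst _ _ _)
    (pullback.lift_snd _ _ _)

variable (σ) in
/-- `T × G × G` is the fibre product of the action and the projection `T × G ⟶ T`. -/
lemma isPullback_secondPair :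
    IsPullback σ.secondPair σ.firstPair (fst T G) σ.act := by
  refine ⟨⟨σ.secondPair_fst⟩, ⟨PullbackCone.IsLimit.mk _
    (fun s ↦ lift s.snd (s.fst ≫ snd T G)) (fun s ↦ ?_) (fun s ↦ ?_) fun s m h₁ h₂ ↦ ?_⟩⟩
  · ext1
    · simpa [RightAction.secondPair] using s.condition.symm
    · simp [RightAction.secondPair]
  · simp [RightAction.firstPair]
  · ext1
    · rw [lift_fst, ← h₂]
      rfl
    · rw [lift_snd, ← h₁, Category.assoc]
      simp [RightAction.secondPair]

lemma isPullback_firstPair (hj : IsTorsor σ j) :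
    IsPullback (σ.secondPair ≫ σ.act) σ.firstPair j (fst T G ≫ j) := by
  have := (isPullback_secondPair σ).paste_horiz hj.isPullback_act
  rwa [hj.invariant] at this

/-- The diagonal of `j` is, up to the isomorphism `T × G ≅ T ×_X T`, the section `t ↦ (t, 1)` of the
quasi-separated morphism `T × G ⟶ T`. -/
lemma quasiSeparated [QuasiSeparated G.hom] (hj : IsTorsor σ j) : QuasiSeparated j.left := by
  let u : T ⟶ T ⊗ G := lift (𝟙 T) 1
  have h₁ : IsPullback (fst T G).left (snd T G).left T.hom G.hom := by
    exact IsPullback.of_hasPullback _ _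
  have h₂ : QuasiSeparated (fst T G).left :=
    MorphismProperty.of_isPullback h₁.flip inferInstance
  have h₃ : u.left ≫ (fst T G).left = 𝟙 _ := by
    rw [← Over.comp_left, lift_fst]
    rfl
  have h₄ : u.left ≫ σ.act.left = 𝟙 _ := by
    rw [← Over.comp_left, σ.act_one]
    rfl
  have h₅ : QuasiCompact u.left := by
    have : QuasiCompact (u.left ≫ (fst T G).left) := by
      rw [h₃]
      infer_instance
    exact QuasiCompact.of_comp _ (fst T G).left
  have h₆ : IsPullback σ.act.left (fst T G).left j.left j.left := hj.isPullback_act.map (Over.forget S)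
  constructor
  rw [show pullback.diagonal j.left = u.left ≫ h₆.isoPullback.hom by
    ext1
    · rw [pullback.diagonal_fst, Category.assoc, IsPullback.isoPullback_hom_fst]
      exact h₄.symm
    · rw [pullback.diagonal_snd, Category.assoc, IsPullback.isoPullback_hom_snd]
      exact h₃.symm]
  infer_instance

/-- The diagram of schemes attached to a torsor. -/
noncomputable def nerve [QuasiSeparated G.hom] (hj : IsTorsor σ j) : Nerve X.left where
  toFork := σ.diagram.fork j.left (congrArg (fun f ↦ f.left) hj.invariant)
  Q := σ.diagram.Q.left
  first := σ.diagram.first.left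
  second := σ.diagram.second.left
  prod := σ.diagram.prod.left
  second_p := σ.diagram.second_pr_left
  prod_p := σ.diagram.prod_pr_left
  prod_a := σ.diagram.prod_act_left
  unit := (lift (𝟙 T) 1 : T ⟶ T ⊗ G).left
  unit_a := congrArg (fun f ↦ f.left) (σ.act_one T (𝟙 T))
  isPullback := (hj.isPullback_act.map (Over.forget S)).flip
  isPullback_first := (hj.isPullback_firstPair.map (Over.forget S)).flip
  flat := hj.flat
  surjective := hj.surjective
  quasiCompact := hj.quasiCompact
  quasiSeparated := hj.quasiSeparated

variable [QuasiSeparated G.hom]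

lemma existsUnique_pullbackVect_map_eq (hj : IsTorsor σ j) {E E' : Vect X.left}
    (ψ : (pullbackVect j hj.invariant).obj E ⟶ (pullbackVect j hj.invariant).obj E') :
    ∃! f : E ⟶ E', (pullbackVect j hj.invariant).map f = ψ := by
  obtain ⟨f, hf, hf'⟩ := EquivariantSheaf.existsUnique_pullbackFunctor_map_eq hj.nerve.exact
    E'.property ψ.hom
  exact ⟨⟨f⟩, ObjectProperty.hom_ext _ hf,
    fun g hg ↦ ObjectProperty.hom_ext _ (hf' g.hom congr(($hg).hom))⟩

lemma cocycle_nerve (hj : IsTorsor σ j) (F : EquivariantSheaf σ.diagram) :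
    hj.nerve.Cocycle F.φ.hom := by
  have e₁ : baseChange F.φ.hom σ.diagram.second.left
      (σ.diagram.second.left ≫ σ.diagram.act.left) (σ.diagram.first.left ≫ σ.diagram.act.left) rfl
        σ.diagram.second_pr_left =
      baseChange (f₁ := hj.nerve.a) (f₂ := hj.nerve.p) F.φ.hom hj.nerve.second
        (hj.nerve.second ≫ hj.nerve.a) (hj.nerve.first ≫ hj.nerve.a) rfl hj.nerve.second_p := rfl
  have e₂ : baseChange F.φ.hom σ.diagram.first.left
      (σ.diagram.first.left ≫ σ.diagram.act.left) (σ.diagram.first.left ≫ σ.diagram.pr.left) rfl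
        rfl =
      baseChange (f₁ := hj.nerve.a) (f₂ := hj.nerve.p) F.φ.hom hj.nerve.first
        (hj.nerve.first ≫ hj.nerve.a) (hj.nerve.first ≫ hj.nerve.p) rfl rfl := rfl
  exact F.cocycle.trans (congrArg₂ (· ≫ ·) e₁ e₂)

lemma exists_pullbackVect_iso (hj : IsTorsor σ j) (F : GVect σ) :
    ∃ E, Nonempty ((pullbackVect j hj.invariant).obj E ≅ F) := by
  obtain ⟨E, hE, ⟨ε⟩⟩ := EquivariantSheaf.exists_pullbackFunctor_iso hj.nerve.exact F.obj
    (hj.nerve.exists_invariant_frame F.obj.φ F.property (hj.cocycle_nerve F.obj))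
  exact ⟨⟨E, hE⟩, ⟨ObjectProperty.isoMk _ ε⟩⟩

/-- Vector bundles on the base of a torsor are the same as equivariant vector bundles on the
torsor. -/
theorem isEquivalence_pullbackVect (hj : IsTorsor σ j) :
    (pullbackVect j hj.invariant).IsEquivalence where
  faithful := ⟨fun {_ _ _ _} h ↦ (hj.existsUnique_pullbackVect_map_eq _).unique h rfl⟩
  full := ⟨fun ψ ↦ (hj.existsUnique_pullbackVect_map_eq ψ).exists⟩
  essSurj := ⟨fun F ↦ hj.exists_pullbackVect_iso F⟩

end IsTorsor

end

/-! ### Torsion-free modules and flat base change -/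

section Algebra

/-- If `h a ∈ p A` implies `a ∈ p A`, then the same holds in every flat `A`-algebra. -/
lemma dvd_of_flat {A C : Type*} [CommRing A] [CommRing C] (f : A →+* C) (hf : f.Flat) {h p : A}
    (hp : ∀ a, p ∣ h * a → p ∣ a) {c : C} (hc : f p ∣ f h * c) : f p ∣ c := by
  let := f.toAlgebra
  have : Module.Flat A C := hf
  obtain ⟨d, hd⟩ := hc
  obtain ⟨k, a, y, h₁, h₂⟩ := Module.Flat.isTrivialRelation_of_sum_smul_eq_zero (R := A) (M := C)
    (f := ![h, -p]) (x := ![c, d]) (by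
      rw [Fin.sum_univ_two]
      change f h * c + f (-p) * d = 0
      rw [hd, map_neg]
      ring)
  have h₃ : ∀ j, p ∣ a 0 j := fun j ↦ by
    have := h₂ j
    rw [Fin.sum_univ_two] at this
    refine hp _ ⟨a 1 j, ?_⟩
    change h * a 0 j + -p * a 1 j = 0 at this
    linear_combination this
  have h₄ : c = ∑ j, f (a 0 j) * y j := h₁ 0
  rw [h₄]
  exact Finset.dvd_sum fun j _ ↦ (map_dvd f (h₃ j)).mul_right _

open TensorProduct in
/-- Let `ι : A' ⟶ A` have torsion-free cokernel. If `∑ wₖ ⊗ nₖ` with linearly independent `nₖ`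
comes from `A' ⊗ B`, then all `wₖ` come from `A'`. -/
lemma mem_range_of_rTensor_eq_sum {R A A' B : Type*} [CommRing R] [IsDomain R]
    [IsPrincipalIdealRing R] [AddCommGroup A] [Module R A] [AddCommGroup A'] [Module R A']
    [AddCommGroup B] [Module R B] (ι : A' →ₗ[R] A) (hι : Module.IsTorsionFree R (A ⧸ ι.range))
    {κ : Type*} [Fintype κ] (n : κ → B) (hn : LinearIndependent R n) (w : κ → A) (z : A' ⊗[R] B)
    (h : ι.rTensor B z = ∑ k, w k ⊗ₜ n k) (k : κ) : w k ∈ ι.range := by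
  classical
  let C := A ⧸ ι.range
  have hinj : Function.Injective ((Fintype.linearCombination R n).lTensor C) := by
    refine Module.Flat.lTensor_preserves_injective_linearMap _ ?_
    exact hn.fintypeLinearCombination_injective
  have h₁ : ∑ k, (ι.range.mkQ (w k)) ⊗ₜ[R] (Pi.single k 1 : κ → R) = 0 := by
    apply hinj
    rw [map_sum, map_zero]
    have h₂ := congrArg (ι.range.mkQ.rTensor B) h
    rw [← LinearMap.comp_apply, ← LinearMap.rTensor_comp,
      show ι.range.mkQ ∘ₗ ι = 0 from LinearMap.range_mkQ_comp ι, LinearMap.rTensor_zero,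
      LinearMap.zero_apply, map_sum] at h₂
    rw [h₂]
    exact Finset.sum_congr rfl fun k _ ↦ by
      simp [Fintype.linearCombination_apply_single]
  have h₃ := congrArg (TensorProduct.rid R C ∘ (LinearMap.proj k : (κ → R) →ₗ[R] R).lTensor C) h₁
  refine (Submodule.Quotient.mk_eq_zero _).mp ?_
  simpa [Pi.single_apply, ite_smul, -Submodule.Quotient.mk_eq_zero] using h₃

variable {R A B D : CommRingCat.{u}} {α : R ⟶ A} {β : R ⟶ B} {b : A ⟶ D} {c : B ⟶ D}

/-- In `A ⊗ B` with `B` torsion-free over a principal ideal domain, every element is of the form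
`∑ wₖ ⊗ nₖ` with linearly independent `nₖ`. -/
lemma exists_sum_linearIndependent [IsDomain R] [IsPrincipalIdealRing R] (h : IsPushout α β b c)
    (hβ : β.hom.Flat) (d : D) :
    ∃ (κ : Type) (_ : Fintype κ) (w : κ → A) (n : κ → B), d = ∑ k, b (w k) * c (n k) ∧
      ∀ r : κ → R, ∑ k, β (r k) * n k = 0 → r = 0 := by
  obtain ⟨κ, _, x, y, rfl⟩ := exists_sum_of_isPushout h d
  let := β.hom.toAlgebra
  have : Module.Flat R B := hβ
  let N : Submodule R B := Submodule.span R (Set.range x)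
  have : Module.Finite R N := Module.Finite.span_of_finite R (Set.finite_range x)
  have : Module.IsTorsionFree R N := inferInstance
  obtain ⟨m, e⟩ := Module.basisOfFiniteTypeTorsionFree' (R := R) (M := N)
  have hx (k : κ) : x k = ∑ i, β (e.repr ⟨x k, Submodule.subset_span ⟨k, rfl⟩⟩ i) * e i := by
    have := congrArg (N.subtype) (e.sum_repr ⟨x k, Submodule.subset_span ⟨k, rfl⟩⟩)
    rw [map_sum] at this
    exact this.symm
  refine ⟨Fin m, inferInstance,
    fun i ↦ ∑ k, α (e.repr ⟨x k, Submodule.subset_span ⟨k, rfl⟩⟩ i) * y k, fun i ↦ e i, ?_, ?_⟩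
  · have e₁ (r : R) : c (β r) = b (α r) := congr($(h.w.symm) r)
    simp only [map_sum, map_mul, Finset.sum_mul]
    rw [Finset.sum_comm]
    refine Finset.sum_congr rfl fun k _ ↦ ?_
    conv_lhs => rw [hx k]
    simp only [map_sum, map_mul, Finset.sum_mul, e₁]
    exact Finset.sum_congr rfl fun i _ ↦ by ring
  · intro r hr
    have h₁ : ∑ i, r i • e i = 0 := by
      apply N.injective_subtype
      rw [map_sum, map_zero]
      exact hr
    funext i
    exact Fintype.linearIndependent_iff.mp e.linearIndependent r h₁ i

/-- The statement of `mem_range_of_rTensor_eq_sum` for algebras, with pushouts instead of tensor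
products. -/
lemma exists_eq_of_isPushout [IsDomain R] [IsPrincipalIdealRing R] {A' D' : CommRingCat.{u}}
    {α' : R ⟶ A'} {b' : A' ⟶ D'} {c' : B ⟶ D'} (h : IsPushout α β b c) (h' : IsPushout α' β b' c')
    (ρ : A' ⟶ A) (δ : D' ⟶ D) (hρ : α' ≫ ρ = α) (hb : b' ≫ δ = ρ ≫ b) (hc : c' ≫ δ = c)
    (htf : ∀ (r : R) (a : A) (a' : A'), r ≠ 0 → α r * a = ρ a' → ∃ a'', ρ a'' = a)
    {κ : Type} [Fintype κ] (w : κ → A) (n : κ → B)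
    (hn : ∀ r : κ → R, ∑ k, β (r k) * n k = 0 → r = 0) (d : D')
    (hd : δ d = ∑ k, b (w k) * c (n k)) (k : κ) : ∃ a, ρ a = w k := by
  let := α.hom.toAlgebra
  let := α'.hom.toAlgebra
  let := β.hom.toAlgebra
  let := b.hom.toAlgebra
  let := c.hom.toAlgebra
  let := (b.hom.comp α.hom).toAlgebra
  have : IsScalarTower R A D := .of_algebraMap_eq fun _ ↦ rfl
  have : IsScalarTower R B D := .of_algebraMap_eq fun x ↦ congr($(h.w) x)
  have hP : Algebra.IsPushout R A B D := CommRingCat.isPushout_iff_isPushout.mp h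
  let ε := hP.out.equiv
  have hε (a : A) (x : B) : ε (a ⊗ₜ x) = b a * c x := by
    rw [IsBaseChange.equiv_tmul, Algebra.smul_def]
    rfl
  let ι : A' →ₗ[R] A :=
    { toFun := ρ
      map_add' := map_add _
      map_smul' := fun r a ↦ by
        rw [Algebra.smul_def, Algebra.smul_def, map_mul]
        congr 1
        exact congr($hρ r) }
  have hι : Module.IsTorsionFree R (A ⧸ ι.range) := by
    rw [Module.isTorsionFree_iff_smul_eq_zero]
    intro r a hra
    obtain ⟨a, rfl⟩ := Submodule.Quotient.mk_surjective _ a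
    rw [← Submodule.Quotient.mk_smul, Submodule.Quotient.mk_eq_zero] at hra
    obtain ⟨a', ha'⟩ := hra
    refine or_iff_not_imp_left.mpr fun hr ↦ (Submodule.Quotient.mk_eq_zero _).mpr ?_
    exact htf r a a' hr ((Algebra.smul_def r a).symm.trans ha'.symm)
  obtain ⟨κ', _, x, y, rfl⟩ := exists_sum_of_isPushout h' d
  refine mem_range_of_rTensor_eq_sum ι hι n (Fintype.linearIndependent_iff.mpr fun r hr ↦ ?_) w
    (∑ l, y l ⊗ₜ x l) ?_ k
  · refine congrFun (hn r (Eq.trans ?_ hr))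
    exact Finset.sum_congr rfl fun k _ ↦ (Algebra.smul_def _ _).symm
  · apply ε.injective
    rw [map_sum, map_sum, map_sum]
    simp only [LinearMap.rTensor_tmul, hε, ← hd]
    rw [map_sum]
    refine Finset.sum_congr rfl fun l _ ↦ ?_
    rw [map_mul]
    exact (mul_comm _ _).trans (congrArg₂ (· * ·) congr($hc.symm (x l)) congr($hb.symm (y l)))

/-- If `R ⟶ A` is injective and `B` is flat, then `B ⟶ A ⊗ B` is injective. -/
lemma injective_of_isPushout (h : IsPushout α β b c) (hβ : β.hom.Flat)
    (hα : Function.Injective α) : Function.Injective c := by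
  rw [injective_iff_map_eq_zero]
  intro x hx
  obtain ⟨κ, _, a, x', hx', ha⟩ := exists_refinement_of_isPushout (I := PUnit) (κ := Unit) h hβ
    (fun _ ↦ x) (fun _ _ ↦ 1) (by simp [hx])
  rw [hx' ⟨⟩]
  refine Finset.sum_eq_zero fun l _ ↦ ?_
  have := ha l ⟨⟩
  rw [Fintype.sum_unique, mul_one] at this
  have h₀ : a ⟨⟩ l = 0 := hα (this.trans (map_zero α.hom).symm)
  change β (a ⟨⟩ l) * x' l = 0
  rw [h₀, map_zero, zero_mul]

/-- If `R ⟶ B` is surjective with kernel generated by `p`, then the kernel of `A ⟶ A ⊗ B` is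
generated by `p`. -/
lemma dvd_of_isPushout (h : IsPushout α β b c) (hβ : Function.Surjective β) {p : R}
    (hp : ∀ r, β r = 0 → p ∣ r) {a : A} (ha : b a = 0) : α p ∣ a := by
  let I := Ideal.span {α p}
  let q : A ⟶ CommRingCat.of (A ⧸ I) := CommRingCat.ofHom (Ideal.Quotient.mk I)
  have hq (x : A) : q x = 0 ↔ α p ∣ x := Ideal.Quotient.eq_zero_iff_mem.trans Ideal.mem_span_singleton
  let g : { g : R →+* (A ⧸ I) // RingHom.ker β.hom ≤ RingHom.ker g } :=
    ⟨(α ≫ q).hom, fun r hr ↦ (hq (α r)).mpr (map_dvd α.hom (hp r hr))⟩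
  let l : B →+* (A ⧸ I) :=
    RingHom.liftOfRightInverse β.hom _ (Function.rightInverse_surjInv hβ) g
  have hl : α ≫ q = β ≫ CommRingCat.ofHom l := by
    ext r
    exact (RingHom.liftOfRightInverse_comp_apply β.hom _ (Function.rightInverse_surjInv hβ) g r).symm
  have := h.inl_desc q (CommRingCat.ofHom l) hl
  rw [← hq, ← this, CommRingCat.comp_apply, ha, map_zero]

end Algebra

/-! ### Functions on flat schemes over an integral scheme -/

/-- For `f : Y ⟶ X` flat, a function on an affine open subset `W` of `Y` is divisible by `p` if it
is divisible by `p` on the locus `h ≠ 0`, where `h` is a nonzerodivisor modulo `p`. -/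
lemma dvd_of_dvd_basicOpen {X Y : Scheme.{u}} (f : Y ⟶ X) [Flat f] {U : X.Opens}
    (hU : IsAffineOpen U) {h p : Γ(X, U)} (hp : ∀ a, p ∣ h * a → p ∣ a) {W : Y.Opens}
    (hW : IsAffineOpen W) (hWU : W ≤ f ⁻¹ᵁ U) (c : Γ(Y, W)) {N : Y.Opens} (hN : N ≤ W)
    (hN' : N ≤ f ⁻¹ᵁ X.basicOpen h) (hN'' : W ⊓ f ⁻¹ᵁ X.basicOpen h ≤ N)
    (hc : Y.presheaf.map (homOfLE hN).op (f.appLE U W hWU p) ∣ Y.presheaf.map (homOfLE hN).op c) :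
    f.appLE U W hWU p ∣ c := by
  have hflat := f.flat_appLE hU hW hWU
  let g := f.appLE U W hWU h
  have hg : Y.basicOpen g = N := by
    rw [Scheme.basicOpen_appLE]
    exact le_antisymm hN'' (le_inf hN hN')
  subst hg
  have hloc := hW.isLocalization_basicOpen g
  -- clear denominators: `h ^ (m + n) * c` is divisible by `p` on `W`
  obtain ⟨d, hd⟩ := hc
  obtain ⟨n, c', hc'⟩ := IsLocalization.Away.surj g d
  have e (x : Γ(Y, W)) : algebraMap Γ(Y, W) Γ(Y, Y.basicOpen g) x =
    Y.presheaf.map (homOfLE hN).op x := rfl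
  obtain ⟨m, hm⟩ := IsLocalization.Away.exists_of_eq (S := Γ(Y, Y.basicOpen g)) (x := g)
    (a := g ^ n * c) (b := f.appLE U W hWU p * c') (by
      rw [map_mul, map_mul, map_pow, ← hc', e, e, e, hd]
      ring)
  have hp' (k : ℕ) : ∀ a, p ∣ h ^ k * a → p ∣ a := by
    induction k with
    | zero => simp
    | succ k ih =>
      intro a ha
      exact ih a (hp _ (by rwa [← mul_assoc, ← pow_succ']))
  refine dvd_of_flat (f.appLE U W hWU).hom hflat (hp' (m + n)) ?_
  change f.appLE U W hWU p ∣ f.appLE U W hWU (h ^ (m + n)) * c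
  rw [map_pow, pow_add, mul_assoc, hm]
  exact ⟨_, mul_left_comm _ _ _⟩

/-- Divisibility by a nonzerodivisor is a local property. -/
lemma dvd_of_locally_dvd {Y : Scheme.{u}} {U : Y.Opens} {p g : Γ(Y, U)}
    (hp : ∀ (V : Y.Opens) (hV : V ≤ U) (a : Γ(Y, V)),
      Y.presheaf.map (homOfLE hV).op p * a = 0 → a = 0)
    (h : ∀ x ∈ U, ∃ (V : Y.Opens) (hV : V ≤ U), x ∈ V ∧
      Y.presheaf.map (homOfLE hV).op p ∣ Y.presheaf.map (homOfLE hV).op g) : p ∣ g := by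
  obtain ⟨c, hc⟩ := fun_glue (U := U) (fun V hV c ↦ Y.presheaf.map (homOfLE hV).op g =
      Y.presheaf.map (homOfLE hV).op p * c)
    (fun V W hV hW c hc ↦ by
      have := congrArg (Y.presheaf.map (homOfLE hW).op) hc
      rwa [map_mul, map_map_apply, map_map_apply] at this)
    (fun V hV s t hs ht ↦ sub_eq_zero.mp (hp V hV _ (by rw [mul_sub, ← hs, ← ht, sub_self])))
    (fun x hx ↦ by
      obtain ⟨V, hV, hxV, c, hc⟩ := h x hx
      exact ⟨V, hV, hxV, c, hc⟩)
  refine ⟨c, fun_ext fun x hx ↦ ?_⟩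
  obtain ⟨V, hV, hxV, h⟩ := hc x hx
  exact ⟨V, hV, hxV, by rw [h, map_mul]⟩

/-- On a flat scheme over an integral scheme `X`, a function which vanishes over a non-empty open
subset of `X` vanishes. -/
lemma eq_zero_of_flat_of_isIntegral {X Y : Scheme.{u}} (f : Y ⟶ X) [Flat f] [IsIntegral X]
    {V : Y.Opens} {O : X.Opens} (hO : (O : Set X).Nonempty) (s : Γ(Y, V)) {N : Y.Opens}
    (hN : N ≤ V) (hN' : V ⊓ f ⁻¹ᵁ O ≤ N) (hs : Y.presheaf.map (homOfLE hN).op s = 0) : s = 0 := by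
  refine fun_ext fun y hy ↦ ?_
  obtain ⟨U, hU, hyU, -⟩ := TopologicalSpace.Opens.isBasis_iff_nbhd.mp X.isBasis_affineOpens
    (show f y ∈ (⊤ : X.Opens) from trivial)
  obtain ⟨W, hW, hyW, hWV⟩ := TopologicalSpace.Opens.isBasis_iff_nbhd.mp Y.isBasis_affineOpens
    (show y ∈ V ⊓ f ⁻¹ᵁ U from ⟨hy, hyU⟩)
  refine ⟨W, hWV.trans inf_le_left, hyW, ?_⟩
  rw [map_zero]
  obtain ⟨x, hxU, hxO⟩ := nonempty_preirreducible_inter U.2 O.2 ⟨_, hyU⟩ hO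
  obtain ⟨h, hhO, hxh⟩ := hU.exists_basicOpen_le ⟨x, hxO⟩ hxU
  have : Nonempty U := ⟨⟨x, hxU⟩⟩
  have hh : h ≠ 0 := by
    rintro rfl
    simp at hxh
  -- divisibility by `0`: the nonzero function `h` on `U` is a nonzerodivisor
  rw [← zero_dvd_iff, ← map_zero (f.appLE U W (hWV.trans inf_le_right)).hom]
  refine dvd_of_dvd_basicOpen f hU (h := h) (p := 0) (fun a ha ↦ ?_) hW (hWV.trans inf_le_right) _
    (N := W ⊓ f ⁻¹ᵁ X.basicOpen h) inf_le_left inf_le_right le_rfl ?_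
  · rw [zero_dvd_iff] at ha ⊢
    exact (mul_eq_zero.mp ha).resolve_left hh
  · have hle : W ⊓ f ⁻¹ᵁ X.basicOpen h ≤ N :=
      (inf_le_inf (hWV.trans inf_le_left) (f.preimage_mono hhO)).trans hN'
    have := congrArg (Y.presheaf.map (homOfLE hle).op) hs
    rw [map_map_apply, map_zero] at this
    rw [map_map_apply, this]
    exact dvd_zero _

/-- Pull-backs of nonzerodivisors along flat morphisms are nonzerodivisors. -/
lemma eq_zero_of_flat_of_mul_eq_zero {S T : Scheme.{u}} [IsAffine S] (f : T ⟶ S) [Flat f]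
    {p : Γ(S, ⊤)} (hp : ∀ a, p * a = 0 → a = 0) (V : T.Opens) (s : Γ(T, V))
    (hs : f.appLE ⊤ V (le_preimage_top f V) p * s = 0) : s = 0 := by
  refine fun_ext fun y hy ↦ ?_
  obtain ⟨W, hW, hyW, hWV⟩ := TopologicalSpace.Opens.isBasis_iff_nbhd.mp T.isBasis_affineOpens hy
  refine ⟨W, hWV, hyW, ?_⟩
  have := congrArg (T.presheaf.map (homOfLE hWV).op) hs
  rw [map_mul, map_apply_appLE, map_zero] at this
  rw [map_zero, ← zero_dvd_iff, ← map_zero (f.appLE ⊤ W (le_preimage_top f W)).hom]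
  refine dvd_of_flat _ (f.flat_appLE (isAffineOpen_top S) hW (le_preimage_top f W)) (h := p)
    (fun a ha ↦ ?_) ?_
  · rw [zero_dvd_iff] at ha ⊢
    exact hp a ha
  · rw [map_zero, zero_dvd_iff]
    exact this

/-! ### Functions on the product of a torsor with an affine flat scheme -/

section Functions

variable {S T H Z : Scheme.{u}} {h : Z ⟶ T} {q : Z ⟶ H} {f : T ⟶ S} {g : H ⟶ S}

lemma isPushout_of_isQuasiSeparated (hP : IsPullback h q f g) [IsAffine S] [IsAffine H] [Flat g]
    {W : T.Opens} (hW : IsCompact (W : Set T)) (hW' : IsQuasiSeparated (W : Set T)) :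
    IsPushout (f.appLE ⊤ W (le_preimage_top f W)) (g.appLE ⊤ ⊤ (le_preimage_top g ⊤))
      (h.appLE W (h ⁻¹ᵁ W) le_rfl) (q.appLE ⊤ (h ⁻¹ᵁ W) (le_preimage_top q _)) :=
  (isIso_pushoutSection_iff hP (le_preimage_top g ⊤) (le_preimage_top f W)
    (inf_top_eq _).symm).mp (isIso_pushoutSection_of_isQuasiSeparated_of_flat_right hP
      (le_preimage_top g ⊤) (le_preimage_top f W) (inf_top_eq _).symm (isAffineOpen_top S)
      (isAffineOpen_top H) hW hW')

/-- **Functions on `T × H`**, if `T` is quasi-compact and quasi-separated. -/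
lemma appTop_bijective_of_compactSpace (hP : IsPullback h q f g) [IsAffine S] [IsAffine H] [Flat g]
    [CompactSpace T] [QuasiSeparatedSpace T] (hT : IsIso f.appTop) :
    Function.Bijective q.appTop := by
  have h₁ := isPushout_of_isQuasiSeparated hP (W := ⊤) isCompact_univ isQuasiSeparated_univ
  have h₂ : IsIso (f.appLE ⊤ ⊤ (le_preimage_top f ⊤)) := by
    rwa [show f.appLE ⊤ ⊤ (le_preimage_top f ⊤) = f.appTop from f.app_eq_appLE.symm]
  have h₃ := (ConcreteCategory.isIso_iff_bijective _).mp h₁.isIso_inr_of_isIso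
  rw [show q.appTop = q.appLE ⊤ (h ⁻¹ᵁ ⊤) (le_preimage_top q _) from q.app_eq_appLE]
  exact h₃

variable {X : Scheme.{u}} {j : T ⟶ X} {θ : X ⟶ S}

/-- The open subset `U₀` of `X` meets the special fibre `π = 0`, and this fibre is integral: every
non-empty affine open subset `U` of `X` contains a non-empty basic open subset `D(h)` of `U₀` such
that `h` is a nonzerodivisor modulo `π`. -/
def MeetsFiber (θ : X ⟶ S) (π : Γ(S, ⊤)) (U₀ : X.Opens) : Prop :=
  ∀ U : X.Opens, IsAffineOpen U → (U : Set X).Nonempty → ∃ h : Γ(X, U),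
    X.basicOpen h ≤ U₀ ∧ (X.basicOpen h : Set X).Nonempty ∧
      ∀ a, θ.appLE ⊤ U (le_preimage_top θ U) π ∣ h * a → θ.appLE ⊤ U (le_preimage_top θ U) π ∣ a

/-- If `h` is a nonzerodivisor modulo `π`, then a function on `j⁻¹(D(h))` extends to `j⁻¹(U)` as
soon as a nonzero multiple of it does. -/
lemma exists_extension_of_mul [IsAffine S] [IsDomain Γ(S, ⊤)] [Flat j] [Flat θ] (hf : j ≫ θ = f)
    {π : Γ(S, ⊤)} (hπ : π ≠ 0) (hπ' : ∀ r : Γ(S, ⊤), r ≠ 0 → ∃ n, Associated (π ^ n) r)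
    {U : X.Opens} (hU : IsAffineOpen U) {t : Γ(X, U)}
    (ht : ∀ a, θ.appLE ⊤ U (le_preimage_top θ U) π ∣ t * a →
      θ.appLE ⊤ U (le_preimage_top θ U) π ∣ a)
    {r : Γ(S, ⊤)} (hr : r ≠ 0) (a : Γ(T, j ⁻¹ᵁ X.basicOpen t)) (a' : Γ(T, j ⁻¹ᵁ U))
    (h : f.appLE ⊤ _ (le_preimage_top f _) r * a =
      T.presheaf.map (homOfLE (j.preimage_mono (X.basicOpen_le t))).op a') :
    ∃ a'' : Γ(T, j ⁻¹ᵁ U),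
      T.presheaf.map (homOfLE (j.preimage_mono (X.basicOpen_le t))).op a'' = a := by
  have : Flat f := hf ▸ inferInstance
  have hreg (V : T.Opens) (s : Γ(T, V)) := eq_zero_of_flat_of_mul_eq_zero f (p := π)
    (fun a ha ↦ (mul_eq_zero.mp ha).resolve_left hπ) V s
  obtain ⟨n, v, rfl⟩ := hπ' r hr
  clear hr
  induction n generalizing a with
  | zero =>
    refine ⟨f.appLE ⊤ _ (le_preimage_top f _) ↑v⁻¹ * a', ?_⟩
    rw [map_mul, ← h, map_apply_appLE, ← mul_assoc, ← map_mul]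
    simp
  | succ n ih =>
    obtain ⟨b, hb⟩ := ih (f.appLE ⊤ _ (le_preimage_top f _) π * a) (by
      rw [← h, ← mul_assoc, ← map_mul]
      congr 2
      ring)
    obtain ⟨c, rfl⟩ : f.appLE ⊤ (j ⁻¹ᵁ U) (le_preimage_top f _) π ∣ b := by
      refine dvd_of_locally_dvd (fun V hV s hs ↦ hreg V s (by rwa [map_apply_appLE] at hs))
        fun x hx ↦ ?_
      obtain ⟨W, hW, hxW, hWU⟩ := TopologicalSpace.Opens.isBasis_iff_nbhd.mp T.isBasis_affineOpens
        hx
      refine ⟨W, hWU, hxW, ?_⟩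
      have e (V : T.Opens) (hV : V ≤ j ⁻¹ᵁ U) : f.appLE ⊤ V (le_preimage_top f _) π =
        j.appLE U V hV (θ.appLE ⊤ U (le_preimage_top θ U) π) :=
          (appLE_apply_appLE _ _ _ hf _ _ _ _ _ _ _).symm
      rw [map_apply_appLE, e W hWU]
      refine dvd_of_dvd_basicOpen j hU ht hW hWU _ (N := W ⊓ j ⁻¹ᵁ X.basicOpen t) inf_le_left
        inf_le_right le_rfl ?_
      have h₁ := congrArg (T.presheaf.map (homOfLE (inf_le_right : W ⊓ j ⁻¹ᵁ X.basicOpen t ≤ _)).op)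
        hb
      rw [map_mul, map_map_apply, map_apply_appLE] at h₁
      rw [← e, map_apply_appLE, map_map_apply, h₁]
      exact dvd_mul_right _ _
    refine ⟨c, sub_eq_zero.mp (hreg _ _ ?_)⟩
    rw [map_mul, map_apply_appLE] at hb
    rw [mul_sub, hb, sub_self]

/-- If `z = ∑ h^* wₖ • q^* nₖ` over `U₀` with linearly independent `nₖ`, then the `wₖ` are
restrictions of global functions on `T`. -/
lemma exists_global_of_sum_eq (hP : IsPullback h q f g) [IsAffine S] [IsAffine H] [Flat g]
    [IsDomain Γ(S, ⊤)] [IsPrincipalIdealRing Γ(S, ⊤)] [IsIntegral X] [Flat j] [QuasiCompact j]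
    [QuasiSeparated j] [Flat θ] (hf : j ≫ θ = f) {π : Γ(S, ⊤)} (hπ : π ≠ 0)
    (hπ' : ∀ r : Γ(S, ⊤), r ≠ 0 → ∃ n, Associated (π ^ n) r) {U₀ : X.Opens}
    (hU₀ : MeetsFiber θ π U₀) (z : Γ(Z, ⊤)) {κ : Type} [Fintype κ] (w : κ → Γ(T, j ⁻¹ᵁ U₀))
    (n : κ → Γ(H, ⊤))
    (hn : ∀ r : κ → Γ(S, ⊤), ∑ k, g.appLE ⊤ ⊤ (le_preimage_top g ⊤) (r k) * n k = 0 → r = 0)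
    (hz : Z.presheaf.map (homOfLE (le_top : h ⁻¹ᵁ j ⁻¹ᵁ U₀ ≤ ⊤)).op z = ∑ k,
      h.appLE _ _ le_rfl (w k) * q.appLE ⊤ _ (le_preimage_top q _) (n k)) (k : κ) :
    ∃ c : Γ(T, ⊤), T.presheaf.map (homOfLE le_top).op c = w k := by
  -- `s` extends `wₖ` if both agree over some non-empty open subset of `X`: as `X` is integral, this
  -- characterises `s`
  let P (V : T.Opens) (_ : V ≤ ⊤) (s : Γ(T, V)) : Prop :=
    ∃ (O : X.Opens) (hO : O ≤ U₀), (O : Set X).Nonempty ∧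
      T.presheaf.map (homOfLE (inf_le_left : V ⊓ j ⁻¹ᵁ O ≤ V)).op s =
        T.presheaf.map (homOfLE (inf_le_right.trans (j.preimage_mono hO) : V ⊓ j ⁻¹ᵁ O ≤ _)).op (w k)
  obtain ⟨c, hc⟩ : ∃ c : Γ(T, ⊤), ∀ x ∈ (⊤ : T.Opens), ∃ (V : T.Opens) (hV : V ≤ ⊤), x ∈ V ∧
      P V hV (T.presheaf.map (homOfLE hV).op c) := by
    refine fun_glue P ?_ ?_ ?_
    · rintro V W hV hW s ⟨O, hO, hO', h⟩
      refine ⟨O, hO, hO', ?_⟩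
      have := congrArg (T.presheaf.map (homOfLE (inf_le_inf_right (j ⁻¹ᵁ O) hW)).op) h
      simp only [map_map_apply] at this ⊢
      exact this
    · rintro V hV s t ⟨O, hO, hO', h⟩ ⟨O₁, hO₁, hO₁', h₁⟩
      refine sub_eq_zero.mp ?_
      have hOO : ((O ⊓ O₁ : X.Opens) : Set X).Nonempty := nonempty_preirreducible_inter O.2 O₁.2 hO' hO₁'
      refine eq_zero_of_flat_of_isIntegral j hOO _ (N := V ⊓ j ⁻¹ᵁ (O ⊓ O₁)) inf_le_left le_rfl ?_
      have e := congrArg (T.presheaf.map (homOfLE (inf_le_inf_left V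
        (j.preimage_mono (inf_le_left : O ⊓ O₁ ≤ O)))).op) h
      have e₁ := congrArg (T.presheaf.map (homOfLE (inf_le_inf_left V
        (j.preimage_mono (inf_le_right : O ⊓ O₁ ≤ O₁)))).op) h₁
      simp only [map_map_apply] at e e₁
      rw [map_sub, sub_eq_zero]
      exact e.trans e₁.symm
    · intro x _
      obtain ⟨U, hU, hxU, -⟩ := TopologicalSpace.Opens.isBasis_iff_nbhd.mp X.isBasis_affineOpens
        (show j x ∈ (⊤ : X.Opens) from trivial)
      obtain ⟨t, htU₀, htne, ht⟩ := hU₀ U hU ⟨_, hxU⟩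
      have hpush (O : X.Opens) (hO : IsAffineOpen O) := isPushout_of_isQuasiSeparated hP
        (W := j ⁻¹ᵁ O) (j.isCompact_preimage hO.isCompact)
        (j.isQuasiSeparated_preimage hO.isQuasiSeparated)
      have htU := X.basicOpen_le t
      obtain ⟨s, hs⟩ := exists_eq_of_isPushout (hpush _ (hU.basicOpen t)) (hpush U hU)
        (T.presheaf.map (homOfLE (j.preimage_mono htU)).op)
        (Z.presheaf.map (homOfLE (h.preimage_mono (j.preimage_mono htU))).op)
        (Scheme.Hom.appLE_map _ _ _) (by rw [Scheme.Hom.appLE_map, Scheme.Hom.map_appLE])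
        (Scheme.Hom.appLE_map _ _ _)
        (fun r a a' hr h ↦ exists_extension_of_mul hf hπ hπ' hU ht hr a a' h)
        (fun k ↦ T.presheaf.map (homOfLE (j.preimage_mono htU₀)).op (w k)) n hn
        (Z.presheaf.map (homOfLE le_top).op z) (by
          have := congrArg (Z.presheaf.map (homOfLE (h.preimage_mono (j.preimage_mono htU₀))).op) hz
          rw [map_map_apply] at this ⊢
          rw [this, map_sum]
          refine Finset.sum_congr rfl fun k _ ↦ ?_
          rw [map_mul, map_apply_appLE, map_apply_appLE, appLE_apply_map]) k
      refine ⟨j ⁻¹ᵁ U, le_top, hxU, s, X.basicOpen t, htU₀, htne, ?_⟩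
      have := congrArg (T.presheaf.map (homOfLE
        (inf_le_right : j ⁻¹ᵁ U ⊓ j ⁻¹ᵁ X.basicOpen t ≤ _)).op) hs
      simp only [map_map_apply] at this
      exact this
  refine ⟨c, fun_ext fun x hx ↦ ?_⟩
  obtain ⟨V, hV, hxV, O, hO, hO', h⟩ := hc x trivial
  refine ⟨V ⊓ j ⁻¹ᵁ U₀, inf_le_right, ⟨hxV, hx⟩, sub_eq_zero.mp ?_⟩
  refine eq_zero_of_flat_of_isIntegral j hO' _ (N := V ⊓ j ⁻¹ᵁ O)
    (inf_le_inf_left _ (j.preimage_mono hO)) (inf_le_inf_right _ inf_le_left) ?_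
  simp only [map_sub, map_map_apply, sub_eq_zero] at h ⊢
  exact h

/-- **Functions on `T × H`**, if the base `X` of `T` is integral and flat with integral special
fibre. -/
lemma appTop_bijective_of_meetsFiber (hP : IsPullback h q f g) [IsAffine S] [IsAffine H] [Flat g]
    [IsDomain Γ(S, ⊤)] [IsPrincipalIdealRing Γ(S, ⊤)] [IsIntegral X] [Flat j] [QuasiCompact j]
    [QuasiSeparated j] [Flat θ] (hf : j ≫ θ = f) {π : Γ(S, ⊤)} (hπ : π ≠ 0)
    (hπ' : ∀ r : Γ(S, ⊤), r ≠ 0 → ∃ n, Associated (π ^ n) r) {U₀ : X.Opens}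
    (hU₀ : MeetsFiber θ π U₀) (hU₀' : IsAffineOpen U₀) (hU₀'' : (U₀ : Set X).Nonempty)
    (hT : IsIso f.appTop) : Function.Bijective q.appTop := by
  have hT' := (ConcreteCategory.isIso_iff_bijective _).mp hT
  have hp := isPushout_of_isQuasiSeparated hP (W := j ⁻¹ᵁ U₀)
    (j.isCompact_preimage hU₀'.isCompact) (j.isQuasiSeparated_preimage hU₀'.isQuasiSeparated)
  have hflat : (g.appLE ⊤ ⊤ (le_preimage_top g ⊤)).hom.Flat :=
    g.flat_appLE (isAffineOpen_top S) (isAffineOpen_top H) _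
  have : Flat h := MorphismProperty.of_isPullback hP.flip inferInstance
  have : Flat (h ≫ j) := inferInstance
  constructor
  · have hinj : Function.Injective (f.appLE ⊤ (j ⁻¹ᵁ U₀) (le_preimage_top f _)) := by
      rw [injective_iff_map_eq_zero]
      intro r hr
      refine (map_eq_zero_iff f.appTop.hom hT'.1).mp ?_
      refine eq_zero_of_flat_of_isIntegral j hU₀'' (V := ⊤) (f.appTop r) (N := j ⁻¹ᵁ U₀) le_top
        inf_le_right ?_
      rw [appTop_apply, map_apply_appLE]
      exact hr
    refine Function.Injective.of_comp (f := Z.presheaf.map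
      (homOfLE (le_top : h ⁻¹ᵁ j ⁻¹ᵁ U₀ ≤ ⊤)).op) ?_
    convert injective_of_isPushout hp hflat hinj using 1
    funext x
    rw [Function.comp_apply, appTop_apply, map_apply_appLE]
  · intro z
    obtain ⟨κ, _, w, n, hz, hn⟩ := exists_sum_linearIndependent hp hflat
      (Z.presheaf.map (homOfLE (le_top : h ⁻¹ᵁ j ⁻¹ᵁ U₀ ≤ ⊤)).op z)
    choose c hc using exists_global_of_sum_eq hP hf hπ hπ' hU₀ z w n hn hz
    choose r hr using fun k ↦ hT'.2 (c k)
    refine ⟨∑ k, g.appLE ⊤ ⊤ (le_preimage_top g ⊤) (r k) * n k, sub_eq_zero.mp ?_⟩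
    refine eq_zero_of_flat_of_isIntegral (h ≫ j) hU₀'' (V := ⊤) _ (N := h ⁻¹ᵁ j ⁻¹ᵁ U₀) le_top
      inf_le_right ?_
    rw [map_sub, hz, sub_eq_zero, appTop_apply, map_apply_appLE, map_sum]
    refine Finset.sum_congr rfl fun k _ ↦ ?_
    rw [map_mul]
    congr 1
    rw [← hc, ← hr, appTop_apply, map_apply_appLE, appLE_apply_appLE h f (h ≫ f) rfl _ _ _ _ _
      (le_preimage_top _ _), appLE_apply_appLE q g (h ≫ f) hP.w.symm]

end Functions

section SpecialFiber

/-- The special fibre `F`, given by `π = 0`, of an integral scheme `X`: if it is integral, then it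
meets every sufficiently small affine open neighbourhood of one of its points. -/
lemma exists_meetsFiber {X S F K : Scheme.{u}} {θ : X ⟶ S} {ι : F ⟶ X} {q : F ⟶ K} {ρ : K ⟶ S}
    (hP : IsPullback ι q θ ρ) [IsAffine S] [IsAffine K] [IsIntegral X] [IsIntegral F]
    (hρ : Function.Surjective (ρ.appLE ⊤ ⊤ (le_preimage_top ρ ⊤))) {π : Γ(S, ⊤)}
    (hπ : ∀ r, ρ.appLE ⊤ ⊤ (le_preimage_top ρ ⊤) r = 0 ↔ π ∣ r) :
    ∃ U₀ : X.Opens, IsAffineOpen U₀ ∧ (U₀ : Set X).Nonempty ∧ MeetsFiber θ π U₀ := by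
  obtain ⟨y⟩ : Nonempty F := inferInstance
  obtain ⟨U₀, hU₀, hy, -⟩ := TopologicalSpace.Opens.isBasis_iff_nbhd.mp X.isBasis_affineOpens
    (show ι y ∈ (⊤ : X.Opens) from trivial)
  refine ⟨U₀, hU₀, ⟨_, hy⟩, fun U hU hne ↦ ?_⟩
  have hpush : IsPushout (θ.appLE ⊤ U (le_preimage_top θ U)) (ρ.appLE ⊤ ⊤ (le_preimage_top ρ ⊤))
      (ι.appLE U (ι ⁻¹ᵁ U) le_rfl) (q.appLE ⊤ (ι ⁻¹ᵁ U) (le_preimage_top q _)) :=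
    (isIso_pushoutSection_iff hP (le_preimage_top ρ ⊤) (le_preimage_top θ U)
      (inf_top_eq _).symm).mp (isIso_pushoutSection_of_isAffineOpen hP
        (le_preimage_top ρ ⊤) (le_preimage_top θ U) (inf_top_eq _).symm (isAffineOpen_top S)
        (isAffineOpen_top K) hU)
  have hker (a : Γ(X, U)) : ι.appLE U (ι ⁻¹ᵁ U) le_rfl a = 0 ↔
      θ.appLE ⊤ U (le_preimage_top θ U) π ∣ a := by
    refine ⟨dvd_of_isPushout hpush hρ (fun r hr ↦ (hπ r).mp hr), ?_⟩
    rintro ⟨b, rfl⟩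
    have e : ι.appLE U (ι ⁻¹ᵁ U) le_rfl (θ.appLE ⊤ U (le_preimage_top θ U) π) = 0 := by
      have := congr($(hpush.w) π)
      rw [CommRingCat.comp_apply, CommRingCat.comp_apply, (hπ π).mpr dvd_rfl, map_zero] at this
      exact this
    rw [map_mul, e, zero_mul]
  -- if `U` meets the special fibre, take `h` nonzero on the fibre, else `π` is a unit on `U`
  by_cases hF : ((ι ⁻¹ᵁ U : F.Opens) : Set F).Nonempty
  · obtain ⟨z, hz, hz₀⟩ := nonempty_preirreducible_inter (ι ⁻¹ᵁ U).2 (ι ⁻¹ᵁ U₀).2 hF ⟨y, hy⟩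
    obtain ⟨t, ht, hzt⟩ := hU.exists_basicOpen_le ⟨ι z, hz₀⟩ hz
    refine ⟨t, ht, ⟨_, hzt⟩, fun a ha ↦ ?_⟩
    have : Nonempty (ι ⁻¹ᵁ U : F.Opens) := ⟨⟨z, hz⟩⟩
    rw [← hker, map_mul] at ha
    refine (hker a).mp ((mul_eq_zero.mp ha).resolve_left fun h ↦ ?_)
    have hb : z ∈ F.basicOpen (ι.appLE U (ι ⁻¹ᵁ U) le_rfl t) := by
      rw [Scheme.basicOpen_appLE]
      exact ⟨hz, hzt⟩
    rw [h, Scheme.basicOpen_zero] at hb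
    exact hb
  · obtain ⟨z, hz, hz₀⟩ := nonempty_preirreducible_inter U.2 U₀.2 hne ⟨_, hy⟩
    obtain ⟨t, ht, hzt⟩ := hU.exists_basicOpen_le ⟨z, hz₀⟩ hz
    refine ⟨t, ht, ⟨_, hzt⟩, fun a _ ↦ (hker a).mp ?_⟩
    have hbot : ι ⁻¹ᵁ U = ⊥ := by
      ext w
      exact ⟨fun hw ↦ (hF ⟨w, hw⟩).elim, fun hw ↦ hw.elim⟩
    have : Subsingleton Γ(F, ι ⁻¹ᵁ U) := by
      rw [hbot]
      infer_instance
    exact Subsingleton.elim _ _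

variable (R : CommRingCat.{u}) [IsDomain R] [IsDiscreteValuationRing R]

/-- A uniformiser of a discrete valuation ring, as a function on its spectrum: every nonzero element
is associated to one of its powers, and it generates the kernel of the surjection onto the residue
field. -/
lemma exists_uniformizer : ∃ π : Γ(Spec R, ⊤), π ≠ 0 ∧ (∀ r ≠ 0, ∃ n, Associated (π ^ n) r) ∧
    (∀ r, ((Spec R).fromSpecResidueField (IsLocalRing.closedPoint R)).appLE ⊤ ⊤
      (le_preimage_top _ ⊤) r = 0 ↔ π ∣ r) ∧
    Function.Surjective (((Spec R).fromSpecResidueField (IsLocalRing.closedPoint R)).appLE ⊤ ⊤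
      (le_preimage_top _ ⊤)) := by
  obtain ⟨p, hp⟩ := IsDiscreteValuationRing.exists_irreducible R
  let e : R ≃+* Γ(Spec R, ⊤) := (Scheme.ΓSpecIso R).symm.commRingCatIsoToRingEquiv
  let x : Spec R := IsLocalRing.closedPoint R
  have hx : x.asIdeal.IsMaximal := inferInstanceAs (IsLocalRing.maximalIdeal R).IsMaximal
  let α : R ⟶ CommRingCat.of x.asIdeal.ResidueField := CommRingCat.ofHom (algebraMap R _)
  have hα : Function.Surjective α := Ideal.algebraMap_residueField_surjective x.asIdeal
  have hα' (r : R) : α r = 0 ↔ p ∣ r := by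
    refine Ideal.algebraMap_residueField_eq_zero.trans ?_
    change r ∈ IsLocalRing.maximalIdeal R ↔ _
    rw [hp.maximalIdeal_eq, Ideal.mem_span_singleton]
  let i := Scheme.Spec.residueFieldIso R x
  let f := (i.inv ≫ (Scheme.ΓSpecIso ((Spec R).residueField x)).inv)
  have hf : Function.Bijective f := (ConcreteCategory.isIso_iff_bijective f).mp inferInstance
  have key (r : R) : ((Spec R).fromSpecResidueField x).appLE ⊤ ⊤ (le_preimage_top _ ⊤) (e r) =
      f (α r) := by
    have h₁ : ((Spec R).fromSpecResidueField x).appLE ⊤ ⊤ (le_preimage_top _ ⊤) =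
        (Spec.map (α ≫ i.inv)).appTop := by
      have h₂ : Spec.map (α ≫ i.inv) = (Spec R).fromSpecResidueField x :=
        (Spec.map_comp _ _).trans (Scheme.Spec.map_residueFieldIso_inv_eq_fromSpecResidueField R x)
      rw [h₂]
      exact (Scheme.Hom.app_eq_appLE _).symm
    rw [h₁]
    exact congr($((Scheme.ΓSpecIso_inv_naturality (α ≫ i.inv)).symm) r)
  refine ⟨e p, (map_ne_zero_iff e e.injective).mpr hp.ne_zero, fun r hr ↦ ?_, fun r ↦ ?_,
    fun b ↦ ?_⟩
  · obtain ⟨r, rfl⟩ := e.surjective r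
    obtain ⟨n, hn⟩ := IsDiscreteValuationRing.associated_pow_irreducible
      ((map_ne_zero_iff e e.injective).mp hr) hp
    exact ⟨n, by simpa using (hn.symm.map e)⟩
  · obtain ⟨r, rfl⟩ := e.surjective r
    rw [key, map_dvd_iff e, ← hα', map_eq_zero_iff f.hom hf.1]
  · obtain ⟨c, rfl⟩ := hf.2 b
    obtain ⟨r, rfl⟩ := hα c
    exact ⟨_, key r⟩

end SpecialFiber

section FunctionsTorsor

variable {R : CommRingCat.{u}} [IsDomain R] [IsDiscreteValuationRing R]

/-- **Functions on `T × H`.** If `Γ(T, 𝒪_T) = R`, then `Γ(T × H, 𝒪) = Γ(H, 𝒪_H)` for every flat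
affine `R`-scheme `H`. -/
lemma snd_appTop_bijective {T X : Over (Spec R)} (j : T ⟶ X) [Flat j.left] [QuasiCompact j.left]
    [QuasiSeparated j.left] (hT : IsIso (str T).appTop)
    (hX : (CompactSpace X.left ∧ QuasiSeparatedSpace X.left) ∨
      (IsIntegral X.left ∧ Flat X.hom ∧ LocallyOfFiniteType X.hom ∧
        IsIntegral ((str X).fiber (IsLocalRing.closedPoint R))))
    (H : Over (Spec R)) [IsAffine H.left] [Flat H.hom] :
    Function.Bijective (snd T H).left.appTop := by
  have hP : IsPullback (fst T H).left (snd T H).left (str T) (str H) :=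
    IsPullback.of_hasPullback _ _
  have : Flat (str H) := ‹Flat H.hom›
  obtain ⟨_, _⟩ | ⟨_, hX', -, hF⟩ := hX
  · have : CompactSpace T.left := QuasiCompact.compactSpace_of_compactSpace j.left
    have : QuasiSeparatedSpace T.left := quasiSeparatedSpace_of_quasiSeparated j.left
    exact appTop_bijective_of_compactSpace hP hT
  · have : Flat (str X) := hX'
    obtain ⟨π, h₁, h₂, h₃, h₄⟩ := exists_uniformizer R
    have hP' : IsPullback ((str X).fiberι (IsLocalRing.closedPoint R))
        ((str X).fiberToSpecResidueField (IsLocalRing.closedPoint R)) (str X)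
        ((Spec R).fromSpecResidueField (IsLocalRing.closedPoint R)) :=
      IsPullback.of_hasPullback _ _
    obtain ⟨U₀, h₅, h₆, h₇⟩ := exists_meetsFiber hP' h₄ h₃
    let e : R ≃+* Γ(Spec R, ⊤) := (Scheme.ΓSpecIso R).symm.commRingCatIsoToRingEquiv
    have : IsDomain Γ(Spec R, ⊤) := MulEquiv.isDomain R e.symm.toMulEquiv
    have : IsPrincipalIdealRing Γ(Spec R, ⊤) := .of_surjective e.toRingHom e.surjective
    exact appTop_bijective_of_meetsFiber hP (str_w j) h₁ h₂ h₇ h₅ h₆ hT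

end FunctionsTorsor

/-! ### Bundles attached to free modules -/

section Tilde

variable {R : CommRingCat.{u}}

/-- The canonical section of `θ^* Ṽ` attached to an element of `V`. -/
noncomputable def globalSec (Y : Over (Spec R)) (V : ModuleCat.{u} R) (v : V) :
    Γ((pullTilde Y).obj V, ⊤) :=
  toSec Y V v

lemma isFrame_globalSec (Y : Over (Spec R)) {V : ModuleCat.{u} R} {I : Type u} [Fintype I]
    (b : Module.Basis I R V) :
    IsFrame ((pullTilde Y).obj V) ⊤ fun i ↦ globalSec Y V (b i) := by
  refine isFrame_of_bijective _ fun N ↦ ?_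
  have e : (fun (φ : (pullTilde Y).obj V ⟶ N) (i : I) ↦
      φ.app ⊤ (globalSec Y V (b i))) =
      (b.constr ℕ (M' := (sec Y).obj N)).symm ∘ ModuleCat.homEquiv ∘
        (pullTildeAdj Y).homEquiv V N := by
    funext φ i
    exact (homEquiv_apply φ (b i)).symm
  rw [e]
  exact (Equiv.bijective (b.constr ℕ).symm.toEquiv).comp
    (ModuleCat.homEquiv.bijective.comp (Equiv.bijective _))

/-- The sections of `θ^* Ṽ` are `Γ(Y, 𝒪_Y) ⊗ V`, if `V` is finite free. -/
lemma tensorToSec_bijective (Y : Over (Spec R)) (V : ModuleCat.{u} R) [Module.Free R V]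
    [Module.Finite R V] : Function.Bijective (tensorToSec Y V) := by
  let b := Module.Free.chooseBasis R V
  let b' := b.baseChange (GlobalFunctions Y)
  have h := isFrame_globalSec Y b ⊤ le_top
  have e : comb (fun i ↦ globalSec Y V (b i)) ⊤ le_top =
      tensorToSec Y V ∘ b'.equivFun.symm := by
    have e₁ (c : Module.Free.ChooseBasisIndex R V → GlobalFunctions Y) :
        tensorToSec Y V (b'.equivFun.symm c) = ∑ i, c i • toSec Y V (b i) := by
      rw [Module.Basis.equivFun_symm_apply, map_sum]
      refine Finset.sum_congr rfl fun i _ ↦ ?_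
      rw [map_smul, Module.Basis.baseChange_apply, tensorToSec_tmul, one_smul]
    funext c
    refine Eq.trans ?_ (e₁ c).symm
    refine Finset.sum_congr rfl fun i _ ↦ ?_
    exact congrArg (fun s : Γ((pullTilde Y).obj V, ⊤) ↦ (c i : Γ(Y.left, ⊤)) • s)
      (res_self _ _ le_rfl _)
  rw [e] at h
  exact (Function.Bijective.of_comp_iff _ b'.equivFun.symm.bijective).mp h

variable {Y Y' Y'' : Over (Spec R)} {V W U : ModuleCat.{u} R}

lemma tildeHom_injective [Module.Free R W] [Module.Finite R W]
    {a b : GlobalFunctions Y ⊗[R] V →ₗ[GlobalFunctions Y] GlobalFunctions Y ⊗[R] W}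
    (h : tildeHom a = tildeHom b) : a = b := by
  ext v
  apply (tensorToSec_bijective Y W).1
  have := congr((sec Y).map (show (pullTilde Y).obj V ⟶ (pullTilde Y).obj W from $h) (toSec Y V v))
  exact (sec_map_sheafHom_toSec a v).symm.trans (this.trans (sec_map_sheafHom_toSec b v))

lemma exists_tildeHom_eq [Module.Free R W] [Module.Finite R W]
    (φ : (Scheme.Modules.pullback (str Y)).obj ((tildeFunctor R).obj V) ⟶
      (Scheme.Modules.pullback (str Y)).obj ((tildeFunctor R).obj W)) :
    ∃ a : GlobalFunctions Y ⊗[R] V →ₗ[GlobalFunctions Y] GlobalFunctions Y ⊗[R] W,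
      tildeHom a = φ := by
  let ψ : (pullTilde Y).obj V ⟶ (pullTilde Y).obj W := φ
  let e := LinearEquiv.ofBijective _ (tensorToSec_bijective Y W)
  let l : V →ₗ[R] GlobalFunctions Y ⊗[R] W :=
    (e.symm.restrictScalars R).toLinearMap ∘ₗ ((sec Y).map ψ).hom ∘ₗ toSec Y V
  refine ⟨l.liftBaseChange (GlobalFunctions Y), ?_⟩
  refine pullTilde_hom_ext (φ := sheafHom (l.liftBaseChange (GlobalFunctions Y))) (ψ := ψ)
    fun v ↦ ?_
  rw [sec_map_sheafHom_toSec, LinearMap.liftBaseChange_tmul, one_smul]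
  exact e.apply_symm_apply _

/-- Base change along `f : Y' ⟶ Y` of a linear map `Γ(Y, 𝒪_Y) ⊗ V ⟶ Γ(Y, 𝒪_Y) ⊗ W`. -/
noncomputable def pullLin (f : Y' ⟶ Y)
    (a : GlobalFunctions Y ⊗[R] V →ₗ[GlobalFunctions Y] GlobalFunctions Y ⊗[R] W) :
    GlobalFunctions Y' ⊗[R] V →ₗ[GlobalFunctions Y'] GlobalFunctions Y' ⊗[R] W :=
  ((pullFunctions f).toLinearMap.rTensor W ∘ₗ a.restrictScalars R ∘ₗ
    TensorProduct.mk R _ V 1).liftBaseChange (GlobalFunctions Y')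

lemma pullLin_one_tmul (f : Y' ⟶ Y)
    (a : GlobalFunctions Y ⊗[R] V →ₗ[GlobalFunctions Y] GlobalFunctions Y ⊗[R] W) (v : V) :
    pullLin f a (1 ⊗ₜ v) = (pullFunctions f).toLinearMap.rTensor W (a (1 ⊗ₜ v)) := by
  rw [pullLin, LinearMap.liftBaseChange_tmul, one_smul]
  rfl

lemma rTensor_pullFunctions_smul (f : Y' ⟶ Y) (c : GlobalFunctions Y)
    (x : GlobalFunctions Y ⊗[R] V) : (pullFunctions f).toLinearMap.rTensor V (c • x) =
      pullFunctions f c • (pullFunctions f).toLinearMap.rTensor V x := by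
  induction x with
  | zero => simp
  | add x y hx hy => rw [smul_add, map_add, map_add, smul_add, hx, hy]
  | tmul b v => simp [TensorProduct.smul_tmul']

lemma pullLin_apply (f : Y' ⟶ Y)
    (a : GlobalFunctions Y ⊗[R] V →ₗ[GlobalFunctions Y] GlobalFunctions Y ⊗[R] W)
    (x : GlobalFunctions Y ⊗[R] V) :
    pullLin f a ((pullFunctions f).toLinearMap.rTensor V x) =
      (pullFunctions f).toLinearMap.rTensor W (a x) := by
  induction x with
  | zero => simp
  | add x y hx hy => simp only [map_add, hx, hy]
  | tmul b v =>
    have e : b ⊗ₜ[R] v = b • (1 ⊗ₜ v) := by rw [TensorProduct.smul_tmul', smul_eq_mul, mul_one]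
    have e₁ : (pullFunctions f).toLinearMap.rTensor V (1 ⊗ₜ v) = 1 ⊗ₜ v := by simp
    rw [e, rTensor_pullFunctions_smul, e₁, map_smul (pullLin f a), pullLin_one_tmul, map_smul a,
      rTensor_pullFunctions_smul]

lemma pullLin_id (f : Y' ⟶ Y) : pullLin f (LinearMap.id (M := GlobalFunctions Y ⊗[R] V)) =
    LinearMap.id := by
  ext v
  simp [pullLin_one_tmul]

lemma pullLin_comp (f : Y' ⟶ Y)
    (b : GlobalFunctions Y ⊗[R] W →ₗ[GlobalFunctions Y] GlobalFunctions Y ⊗[R] U)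
    (a : GlobalFunctions Y ⊗[R] V →ₗ[GlobalFunctions Y] GlobalFunctions Y ⊗[R] W) :
    pullLin f (b ∘ₗ a) = pullLin f b ∘ₗ pullLin f a := by
  ext v
  change pullLin f (b ∘ₗ a) (1 ⊗ₜ v) = pullLin f b (pullLin f a (1 ⊗ₜ v))
  rw [pullLin_one_tmul, pullLin_one_tmul, pullLin_apply]
  rfl

lemma rTensor_pullFunctions_comp (f : Y'' ⟶ Y') (g : Y' ⟶ Y) (x : GlobalFunctions Y ⊗[R] V) :
    (pullFunctions (f ≫ g)).toLinearMap.rTensor V x =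
      (pullFunctions f).toLinearMap.rTensor V ((pullFunctions g).toLinearMap.rTensor V x) := by
  have e : (pullFunctions (f ≫ g)).toLinearMap =
      (pullFunctions f).toLinearMap ∘ₗ (pullFunctions g).toLinearMap := by
    ext c
    exact congr($(Scheme.Hom.comp_appTop f.left g.left) c)
  rw [e, LinearMap.rTensor_comp]
  rfl

lemma pullLin_comp_left (f : Y'' ⟶ Y') (g : Y' ⟶ Y)
    (a : GlobalFunctions Y ⊗[R] V →ₗ[GlobalFunctions Y] GlobalFunctions Y ⊗[R] W) :
    pullLin (f ≫ g) a = pullLin f (pullLin g a) := by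
  ext v
  change pullLin (f ≫ g) a (1 ⊗ₜ v) = pullLin f (pullLin g a) (1 ⊗ₜ v)
  rw [pullLin_one_tmul, pullLin_one_tmul, pullLin_one_tmul, rTensor_pullFunctions_comp]

lemma pullLin_baseChange (f : Y' ⟶ Y) (l : V ⟶ W) :
    pullLin f (l.hom.baseChange (GlobalFunctions Y)) = l.hom.baseChange (GlobalFunctions Y') := by
  ext v
  change pullLin f (l.hom.baseChange (GlobalFunctions Y)) (1 ⊗ₜ v) = _
  rw [pullLin_one_tmul]
  simp

lemma pullLin_injective (f : Y' ⟶ Y) (hf : Function.Bijective f.left.appTop)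
    {a b : GlobalFunctions Y ⊗[R] V →ₗ[GlobalFunctions Y] GlobalFunctions Y ⊗[R] W}
    (h : pullLin f a = pullLin f b) : a = b := by
  let e : GlobalFunctions Y ≃ₐ[R] GlobalFunctions Y' := AlgEquiv.ofBijective (pullFunctions f) hf
  ext v
  apply (LinearEquiv.rTensor W e.toLinearEquiv).injective
  have := congr($h (1 ⊗ₜ v))
  rw [pullLin_one_tmul, pullLin_one_tmul] at this
  exact this

lemma exists_pullLin_eq (f : Y' ⟶ Y) (hf : Function.Bijective f.left.appTop)
    (a : GlobalFunctions Y' ⊗[R] V →ₗ[GlobalFunctions Y'] GlobalFunctions Y' ⊗[R] W) :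
    ∃ b, pullLin f b = a := by
  let e : GlobalFunctions Y ≃ₐ[R] GlobalFunctions Y' := AlgEquiv.ofBijective (pullFunctions f) hf
  let e' := LinearEquiv.rTensor W e.toLinearEquiv
  refine ⟨LinearMap.liftBaseChange (GlobalFunctions Y)
    (e'.symm.toLinearMap ∘ₗ a.restrictScalars R ∘ₗ TensorProduct.mk R _ V 1), ?_⟩
  ext v
  change pullLin f _ (1 ⊗ₜ v) = a (1 ⊗ₜ v)
  rw [pullLin_one_tmul, LinearMap.liftBaseChange_tmul, one_smul]
  exact e'.apply_symm_apply _

/-- If `R = Γ(Y, 𝒪_Y)`, then a `Γ(Y, 𝒪_Y)`-linear map `Γ(Y, 𝒪_Y) ⊗ V ⟶ Γ(Y, 𝒪_Y) ⊗ W` is the same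
as a linear map `V ⟶ W`. -/
lemma existsUnique_baseChange_eq (hY : IsIso (str Y).appTop)
    (a : GlobalFunctions Y ⊗[R] V →ₗ[GlobalFunctions Y] GlobalFunctions Y ⊗[R] W) :
    ∃! l : V ⟶ W, l.hom.baseChange (GlobalFunctions Y) = a := by
  have h : Function.Bijective (algebraMap R (GlobalFunctions Y)) :=
    (ConcreteCategory.isIso_iff_bijective ((Scheme.ΓSpecIso R).inv ≫ (str Y).appTop)).mp
      inferInstance
  let e : R ≃ₐ[R] GlobalFunctions Y := AlgEquiv.ofBijective (Algebra.ofId R _) h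
  let e' : W ≃ₗ[R] GlobalFunctions Y ⊗[R] W :=
    (TensorProduct.lid R W).symm ≪≫ₗ LinearEquiv.rTensor W e.toLinearEquiv
  have he (w : W) : e' w = 1 ⊗ₜ w := by
    simp [e', e]
  refine ⟨ModuleCat.ofHom (e'.symm.toLinearMap ∘ₗ a.restrictScalars R ∘ₗ
    TensorProduct.mk R _ V 1), ?_, fun l hl ↦ ?_⟩
  · ext v
    change 1 ⊗ₜ e'.symm (a (1 ⊗ₜ v)) = a (1 ⊗ₜ v)
    rw [← he, LinearEquiv.apply_symm_apply]
  · ext v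
    apply e'.injective
    change e' (l v) = e' (e'.symm (a (1 ⊗ₜ v)))
    rw [LinearEquiv.apply_symm_apply, he, ← hl]
    simp

end Tilde

/-! ### Representations and equivariant vector bundles -/

section Transport

lemma comm_of_transport_comm {P T Z : Scheme.{u}} {q : T ⟶ Z} {a b : P ⟶ T} {r : P ⟶ Z}
    (ha : a ≫ q = r) (hb : b ≫ q = r) {N N' : Z.Modules} (f : N ⟶ N')
    (α : (Scheme.Modules.pullback r).obj N ⟶ (Scheme.Modules.pullback r).obj N)
    (α' : (Scheme.Modules.pullback r).obj N' ⟶ (Scheme.Modules.pullback r).obj N')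
    (h : (Scheme.Modules.pullback a).map ((Scheme.Modules.pullback q).map f) ≫
      transport ha hb α' =
        transport ha hb α ≫ (Scheme.Modules.pullback b).map ((Scheme.Modules.pullback q).map f)) :
    (Scheme.Modules.pullback r).map f ≫ α' = α ≫ (Scheme.Modules.pullback r).map f := by
  have e₁ := (pcomp a q r ha).hom.naturality f
  have e₂ := (pcomp b q r hb).inv.naturality f
  dsimp at e₁ e₂
  simp only [transport, Category.assoc] at h
  rw [reassoc_of% e₁, ← e₂] at h
  rw [← cancel_epi ((pcomp a q r ha).hom.app N), ← cancel_mono ((pcomp b q r hb).inv.app N')]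
  simpa only [Category.assoc] using h

lemma transport_injective {P T Z : Scheme.{u}} {q : T ⟶ Z} {a b : P ⟶ T} {r : P ⟶ Z}
    (ha : a ≫ q = r) (hb : b ≫ q = r) {N : Z.Modules}
    {α β : (Scheme.Modules.pullback r).obj N ⟶ (Scheme.Modules.pullback r).obj N}
    (h : transport ha hb α = transport ha hb β) : α = β := by
  simpa only [transport, cancel_epi, cancel_mono] using h

lemma exists_transport_eq {P T Z : Scheme.{u}} {q : T ⟶ Z} {a b : P ⟶ T} {r : P ⟶ Z}
    (ha : a ≫ q = r) (hb : b ≫ q = r) {N : Z.Modules}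
    (β : (Scheme.Modules.pullback a).obj ((Scheme.Modules.pullback q).obj N) ⟶
      (Scheme.Modules.pullback b).obj ((Scheme.Modules.pullback q).obj N)) :
    ∃ α, transport ha hb α = β := by
  refine ⟨(pcomp a q r ha).inv.app N ≫ β ≫ (pcomp b q r hb).hom.app N, ?_⟩
  simp only [transport, Category.assoc, Iso.hom_inv_id_app, Iso.hom_inv_id_app_assoc]
  exact Category.comp_id β

lemma baseChange_comp {Y' Y X₁ X₂ X₃ : Scheme.{u}} {M₁ : X₁.Modules} {M₂ : X₂.Modules}
    {M₃ : X₃.Modules} {f₁ : Y ⟶ X₁} {f₂ : Y ⟶ X₂} {f₃ : Y ⟶ X₃}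
    (φ : (Scheme.Modules.pullback f₁).obj M₁ ⟶ (Scheme.Modules.pullback f₂).obj M₂)
    (ψ : (Scheme.Modules.pullback f₂).obj M₂ ⟶ (Scheme.Modules.pullback f₃).obj M₃)
    (g : Y' ⟶ Y) (k₁ : Y' ⟶ X₁) (k₂ : Y' ⟶ X₂) (k₃ : Y' ⟶ X₃) (h₁ : g ≫ f₁ = k₁)
    (h₂ : g ≫ f₂ = k₂) (h₃ : g ≫ f₃ = k₃) :
    baseChange (φ ≫ ψ) g k₁ k₃ h₁ h₃ = baseChange φ g k₁ k₂ h₁ h₂ ≫ baseChange ψ g k₂ k₃ h₂ h₃ := by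
  simp [baseChange]

lemma baseChange_map {Y' Y X : Scheme.{u}} {M N : X.Modules} {f : Y ⟶ X} (l : M ⟶ N)
    (g : Y' ⟶ Y) (k : Y' ⟶ X) (h : g ≫ f = k) :
    baseChange ((Scheme.Modules.pullback f).map l) g k k h h = (Scheme.Modules.pullback k).map l := by
  have e := (pcomp g f k h).hom.naturality l
  dsimp at e
  rw [baseChange, e, Iso.inv_hom_id_app_assoc]

end Transport

section

variable {R : CommRingCat.{u}}

lemma baseChange_tildeHom {Y' Y : Over (Spec R)} {V : ModuleCat.{u} R} (f : Y' ⟶ Y)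
    (hf : f.left ≫ str Y = str Y')
    (a : GlobalFunctions Y ⊗[R] V →ₗ[GlobalFunctions Y] GlobalFunctions Y ⊗[R] V) :
    baseChange (tildeHom a) f.left (str Y') (str Y') hf hf = tildeHom (pullLin f a) :=
  (baseChange_eq hf (tildeIso f V) (tildeIso_hom f hf V) (tildeHom a)).trans
    (tildeIso_tildeHom f a (pullLin f a) (pullLin_apply f a))

open MonObj

namespace LinearAction

variable {G : Over (Spec R)} [GrpObj G] {V : ModuleCat.{u} R}

lemma ρ_comp (a : LinearAction G V) {Y' Y : Over (Spec R)} (f : Y' ⟶ Y) (g : Y ⟶ G) :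
    a.ρ Y' (f ≫ g) = pullLin f (a.ρ Y g) := by
  ext v
  change a.ρ Y' (f ≫ g) (1 ⊗ₜ v) = pullLin f (a.ρ Y g) (1 ⊗ₜ v)
  rw [pullLin_one_tmul, ← a.natural]
  simp

/-- The representation of `G` given by the action `a` of the universal element of `G`. -/
noncomputable def ofUniversal
    (a b : GlobalFunctions G ⊗[R] V →ₗ[GlobalFunctions G] GlobalFunctions G ⊗[R] V)
    (hab : a ∘ₗ b = LinearMap.id)
    (ha : pullLin (fst G G * snd G G) a = pullLin (fst G G) a ∘ₗ pullLin (snd G G) a) :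
    LinearAction G V :=
  have mul (Y : Over (Spec R)) (g h : Y ⟶ G) :
      pullLin (g * h) a = pullLin g a ∘ₗ pullLin h a := by
    have e : g * h = lift g h ≫ (fst G G * snd G G) := by
      rw [MonObj.comp_mul, lift_fst, lift_snd]
    rw [e, pullLin_comp_left, ha, pullLin_comp, ← pullLin_comp_left, ← pullLin_comp_left, lift_fst,
      lift_snd]
  { ρ := fun _ g ↦ pullLin g a
    ρ_one := fun Y ↦ by
      -- an invertible idempotent is the identity
      have h₁ := mul Y 1 1
      have h₂ : pullLin (1 : Y ⟶ G) a ∘ₗ pullLin 1 b = LinearMap.id := by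
        rw [← pullLin_comp, hab, pullLin_id]
      have h₃ := congrArg (· ∘ₗ pullLin 1 b) h₁
      rw [_root_.mul_one, LinearMap.comp_assoc, h₂, LinearMap.comp_id] at h₃
      exact h₃.symm
    ρ_mul := mul
    natural := fun f g x ↦ by rw [pullLin_comp_left, pullLin_apply] }

end LinearAction

namespace FreeRep

variable {G : Over (Spec R)} [GrpObj G] {D : ActionDiagram (Spec R)} {g : D.P ⟶ G}
  {hg : D.prod ≫ g = (D.first ≫ g) * (D.second ≫ g)}

lemma toEquivariantSheaf_φ (V : FreeRep G) : ((toEquivariantSheaf g hg).obj V).φ.hom =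
    transport (act_str D) (pr_str D) (tildeHom (V.act.ρ D.P g)) := rfl

lemma toEquivariantSheaf_map {V W : FreeRep G} (f : V ⟶ W) :
    ((toEquivariantSheaf g hg).map f).hom =
      (Scheme.Modules.pullback (str D.T)).map ((tildeFunctor R).map (homLin V W f)) := rfl

/-- If `Γ(T, 𝒪_T) = R` and `Γ(T × G, 𝒪) = Γ(G, 𝒪_G)`, then morphisms of representations are the
same as morphisms of the associated equivariant sheaves. -/
lemma existsUnique_toEquivariantSheaf_map_eq (hT : IsIso (str D.T).appTop)
    (hP : Function.Bijective g.left.appTop) {V W : FreeRep G}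
    (ψ : (toEquivariantSheaf g hg).obj V ⟶ (toEquivariantSheaf g hg).obj W) :
    ∃! f : V ⟶ W, (toEquivariantSheaf g hg).map f = ψ := by
  have : Module.Free R W.mod := W.free
  have : Module.Finite R W.mod := W.finite
  obtain ⟨a, ha⟩ := exists_tildeHom_eq (Y := D.T) (V := V.mod) (W := W.mod) ψ.hom
  obtain ⟨l, hl, hl'⟩ := existsUnique_baseChange_eq hT a
  have h₁ : (Scheme.Modules.pullback (str D.T)).map ((tildeFunctor R).map l) = ψ.hom := by
    rw [← tildeHom_baseChange, hl, ha]
  have h₂ : (Scheme.Modules.pullback D.act.left).map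
      ((Scheme.Modules.pullback (str D.T)).map ((tildeFunctor R).map l)) ≫
        transport (act_str D) (pr_str D) (tildeHom (W.act.ρ D.P g)) =
      transport (act_str D) (pr_str D) (tildeHom (V.act.ρ D.P g)) ≫
        (Scheme.Modules.pullback D.pr.left).map
          ((Scheme.Modules.pullback (str D.T)).map ((tildeFunctor R).map l)) := by
    rw [h₁]
    exact ψ.comm
  have h₃ := comm_of_transport_comm _ _ _ _ _ h₂
  rw [← tildeHom_baseChange, ← tildeHom_comp, ← tildeHom_comp] at h₃
  have h₄ := tildeHom_injective h₃
  rw [← Category.comp_id g, V.act.ρ_comp, W.act.ρ_comp, ← pullLin_baseChange g, ← pullLin_comp,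
    ← pullLin_comp] at h₄
  have h₅ := pullLin_injective g hP h₄
  refine ⟨⟨l, fun Y h ↦ ?_⟩, EquivariantSheaf.hom_ext h₁, fun f hf ↦ hom_ext (hl' _ ?_)⟩
  · have := congrArg (pullLin h) h₅.symm
    rw [pullLin_comp, pullLin_comp, pullLin_baseChange, ← V.act.ρ_comp, ← W.act.ρ_comp,
      Category.comp_id] at this
    exact this
  · refine tildeHom_injective ((tildeHom_baseChange _ _).trans (Eq.trans ?_ ha.symm))
    exact (toEquivariantSheaf_map f).symm.trans congr(($hf).hom)

/-- If `Γ(T × G, 𝒪) = Γ(G, 𝒪_G)` and `Γ(T × G × G, 𝒪) = Γ(G × G, 𝒪)`, then a linearisation of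
`𝒪_T^n` comes from a representation of `G` on `R^n`. -/
lemma exists_toEquivariantSheaf_iso (hP : Function.Bijective g.left.appTop)
    (hQ : Function.Bijective (lift (D.first ≫ g) (D.second ≫ g)).left.appTop)
    (F : EquivariantSheaf D) {I : Type u} [Fintype I] (ε₀ : F.sheaf ≅ freeMod D.T.left I) :
    ∃ V, Nonempty ((toEquivariantSheaf g hg).obj V ≅ F) := by
  let V : ModuleCat.{u} R := ModuleCat.of R (I →₀ R)
  have : Module.Free R V := inferInstanceAs (Module.Free R (I →₀ R))
  have : Module.Finite R V := inferInstanceAs (Module.Finite R (I →₀ R))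
  obtain ⟨ε₁, -⟩ := exists_iso_of_isFrame _
    (isFrame_globalSec D.T (V := V) (Finsupp.basisSingleOne : Module.Basis I R (I →₀ R)))
  let ε : (Scheme.Modules.pullback (str D.T)).obj ((tildeFunctor R).obj V) ≅ F.sheaf :=
    (ε₀ ≪≫ ε₁).symm
  let β : (Scheme.Modules.pullback D.act.left).obj
      ((Scheme.Modules.pullback (str D.T)).obj ((tildeFunctor R).obj V)) ≅
      (Scheme.Modules.pullback D.pr.left).obj
      ((Scheme.Modules.pullback (str D.T)).obj ((tildeFunctor R).obj V)) :=
    (Scheme.Modules.pullback D.act.left).mapIso ε ≪≫ F.φ ≪≫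
      (Scheme.Modules.pullback D.pr.left).mapIso ε.symm
  obtain ⟨α, hα⟩ := exists_transport_eq (act_str D) (pr_str D) β.hom
  obtain ⟨α', hα'⟩ := exists_transport_eq (pr_str D) (act_str D) β.inv
  have hαα' : α' ≫ α = 𝟙 _ := by
    apply transport_injective (pr_str D) (pr_str D)
    rw [← transport_comp _ (act_str D), hα, hα', transport_id, β.inv_hom_id]
  obtain ⟨a, rfl⟩ := exists_tildeHom_eq α
  obtain ⟨a', rfl⟩ := exists_tildeHom_eq α'
  rw [← tildeHom_comp, ← tildeHom_id] at hαα'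
  have haa' := tildeHom_injective hαα'
  have conj {Y : Scheme.{u}} (f : Y ⟶ D.P.left) (k₁ k₂ : Y ⟶ D.T.left)
      (h₁ : f ≫ D.act.left = k₁) (h₂ : f ≫ D.pr.left = k₂) :
      baseChange β.hom f k₁ k₂ h₁ h₂ = (Scheme.Modules.pullback k₁).map ε.hom ≫
        baseChange F.φ.hom f k₁ k₂ h₁ h₂ ≫ (Scheme.Modules.pullback k₂).map ε.inv := by
    rw [← baseChange_map ε.hom f k₁ h₁, ← baseChange_map ε.inv f k₂ h₂, ← baseChange_comp,
      ← baseChange_comp]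
    rfl
  have hβ : baseChange β.hom D.prod.left (D.second.left ≫ D.act.left) (D.first.left ≫ D.pr.left)
      D.prod_act_left D.prod_pr_left =
      baseChange β.hom D.second.left (D.second.left ≫ D.act.left) (D.first.left ≫ D.act.left) rfl
        D.second_pr_left ≫
      baseChange β.hom D.first.left (D.first.left ≫ D.act.left) (D.first.left ≫ D.pr.left) rfl
        rfl := by
    rw [conj, conj, conj, F.cocycle]
    simp only [Category.assoc, ← Functor.map_comp_assoc, ε.inv_hom_id,
      CategoryTheory.Functor.map_id, Category.id_comp]
  have a₁ : (D.second.left ≫ D.act.left) ≫ str D.T = str D.Q := by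
    rw [Category.assoc, act_str, second_str]
  have a₂ : (D.first.left ≫ D.act.left) ≫ str D.T = str D.Q := by
    rw [Category.assoc, act_str, first_str]
  have a₃ : (D.first.left ≫ D.pr.left) ≫ str D.T = str D.Q := by
    rw [Category.assoc, pr_str, first_str]
  rw [← hα, baseChange_transport (act_str D) (pr_str D) _ _ _ _ _ _ _ (prod_str D) a₁ a₃,
    baseChange_transport (act_str D) (pr_str D) _ _ _ _ _ _ _ (second_str D) a₁ a₂,
    baseChange_transport (act_str D) (pr_str D) _ _ _ _ _ _ _ (first_str D) a₂ a₃,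
    transport_comp] at hβ
  have hβ' := transport_injective _ _ hβ
  rw [baseChange_tildeHom, baseChange_tildeHom, baseChange_tildeHom, ← tildeHom_comp] at hβ'
  have hβ'' := tildeHom_injective hβ'
  obtain ⟨a₀, rfl⟩ := exists_pullLin_eq g hP a
  obtain ⟨b₀, rfl⟩ := exists_pullLin_eq g hP a'
  have h₁ : a₀ ∘ₗ b₀ = LinearMap.id := by
    apply pullLin_injective g hP
    rw [pullLin_comp, haa', pullLin_id]
  have h₂ : pullLin (fst G G * snd G G) a₀ = pullLin (fst G G) a₀ ∘ₗ pullLin (snd G G) a₀ := by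
    apply pullLin_injective _ hQ
    rw [pullLin_comp, ← pullLin_comp_left, ← pullLin_comp_left, ← pullLin_comp_left,
      MonObj.comp_mul, lift_fst, lift_snd, ← hg, pullLin_comp_left, pullLin_comp_left,
      pullLin_comp_left, hβ'']
  let A : FreeRep G := ⟨V, inferInstance, inferInstance, LinearAction.ofUniversal a₀ b₀ h₁ h₂⟩
  have hA : ((toEquivariantSheaf g hg).obj A).φ.hom = β.hom :=
    (toEquivariantSheaf_φ A).trans hα
  refine ⟨A, ⟨EquivariantSheaf.isoMk ε ?_⟩⟩
  have h₃ : β.hom ≫ (Scheme.Modules.pullback D.pr.left).map ε.hom =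
      (Scheme.Modules.pullback D.act.left).map ε.hom ≫ F.φ.hom := by
    simp [β, ← Functor.map_comp]
  exact h₃.symm.trans (congrArg (· ≫ (Scheme.Modules.pullback D.pr.left).map ε.hom) hA.symm)

end FreeRep

end

section

variable {R : CommRingCat.{u}} {G T X : Over (Spec R)} [GrpObj G] {σ : RightAction G T}

/-- Functions on `T × G × G`, by the associativity of the product. -/
lemma lift_pairs_appTop_bijective (h : Function.Bijective (snd T (G ⊗ G)).left.appTop) :
    Function.Bijective
      (lift (σ.diagram.first ≫ snd T G) (σ.diagram.second ≫ snd T G)).left.appTop := by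
  have e : lift (σ.firstPair ≫ snd T G) (σ.secondPair ≫ snd T G) =
      (α_ T G G).hom ≫ snd T (G ⊗ G) := by
    ext1
    · simp [RightAction.firstPair]
    · simp [RightAction.secondPair]
  have e₁ : (lift (σ.firstPair ≫ snd T G) (σ.secondPair ≫ snd T G)).left.appTop =
      (snd T (G ⊗ G)).left.appTop ≫ (α_ T G G).hom.left.appTop := by
    rw [e, Over.comp_left, Scheme.Hom.comp_appTop]
  have h₀ {A B : Scheme.{u}} (f : A ⟶ B) (_ : IsIso f) : IsIso f.appTop :=
    inferInstanceAs (IsIso (f.app ⊤))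
  have h₀' : IsIso (α_ T G G).hom.left :=
    inferInstanceAs (IsIso ((Over.forget (Spec R)).map (α_ T G G).hom))
  have h₁ : Function.Bijective (α_ T G G).hom.left.appTop :=
    (ConcreteCategory.isIso_iff_bijective _).mp (h₀ _ h₀')
  change Function.Bijective
    (lift (σ.firstPair ≫ snd T G) (σ.secondPair ≫ snd T G)).left.appTop
  rw [e₁]
  exact h₁.comp h

lemma existsUnique_repToGVect_map_eq (hT : IsIso (str T).appTop)
    (hP : Function.Bijective (snd T G).left.appTop) {V W : FreeRep G}
    (ψ : (repToGVect σ).obj V ⟶ (repToGVect σ).obj W) :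
    ∃! f : V ⟶ W, (repToGVect σ).map f = ψ := by
  obtain ⟨f, hf, hf'⟩ := FreeRep.existsUnique_toEquivariantSheaf_map_eq (D := σ.diagram)
    (hg := σ.productPair_snd) hT hP ψ.hom
  exact ⟨f, ObjectProperty.hom_ext _ hf, fun f' h ↦ hf' f' congr(($h).hom)⟩

lemma exists_repToGVect_iso (hP : Function.Bijective (snd T G).left.appTop)
    (hQ : Function.Bijective (snd T (G ⊗ G)).left.appTop) (F : GVect σ) {n : ℕ}
    (ε : F.obj.sheaf ≅ freeMod T.left (ULift.{u} (Fin n))) :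
    ∃ V, Nonempty ((repToGVect σ).obj V ≅ F) := by
  obtain ⟨V, ⟨e⟩⟩ := FreeRep.exists_toEquivariantSheaf_iso (D := σ.diagram)
    (hg := σ.productPair_snd) hP (lift_pairs_appTop_bijective hQ) F.obj ε
  exact ⟨V, ⟨ObjectProperty.isoMk _ e⟩⟩

/-- If `j^* E` is isomorphic to the equivariant vector bundle attached to a representation, then
`j` trivialises `E`. -/
lemma isTrivializedBy_of_iso {j : T ⟶ X} {hj : σ.act ≫ j = fst T G ≫ j} {E : Vect X.left}
    {V : FreeRep G} (e : (pullbackVect j hj).obj E ≅ (repToGVect σ).obj V) :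
    IsTrivializedBy j E := by
  let b := (Module.Free.chooseBasis R V.V).reindex
    ((Fintype.equivFin _).trans Equiv.ulift.{u}.symm)
  obtain ⟨ε, -⟩ := exists_iso_of_isFrame _ (isFrame_globalSec T b)
  exact ⟨_, ⟨(ObjectProperty.ι _ ⋙ EquivariantSheaf.forget σ.diagram).mapIso e ≪≫ ε.symm⟩⟩

/-- If `j^*` is an equivalence and the functions on `T`, `T × G` and `T × G × G` are those on
`Spec R`, `G` and `G × G`, then representations of `G` are the same as vector bundles trivialised
by `j`. -/
lemma exists_isEquivalence_lift {j : T ⟶ X} {hj : σ.act ≫ j = fst T G ≫ j}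
    (hT : IsIso (str T).appTop) (hP : Function.Bijective (snd T G).left.appTop)
    (hQ : Function.Bijective (snd T (G ⊗ G)).left.appTop) (ρ : GVect σ ⥤ Vect X.left)
    (η : pullbackVect j hj ⋙ ρ ≅ 𝟭 _) (ε : ρ ⋙ pullbackVect j hj ≅ 𝟭 _) :
    ∃ h : ∀ V, IsTrivializedBy j ((repToGVect σ ⋙ ρ).obj V),
      ((IsTrivializedBy j).lift (repToGVect σ ⋙ ρ) h).IsEquivalence := by
  have hρ : ρ.IsEquivalence := .mk' (pullbackVect j hj) ε.symm η
  have : (repToGVect σ).Faithful :=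
    ⟨fun {_ _ _ _} h ↦ (existsUnique_repToGVect_map_eq hT hP _).unique h rfl⟩
  have : (repToGVect σ).Full := ⟨fun ψ ↦ (existsUnique_repToGVect_map_eq hT hP ψ).exists⟩
  refine ⟨fun V ↦ isTrivializedBy_of_iso (hj := hj) (ε.app _), ?_⟩
  refine { faithful := inferInstance, full := inferInstance, essSurj := ⟨fun E ↦ ?_⟩ }
  obtain ⟨n, ⟨α⟩⟩ := E.property
  obtain ⟨V, ⟨e⟩⟩ := exists_repToGVect_iso hP hQ ((pullbackVect j hj).obj E.obj) α
  exact ⟨V, ⟨ObjectProperty.isoMk _ (ρ.mapIso e ≪≫ η.app _)⟩⟩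

end

end TorsorRep

theorem mainTheorem4 (R : CommRingCat.{u}) [IsDomain R] [IsDiscreteValuationRing R]
    (G T X : Over (Spec R)) [GrpObj G] [IsAffine G.left] [Flat G.hom]
    (σ : TorsorRep.RightAction G T) (j : T ⟶ X) (hj : TorsorRep.IsTorsor σ j)
    (hT : IsIso (TorsorRep.str T).appTop)
    (hX : (CompactSpace X.left ∧ QuasiSeparatedSpace X.left) ∨
      (IsIntegral X.left ∧ Flat X.hom ∧ LocallyOfFiniteType X.hom ∧
        IsIntegral ((TorsorRep.str X).fiber (IsLocalRing.closedPoint R)))) :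
    (TorsorRep.pullbackVect j hj.invariant).IsEquivalence ∧
      ∀ ρ : TorsorRep.GVect σ ⥤ TorsorRep.Vect X.left,
        Nonempty (TorsorRep.pullbackVect j hj.invariant ⋙ ρ ≅ 𝟭 (TorsorRep.Vect X.left)) →
        Nonempty (ρ ⋙ TorsorRep.pullbackVect j hj.invariant ≅ 𝟭 (TorsorRep.GVect σ)) →
        ∃ h : ∀ V : TorsorRep.FreeRep G,
            TorsorRep.IsTrivializedBy j ((TorsorRep.repToGVect σ ⋙ ρ).obj V),
          ((TorsorRep.IsTrivializedBy j).lift (TorsorRep.repToGVect σ ⋙ ρ) h).IsEquivalence := by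
  have := hj.flat
  have := hj.quasiCompact
  have := hj.quasiSeparated
  have : IsAffine (G ⊗ G).left := inferInstanceAs (IsAffine (pullback G.hom G.hom))
  have : Flat (G ⊗ G).hom := inferInstanceAs (Flat (pullback.fst G.hom G.hom ≫ G.hom))
  exact ⟨hj.isEquivalence_pullbackVect, fun ρ ⟨η⟩ ⟨ε⟩ ↦ TorsorRep.exists_isEquivalence_lift hT
    (TorsorRep.snd_appTop_bijective j hT hX G) (TorsorRep.snd_appTop_bijective j hT hX (G ⊗ G))
    ρ η ε⟩
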